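/- All graphs are finite multigraphs without loops (parallel edges are allowed, so a cycle may consist of two vertices joined by two parallel edges). A length-function on a graph $G$ is a map $\ell : E(G) \to \mathbb{R}^+$ to the positive reals; the length of a subgraph $S$ is $\ell(S) := \sum_{e \in E(S)} \ell(e)$. The Steiner distance $\mathrm{sd}_G(A)$ of $A \subseteq V(G)$ is the minimum length of a connected subgraph of $G$ containing $A$ ($\infty$ if there is none). A subgraph $H \subseteq G$ is $k$-geodesic in $G$ if $\mathrm{sd}_H(A) = \mathrm{sd}_G(A)$ for every $A \subseteq V(H)$ with $|A| \le k$. Write $L(T)$ for the set of leaves (vertices of degree 1) of a tree $T$. A tree $T$ is a shortcut tree for a graph $H$, with respect to a length-function $\ell$ on $T \cup H$, if (1) $V(T) \cap V(H) = L(T)$; (2) $E(T) \cap E(H) = \emptyset$; (3) $\ell(T) < \mathrm{sd}_H(L(T))$; and (4) $\mathrm{sd}_H(B) \le \mathrm{sd}_T(B)$ for every $B \subsetneq L(T)$. For $k \in \{2, \dots, 6\}$ let $X_k = C_k \cup T_k$, where $C_k$ is the cycle $0, 1, \dots, k-1$ (a pair of parallel edges if $k = 2$) and $T_k$ is the following tree,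 edge-disjoint from $C_k$, with leaves $0, \dots, k-1$ and with the remaining vertices outside $C_k$: $T_2$ is a single edge $01$ (so $X_2$ has three parallel edges); $T_3$ is a star with centre $3$ and leaves $0,1,2$; $T_4$ has edges $40, 41, 52, 53, 54$; $T_5$ has edges $50, 51, 62, 63, 74, 75, 76$; $T_6$ has edges $60, 61, 72, 73, 84, 85, 96, 97, 98$. **Theorem.** Let $T$ be a shortcut tree for a cycle $C$ with respect to a length-function $\ell$ on $T \cup C$. Then, for some $k \in \{2,3,4,5,6\}$, $T$ has exactly $k$ leaves and $T \cup C$ is a subdivision of $X_k$, in which the edges of $C_k$ are replaced by paths in $C$ and the edges of $T_k$ by paths in $T$. In particular, $C$ is not $6$-geodesic in $T \cup C$. -/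

import Mathlib

open scoped Graph

namespace Graph

variable {α β α' β' : Type*}

/-- The union of two multigraphs. On an edge that belongs to both graphs the incidences of `G` are
used; for graphs that agree on their common edges (in particular for edge-disjoint ones) this is
the usual union. -/
instance : Union (Graph α β) where
  union G H :=
    { vertexSet := V(G) ∪ V(H)
      edgeSet := E(G) ∪ E(H)
      IsLink := fun e x y => G.IsLink e x y ∨ (e ∉ E(G) ∧ H.IsLink e x y)
      isLink_symm := fun e _ => ⟨fun x y h => h.imp (·.symm) (fun h => ⟨h.1, h.2.symm⟩)⟩
      eq_or_eq_of_isLink_of_isLink := by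
        rintro e x y v w (h | ⟨h₁, h⟩) (h' | ⟨h₂, h'⟩)
        · exact h.left_eq_or_eq h'
        · exact absurd h.edge_mem h₂
        · exact absurd h'.edge_mem h₁
        · exact h.left_eq_or_eq h'
      edge_mem_iff_exists_isLink := by
        intro e
        constructor
        · intro h
          by_cases he : e ∈ E(G)
          · obtain ⟨x, y, hxy⟩ := exists_isLink_of_mem_edgeSet he
            exact ⟨x, y, Or.inl hxy⟩
          · obtain ⟨x, y, hxy⟩ := exists_isLink_of_mem_edgeSet (h.resolve_left he)
            exact ⟨x, y, Or.inr ⟨he, hxy⟩⟩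
        · rintro ⟨x, y, h | h⟩
          · exact Or.inl h.edge_mem
          · exact Or.inr h.2.edge_mem
      left_mem_of_isLink := by
        rintro e x y (h | h)
        · exact Or.inl h.left_mem
        · exact Or.inr h.2.left_mem }

/-- A multigraph is connected if it is non-empty and any two of its vertices are joined by
a walk. -/
def IsConnected (G : Graph α β) : Prop :=
  V(G).Nonempty ∧ ∀ x ∈ V(G), ∀ y ∈ V(G), Relation.ReflTransGen G.Adj x y

/-- A cycle with `n ≥ 2` vertices; for `n = 2` it consists of two parallel edges. -/
def IsCycle (C : Graph α β) : Prop :=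
  ∃ (n : ℕ) (v : ZMod n → α) (e : ZMod n → β), 2 ≤ n ∧
    Function.Injective v ∧ Function.Injective e ∧
    V(C) = Set.range v ∧ E(C) = Set.range e ∧
    ∀ i, C.IsLink (e i) (v i) (v (i + 1))

/-- `P` is a path with end vertices `x` and `y`. -/
def IsPath (P : Graph α β) (x y : α) : Prop :=
  ∃ (n : ℕ) (v : Fin (n + 1) → α) (e : Fin n → β),
    Function.Injective v ∧ V(P) = Set.range v ∧ E(P) = Set.range e ∧
    (∀ i, P.IsLink (e i) (v i.castSucc) (v i.succ)) ∧
    v 0 = x ∧ v (Fin.last n) = y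

/-- A tree: a loopless connected multigraph without cycles as subgraphs. -/
def IsTree (T : Graph α β) : Prop :=
  T.Loopless ∧ T.IsConnected ∧ ∀ C : Graph α β, C ≤ T → ¬ C.IsCycle

/-- The leaves of `T`: the vertices of degree one, i.e. those incident with exactly one edge
(used for loopless graphs). -/
def leaves (T : Graph α β) : Set α :=
  {x | x ∈ V(T) ∧ ∃! e, T.Inc e x}

/-- The length of a finite graph: the sum of the lengths of its edges. -/
noncomputable def length (ℓ : β → ℝ) (G : Graph α β) : ℝ :=
  ∑ᶠ e ∈ E(G), ℓ e

/-- The Steiner distance of `A` within `G`: the least length of a connected subgraph of `G` that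
contains `A`, and `⊤` if there is none. -/
noncomputable def steinerDist (ℓ : β → ℝ) (G : Graph α β) (A : Set α) : EReal :=
  ⨅ (S : Graph α β) (_ : S ≤ G ∧ S.IsConnected ∧ A ⊆ V(S)), ((S.length ℓ : ℝ) : EReal)

/-- The subgraph `H` of `G` is `k`-geodesic in `G`: Steiner distances in `H` and in `G` agree for all sets of at most
`k` vertices of `H`. -/
def IsGeodesic (ℓ : β → ℝ) (k : ℕ) (H G : Graph α β) : Prop :=
  ∀ A : Set α, A ⊆ V(H) → A.encard ≤ k → H.steinerDist ℓ A = G.steinerDist ℓ A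

/-- `T` is a shortcut tree for `H` with respect to `ℓ`. -/
structure IsShortcutTree (ℓ : β → ℝ) (T H : Graph α β) : Prop where
  isTree : T.IsTree
  length_pos : ∀ e ∈ E(T ∪ H), 0 < ℓ e
  vert : V(T) ∩ V(H) = T.leaves
  edge : E(T) ∩ E(H) = ∅
  shorter : ((T.length ℓ : ℝ) : EReal) < H.steinerDist ℓ T.leaves
  minimal : ∀ B : Set α, B ⊂ T.leaves → H.steinerDist ℓ B ≤ T.steinerDist ℓ B

/-- A presentation of `G` as a subdivision of the loopless multigraph `X`: the vertices of `X` are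
mapped injectively to vertices of `G`, every edge of `X` is replaced by a path of `G` between the
images of its ends, these paths are edge-disjoint and have no inner vertices in common with each
other or with the images of vertices of `X`, and together they make up `G`. -/
structure Subdivision (X : Graph α' β') (G : Graph α β) where
  vert : α' → α
  path : β' → Graph α β
  vert_injOn : Set.InjOn vert V(X)
  path_le : ∀ e ∈ E(X), path e ≤ G
  isPath : ∀ e x y, X.IsLink e x y → (path e).IsPath (vert x) (vert y)
  inc_of_mem : ∀ e ∈ E(X), ∀ z ∈ V(X), vert z ∈ V(path e) → X.Inc e z
  vert_disjoint : ∀ e ∈ E(X), ∀ f ∈ E(X), e ≠ f → V(path e) ∩ V(path f) ⊆ vert '' V(X)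
  edge_disjoint : ∀ e ∈ E(X), ∀ f ∈ E(X), e ≠ f → Disjoint E(path e) E(path f)
  vertexSet_eq : V(G) = vert '' V(X) ∪ ⋃ e ∈ E(X), V(path e)
  edgeSet_eq : E(G) = ⋃ e ∈ E(X), E(path e)

/-- The multigraph with one edge for every entry of the list `l`: the `i`-th edge joins the two
numbers in the `i`-th entry. -/
def ofEdgeList (l : List (ℕ × ℕ)) : Graph ℕ ℕ where
  vertexSet := {x | ∃ p ∈ l, x = p.1 ∨ x = p.2}
  edgeSet := {i | i < l.length}
  IsLink i x y := l[i]? = some (x, y) ∨ l[i]? = some (y, x)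
  isLink_symm := fun _ _ => ⟨fun _ _ h => h.symm⟩
  eq_or_eq_of_isLink_of_isLink := by
    rintro e x y v w (h | h) (h' | h') <;> rw [h] at h' <;> simp at h' <;> tauto
  edge_mem_iff_exists_isLink := by
    intro i
    constructor
    · intro h
      exact ⟨l[i].1, l[i].2, Or.inl (List.getElem?_eq_getElem h)⟩
    · rintro ⟨x, y, h | h⟩ <;> exact (List.getElem?_eq_some_iff.1 h).1
  left_mem_of_isLink := by
    rintro i x y (h | h)
    · exact ⟨_, List.mem_of_getElem? h, Or.inl rfl⟩
    · exact ⟨_, List.mem_of_getElem? h, Or.inr rfl⟩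

/-- The edges of the cycle `0, 1, …, k - 1` (a pair of parallel edges for `k = 2`). -/
def cycleEdges (k : ℕ) : List (ℕ × ℕ) :=
  (List.range k).map fun i => (i, (i + 1) % k)

/-- The edges of the tree that is drawn inside the cycle `0, 1, …, k - 1`, which meets it precisely
in its leaves `0, 1, …, k - 1`, for `k = 2, …, 6`: a single edge, a star with three leaves, and the
trees obtained from that star by giving one, two or all three of its leaves two new neighbours
(for `k = 4` the remaining leaves of the star are `2` and `3`, and its centre is `5`). -/
def innerTreeEdges : ℕ → List (ℕ × ℕ)
  | 2 => [(0, 1)]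
  | 3 => [(3, 0), (3, 1), (3, 2)]
  | 4 => [(4, 0), (4, 1), (5, 2), (5, 3), (5, 4)]
  | 5 => [(5, 0), (5, 1), (6, 2), (6, 3), (7, 4), (7, 5), (7, 6)]
  | 6 => [(6, 0), (6, 1), (7, 2), (7, 3), (8, 4), (8, 5), (9, 6), (9, 7), (9, 8)]
  | _ => []

/-- For `k = 2, …, 6`, the union of the cycle `0, 1, …, k - 1` and the tree inside it. The edges of
the cycle are those numbered `0, …, k - 1`; the edges of the tree have numbers `k, k + 1, …`. -/
def cycleTree (k : ℕ) : Graph ℕ ℕ :=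
  ofEdgeList (cycleEdges k ++ innerTreeEdges k)

end Graph

/-! Measure positions on `C` by arc length; let `G` be the length of `C` and `t₀` that of `T`. Two
facts carry the argument. If a proper set `B` of leaves lies in a subtree of length `t`, then by (4)
it lies in a connected subgraph of `C` of length at most `t`. This subgraph is no longer than `T`,
so by (3) it misses some leaf `z`, and hence it contains, for any two points of `B`, the arc between
them that avoids `z`. Secondly, the gap between two cyclically consecutive leaves is shorter than `G
- t₀`, because the rest of `C` is an arc through all leaves and (3) applies to it. `ShortcutCircle`
records these facts and forgets the graphs.

Suppose that `T` is the union of two edge-disjoint subtrees that partition the leaves. Then their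
leaf sets lie on disjoint arcs (`ShortcutCircle.separate`): otherwise two arcs of total length at
most `t₀` would cover `C`, or all of `C` except one gap. Consequently no vertex of `T` has degree
four or more, since leaves taken from four directions could be paired so that the pairs cross
(`ShortcutCircle.not_four`). Moreover, if two subtrees are attached at either end of a path of `T`,
then one of the two sides has at most two leaves (`IsQuad.ncard_le_two_or`). Here the leaves form
four consecutive blocks, and the estimates for gaps and hulls are incompatible with those for the
two crossing pairs of blocks.

It follows that `T` is a path, or has a centre from which three branches with at most two leaves
each emanate (`isPath_or_exists_centre`). These are the shapes of `T_2`, …, `T_6`. Separation also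
makes the two leaves of a branch consecutive on `C`, so the cyclic order is the one in `X_k`, and
cutting `C` at the leaves yields the subdivision. Finally `T` itself is a connected subgraph of `T ∪
C` that contains its at most six leaves and is shorter than their Steiner distance in `C`. -/

namespace Graph

variable {α β : Type*} {G H X Y Z S T C P Q R : Graph α β} {ℓ : β → ℝ} {u v w x y z : α} {e f : β}

/-! ### Unions, lengths and Steiner distances -/

@[simp] lemma vertexSet_union : V(G ∪ H) = V(G) ∪ V(H) := rfl

@[simp] lemma edgeSet_union : E(G ∪ H) = E(G) ∪ E(H) := rfl

lemma le_union_left : G ≤ G ∪ H := ⟨Set.subset_union_left, fun _ _ _ h => Or.inl h⟩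

lemma Compatible.le_union_right (h : G.Compatible H) : H ≤ G ∪ H := by
  refine ⟨Set.subset_union_right, fun e x y he => ?_⟩
  by_cases heG : e ∈ E(G)
  · exact Or.inl ((h.isLink_congr heG he.edge_mem).2 he)
  · exact Or.inr ⟨heG, he⟩

lemma union_le (hX : X ≤ G) (hY : Y ≤ G) : X ∪ Y ≤ G := by
  refine ⟨Set.union_subset hX.vertexSet_mono hY.vertexSet_mono, fun e x y he => ?_⟩
  rcases he with he | he
  · exact he.mono hX
  · exact he.2.mono hY

lemma reflTransGen_mono (h : H ≤ G) (hxy : Relation.ReflTransGen H.Adj x y) :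
    Relation.ReflTransGen G.Adj x y :=
  Relation.ReflTransGen.mono (fun _ _ => Adj.mono h) _ _ hxy

lemma IsConnected.union (hX : X.IsConnected) (hY : Y.IsConnected) (h : X.Compatible Y)
    (hx : v ∈ V(X)) (hy : v ∈ V(Y)) : (X ∪ Y).IsConnected := by
  have hXl : X ≤ X ∪ Y := le_union_left
  have hYl : Y ≤ X ∪ Y := h.le_union_right
  have key : ∀ a ∈ V(X ∪ Y), Relation.ReflTransGen (X ∪ Y).Adj a v ∧
      Relation.ReflTransGen (X ∪ Y).Adj v a := by
    rintro a (ha | ha)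
    · exact ⟨reflTransGen_mono hXl (hX.2 a ha v hx), reflTransGen_mono hXl (hX.2 v hx a ha)⟩
    · exact ⟨reflTransGen_mono hYl (hY.2 a ha v hy), reflTransGen_mono hYl (hY.2 v hy a ha)⟩
  exact ⟨⟨v, Or.inl hx⟩, fun a ha b hb => (key a ha).1.trans (key b hb).2⟩

lemma length_mono (h : H ≤ G) (hE : E(G).Finite) (hpos : ∀ e ∈ E(G), 0 < ℓ e) :
    H.length ℓ ≤ G.length ℓ := by
  have hH := hE.subset h.edgeSet_mono
  unfold length
  rw [finsum_mem_eq_finite_toFinset_sum _ hE, finsum_mem_eq_finite_toFinset_sum _ hH]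
  refine Finset.sum_le_sum_of_subset_of_nonneg (by simpa using h.edgeSet_mono) fun e he _ => ?_
  exact (hpos e (by simpa using he)).le

lemma length_eq_add (hX : E(X).Finite) (hY : E(Y).Finite) (h : Disjoint E(X) E(Y))
    (hG : E(G) = E(X) ∪ E(Y)) : G.length ℓ = X.length ℓ + Y.length ℓ := by
  unfold length
  rw [hG, finsum_mem_union h hX hY]

lemma steinerDist_le {A : Set α} (hS : S ≤ G) (hc : S.IsConnected) (hA : A ⊆ V(S)) :
    G.steinerDist ℓ A ≤ (S.length ℓ : ℝ) :=
  iInf₂_le (f := fun (S : Graph α β) (_ : S ≤ G ∧ S.IsConnected ∧ A ⊆ V(S)) =>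
    ((S.length ℓ : ℝ) : EReal)) S ⟨hS, hc, hA⟩

/-- The length of a subgraph depends only on its edge set. With finitely many edges the infimum
therefore ranges over finitely many values and is attained. -/
lemma exists_steinerDist_eq {A : Set α} (hE : E(G).Finite) (hc : G.IsConnected) (hA : A ⊆ V(G)) :
    ∃ S ≤ G, S.IsConnected ∧ A ⊆ V(S) ∧ G.steinerDist ℓ A = (S.length ℓ : ℝ) := by
  let s : Set EReal := {r | ∃ S ≤ G, S.IsConnected ∧ A ⊆ V(S) ∧ r = (S.length ℓ : ℝ)}
  have hfin : s.Finite := by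
    refine ((hE.finite_subsets).image fun F => ((∑ᶠ e ∈ F, ℓ e : ℝ) : EReal)).subset ?_
    rintro _ ⟨S, hS, -, -, rfl⟩
    exact ⟨E(S), hS.edgeSet_mono, rfl⟩
  have hne : s.Nonempty := ⟨_, G, le_rfl, hc, hA, rfl⟩
  have hmem : sInf s ∈ s := hne.csInf_mem hfin
  have heq : G.steinerDist ℓ A = sInf s := by
    refine le_antisymm ?_ ?_
    · obtain ⟨S, hS, hSc, hAS, h⟩ := hmem
      rw [h]
      exact steinerDist_le hS hSc hAS
    · refine le_iInf₂ fun S hS => sInf_le ⟨S, hS.1, hS.2.1, hS.2.2, rfl⟩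
  rw [heq]
  exact hmem

/-- A set of vertices closed under adjacency contains every vertex joined to one of its elements. -/
lemma mem_of_reflTransGen {U : Set α} (hU : ∀ a ∈ U, ∀ b, G.Adj a b → b ∈ U) (hx : x ∈ U)
    (h : Relation.ReflTransGen G.Adj x y) : y ∈ U := by
  induction h with
  | refl => exact hx
  | tail _ hab ih => exact hU _ ih _ hab

lemma isConnected_noEdge (v : α) : (noEdge {v} β).IsConnected := by
  refine ⟨⟨v, rfl⟩, ?_⟩
  rintro x rfl y rfl
  exact .refl

end Graph

/-! ### Paths, walks, and splitting a tree at an edge -/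

namespace Graph

variable {α β : Type*} {G H X Y Z S T C P Q R : Graph α β} {ℓ : β → ℝ} {u v w x y z : α} {e f : β}

/-- The source of all subgraphs with prescribed vertices and edges. Requiring only the first end to
lie in `U` suffices, since `IsLink` is symmetric. -/
lemma exists_subgraph {U : Set α} {F : Set β} (hF : F ⊆ E(G)) (hU : U ⊆ V(G))
    (h : ∀ e ∈ F, ∀ x y, G.IsLink e x y → x ∈ U) : ∃ H ≤ G, V(H) = U ∧ E(H) = F := by
  refine ⟨(G.restrict F).induce U, ⟨hU, fun _ _ _ h => h.1.2⟩, rfl, ?_⟩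
  ext e
  rw [edgeSet_induce]
  constructor
  · rintro ⟨x, y, h, -⟩
    exact h.1
  · intro he
    obtain ⟨x, y, hxy⟩ := exists_isLink_of_mem_edgeSet (hF he)
    exact ⟨x, y, ⟨he, hxy⟩, h e he x y hxy, h e he y x hxy.symm⟩

/-- The sequences of `n + 1` distinct vertices and `n` edges traversing a path of `G`. -/
def IsPathSeq (G : Graph α β) (n : ℕ) (v : ℕ → α) (e : ℕ → β) : Prop :=
  Set.InjOn v (Set.Iic n) ∧ ∀ i < n, G.IsLink (e i) (v i) (v (i + 1))

/-- Indexing by natural numbers avoids casts between `Fin` types. Distinct ends guarantee an edge,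
which is needed to define the edge sequence beyond the end of the path. -/
lemma IsPath.exists_isPathSeq (h : P.IsPath x y) (hxy : x ≠ y) :
    ∃ (n : ℕ) (v : ℕ → α) (e : ℕ → β), 0 < n ∧ P.IsPathSeq n v e ∧
    V(P) = v '' Set.Iic n ∧ E(P) = e '' Set.Iio n ∧ v 0 = x ∧ v n = y := by
  obtain ⟨n, v, e, hv, hV, hE, hl, hx, hy⟩ := h
  have hn : 0 < n := by
    rcases Nat.eq_zero_or_pos n with rfl | hn
    · exact absurd (hx.symm.trans hy) hxy
    · exact hn
  have hval : ∀ i (hi : i < n + 1), Fin.ofNat (n + 1) i = ⟨i, hi⟩ := fun i hi =>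
    Fin.ext (Nat.mod_eq_of_lt hi)
  have hmod : ∀ i (hi : i < n), (⟨i % n, Nat.mod_lt _ hn⟩ : Fin n) = ⟨i, hi⟩ := fun i hi =>
    Fin.ext (Nat.mod_eq_of_lt hi)
  refine ⟨n, fun i => v (Fin.ofNat (n + 1) i), fun i => e ⟨i % n, Nat.mod_lt _ hn⟩, hn,
    ⟨?_, ?_⟩, ?_, ?_, ?_, ?_⟩
  · intro i hi j hj hij
    simp only [Set.mem_Iic] at hi hj
    have := hv hij
    rw [hval i (by omega), hval j (by omega)] at this
    simpa using this
  · intro i hi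
    simp only [hval i (by omega), hval (i + 1) (by omega), hmod i hi]
    exact hl ⟨i, hi⟩
  · rw [hV]; ext z
    constructor
    · rintro ⟨i, rfl⟩
      exact ⟨i, Nat.le_of_lt_succ i.2, by simp only [hval i i.2]⟩
    · rintro ⟨i, hi, rfl⟩
      exact ⟨_, rfl⟩
  · rw [hE]; ext z
    constructor
    · rintro ⟨i, rfl⟩
      exact ⟨i, i.2, by simp only [hmod i i.2]⟩
    · rintro ⟨i, hi, rfl⟩
      exact ⟨_, rfl⟩
  · rw [← hx]; simp only [hval 0 (by omega)]; rfl
  · rw [← hy]; simp only [hval n (by omega)]; rfl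

lemma IsPathSeq.isPath {n : ℕ} {v : ℕ → α} {e : ℕ → β} (h : P.IsPathSeq n v e)
    (hV : V(P) = v '' Set.Iic n) (hE : E(P) = e '' Set.Iio n) : P.IsPath (v 0) (v n) := by
  refine ⟨n, fun i => v i, fun i => e i, ?_, ?_, ?_, ?_, by simp, by simp⟩
  · intro i j hij
    exact Fin.ext (h.1 (by simp; omega) (by simp; omega) hij)
  · rw [hV]; ext z
    constructor
    · rintro ⟨i, hi, rfl⟩
      exact ⟨⟨i, by simp at hi; omega⟩, rfl⟩
    · rintro ⟨i, rfl⟩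
      exact ⟨i, by simp; omega, rfl⟩
  · rw [hE]; ext z
    constructor
    · rintro ⟨i, hi, rfl⟩
      exact ⟨⟨i, hi⟩, rfl⟩
    · rintro ⟨i, rfl⟩
      exact ⟨i, i.2, rfl⟩
  · intro i
    exact h.2 i i.2

lemma IsPathSeq.exists_isPath {n : ℕ} {v : ℕ → α} {e : ℕ → β} (h : G.IsPathSeq n v e)
    (h0 : v 0 ∈ V(G)) :
    ∃ P ≤ G, V(P) = v '' Set.Iic n ∧ E(P) = e '' Set.Iio n ∧ P.IsPath (v 0) (v n) := by
  have hU : v '' Set.Iic n ⊆ V(G) := by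
    rintro _ ⟨i, hi, rfl⟩
    rcases Nat.eq_zero_or_pos i with rfl | hi0
    · exact h0
    · have := (h.2 (i - 1) (by simp at hi; omega)).right_mem
      rwa [Nat.sub_add_cancel hi0] at this
  have hF : e '' Set.Iio n ⊆ E(G) := by
    rintro _ ⟨i, hi, rfl⟩
    exact (h.2 i hi).edge_mem
  obtain ⟨P, hP, hPV, hPE⟩ := exists_subgraph (G := G) hF hU (by
    rintro _ ⟨i, hi, rfl⟩ x y hxy
    simp only [Set.mem_Iio] at hi
    rcases hxy.left_eq_or_eq (h.2 i hi) with rfl | rfl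
    · exact ⟨i, by simp; omega, rfl⟩
    · exact ⟨i + 1, by simp; omega, rfl⟩)
  refine ⟨P, hP, hPV, hPE, IsPathSeq.isPath (e := e) ⟨h.1, fun i hi => ?_⟩ hPV hPE⟩
  exact (hP.isLink_iff (hPE ▸ ⟨i, hi, rfl⟩)).2 (h.2 i hi)

lemma IsPathSeq.reflTransGen {n : ℕ} {v : ℕ → α} {e : ℕ → β} (h : G.IsPathSeq n v e) {i j : ℕ}
    (hij : i ≤ j) (hj : j ≤ n) : Relation.ReflTransGen G.Adj (v i) (v j) := by
  induction j, hij using Nat.le_induction with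
  | base => exact .refl
  | succ j hij ih => exact (ih (by omega)).tail ⟨_, h.2 j (by omega)⟩

lemma reflTransGen_symm (h : Relation.ReflTransGen G.Adj x y) :
    Relation.ReflTransGen G.Adj y x := by
  induction h with
  | refl => exact .refl
  | tail _ hab ih => exact ih.head hab.symm

lemma IsPath.isConnected (h : P.IsPath x y) (hxy : x ≠ y) : P.IsConnected := by
  obtain ⟨n, v, e, hn, hs, hV, hE, rfl, rfl⟩ := h.exists_isPathSeq hxy
  refine ⟨⟨v 0, hV ▸ ⟨0, by simp, rfl⟩⟩, ?_⟩
  rw [hV]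
  rintro _ ⟨i, hi, rfl⟩ _ ⟨j, hj, rfl⟩
  rcases le_total i j with hij | hij
  · exact hs.reflTransGen hij hj
  · exact reflTransGen_symm (hs.reflTransGen hij hi)

lemma IsPath.left_mem (h : P.IsPath x y) : x ∈ V(P) := by
  obtain ⟨n, v, e, hv, hV, hE, hl, hx, hy⟩ := h
  exact hV ▸ ⟨_, hx⟩

lemma IsPath.right_mem (h : P.IsPath x y) : y ∈ V(P) := by
  obtain ⟨n, v, e, hv, hV, hE, hl, hx, hy⟩ := h
  exact hV ▸ ⟨_, hy⟩

lemma IsPath.symm (h : P.IsPath x y) : P.IsPath y x := by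
  obtain ⟨n, v, e, hv, hV, hE, hl, rfl, rfl⟩ := h
  refine ⟨n, fun i => v i.rev, fun i => e i.rev, hv.comp Fin.rev_injective, ?_, ?_, ?_, ?_, ?_⟩
  · rw [hV]; exact (Fin.rev_surjective.range_comp v).symm
  · rw [hE]; exact (Fin.rev_surjective.range_comp e).symm
  · intro i
    simp only [Fin.rev_castSucc, Fin.rev_succ]
    exact (hl i.rev).symm
  · simp
  · simp

/-- An inner vertex of a path is incident with two of its edges. -/
lemma IsPath.exists_two_inc (h : P.IsPath x y) (hz : z ∈ V(P)) (hzx : z ≠ x) (hzy : z ≠ y) :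
    ∃ e f, e ≠ f ∧ P.Inc e z ∧ P.Inc f z := by
  have hxy : x ≠ y := by
    rintro rfl
    obtain ⟨n, v, e, hv, hV, hE, hl, hx, hy⟩ := h
    have h0 := hv (hx.trans hy.symm)
    obtain ⟨i, rfl⟩ : z ∈ Set.range v := hV ▸ hz
    have h0 := congrArg Fin.val h0
    simp only [Fin.val_zero, Fin.val_last] at h0
    subst h0
    exact hzx (by rw [← hx]; congr 1; exact Fin.ext (by omega))
  obtain ⟨n, v, e, hn, hs, hV, hE, rfl, rfl⟩ := h.exists_isPathSeq hxy
  obtain ⟨i, hi, rfl⟩ : z ∈ v '' Set.Iic n := hV ▸ hz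
  simp only [Set.mem_Iic] at hi
  have hi0 : i ≠ 0 := fun h => hzx (h ▸ rfl)
  have hin : i ≠ n := fun h => hzy (h ▸ rfl)
  obtain ⟨j, rfl⟩ := Nat.exists_eq_succ_of_ne_zero hi0
  refine ⟨e j, e (j + 1), ?_, (hs.2 j (by omega)).inc_right, (hs.2 (j + 1) (by omega)).inc_left⟩
  intro heq
  have h1 := hs.2 j (by omega)
  have h2 := hs.2 (j + 1) (by omega)
  rw [heq] at h1
  rcases h1.left_eq_or_eq h2 with h | h
  · have := hs.1 (by simp; omega) (by simp; omega) h; omega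
  · have := hs.1 (by simp; omega) (by simp; omega) h; omega

lemma exists_isPath_of_isLink (h : G.IsLink e v w) (hvw : v ≠ w) :
    ∃ P ≤ G, V(P) = {v, w} ∧ E(P) = {e} ∧ P.IsPath v w := by
  have hs : G.IsPathSeq 1 (fun i => if i = 0 then v else w) (fun _ => e) := by
    constructor
    · intro i hi j hj hij
      simp only [Set.mem_Iic] at hi hj
      have hi' : i = 0 ∨ i = 1 := by omega
      have hj' : j = 0 ∨ j = 1 := by omega
      rcases hi' with rfl | rfl <;> rcases hj' with rfl | rfl <;> simp_all
    · intro i hi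
      obtain rfl : i = 0 := by omega
      simpa using h
  obtain ⟨P, hP, hV, hE, hp⟩ := hs.exists_isPath (by simpa using h.left_mem)
  refine ⟨P, hP, ?_, ?_, by simpa using hp⟩
  · rw [hV]; ext z; constructor
    · rintro ⟨i, hi, rfl⟩
      by_cases hi0 : i = 0 <;> simp [hi0]
    · rintro (rfl | rfl)
      · exact ⟨0, by simp⟩
      · exact ⟨1, by simp⟩
  · rw [hE]; ext z; constructor
    · rintro ⟨i, hi, rfl⟩; rfl
    · rintro rfl; exact ⟨0, by simp⟩

/-- The sequence `s` with `a` put in front. -/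
def consSeq {γ : Type*} (a : γ) (s : ℕ → γ) : ℕ → γ
  | 0 => a
  | i + 1 => s i

lemma IsPathSeq.cons {n : ℕ} {s : ℕ → α} {t : ℕ → β} (h : G.IsPathSeq n s t)
    (he : G.IsLink e v (s 0)) (hv : v ∉ s '' Set.Iic n) :
    G.IsPathSeq (n + 1) (consSeq v s) (consSeq e t) := by
  constructor
  · rintro (_ | i) hi (_ | j) hj hij
    · rfl
    · exact absurd ⟨j, by simp at hj ⊢; omega, hij.symm⟩ hv
    · exact absurd ⟨i, by simp at hi ⊢; omega, hij⟩ hv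
    · exact congrArg _ (h.1 (by simp at hi ⊢; omega) (by simp at hj ⊢; omega) hij)
  · rintro (_ | i) hi
    · exact he
    · exact h.2 i (by omega)

lemma image_consSeq_Iic {γ : Type*} (a : γ) (s : ℕ → γ) (n : ℕ) :
    consSeq a s '' Set.Iic (n + 1) = insert a (s '' Set.Iic n) := by
  ext z; constructor
  · rintro ⟨_ | i, hi, rfl⟩
    · exact Or.inl rfl
    · exact Or.inr ⟨i, by simp at hi ⊢; omega, rfl⟩
  · rintro (rfl | ⟨i, hi, rfl⟩)
    · exact ⟨0, by simp, rfl⟩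
    · exact ⟨i + 1, by simp at hi ⊢; omega, rfl⟩

lemma image_consSeq_Iio {γ : Type*} (a : γ) (s : ℕ → γ) (n : ℕ) :
    consSeq a s '' Set.Iio (n + 1) = insert a (s '' Set.Iio n) := by
  ext z; constructor
  · rintro ⟨_ | i, hi, rfl⟩
    · exact Or.inl rfl
    · exact Or.inr ⟨i, by simp at hi ⊢; omega, rfl⟩
  · rintro (rfl | ⟨i, hi, rfl⟩)
    · exact ⟨0, by simp, rfl⟩
    · exact ⟨i + 1, by simp at hi ⊢; omega, rfl⟩

lemma IsPath.exists_cons (hP : P.IsPath w x) (hwx : w ≠ x) (hPG : P ≤ G) (he : G.IsLink e v w)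
    (hv : v ∉ V(P)) :
    ∃ Q ≤ G, V(Q) = insert v V(P) ∧ E(Q) = insert e E(P) ∧ Q.IsPath v x := by
  obtain ⟨n, s, t, hn, hs, hV, hE, rfl, rfl⟩ := hP.exists_isPathSeq hwx
  have hs' : G.IsPathSeq n s t := ⟨hs.1, fun i hi => (hs.2 i hi).mono hPG⟩
  obtain ⟨Q, hQ, hQV, hQE, hQp⟩ := (hs'.cons he (hV ▸ hv)).exists_isPath he.left_mem
  exact ⟨Q, hQ, by rw [hQV, image_consSeq_Iic, hV], by rw [hQE, image_consSeq_Iio, hE], hQp⟩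

/-- Induction from the front of the walk: a new first vertex is put in front of the path already
found, unless it lies on that path, in which case the initial part is dropped. `Nonempty β` only
serves to name an edge sequence for the trivial path. -/
lemma exists_isPathSeq_of_reflTransGen [Nonempty β] (h : Relation.ReflTransGen G.Adj x y) :
    ∃ (n : ℕ) (v : ℕ → α) (e : ℕ → β), G.IsPathSeq n v e ∧ v 0 = x ∧ v n = y := by
  induction h using Relation.ReflTransGen.head_induction_on with
  | refl =>
    refine ⟨0, fun _ => y, fun _ => Classical.arbitrary β, ⟨?_, fun i hi => by omega⟩, rfl, rfl⟩
    intro i hi j hj _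
    simp at hi hj; omega
  | @head a b hab _ ih =>
    obtain ⟨n, v, e, hs, rfl, rfl⟩ := ih
    obtain ⟨e₀, he₀⟩ := hab
    by_cases ha : a ∈ v '' Set.Iic n
    · obtain ⟨i, hi, rfl⟩ := ha
      simp only [Set.mem_Iic] at hi
      refine ⟨n - i, fun j => v (i + j), fun j => e (i + j), ⟨?_, ?_⟩, rfl, ?_⟩
      · intro j hj k hk hjk
        simp only [Set.mem_Iic] at hj hk
        have := hs.1 (by simp; omega) (by simp; omega) hjk
        omega
      · intro j hj
        exact hs.2 (i + j) (by omega)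
      · simp only; congr 1; omega
    · exact ⟨n + 1, consSeq a v, consSeq e₀ e, hs.cons he₀ ha, rfl, rfl⟩

lemma isCycle_of_seq {n : ℕ} (hn : 2 ≤ n) {v : ℕ → α} {e : ℕ → β} (hv : Set.InjOn v (Set.Iio n))
    (he : Set.InjOn e (Set.Iio n)) (hV : V(C) = v '' Set.Iio n) (hE : E(C) = e '' Set.Iio n)
    (hl : ∀ i < n, C.IsLink (e i) (v i) (v ((i + 1) % n))) : C.IsCycle := by
  have : NeZero n := ⟨by omega⟩
  have : Fact (1 < n) := ⟨by omega⟩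
  refine ⟨n, fun i => v i.val, fun i => e i.val, hn, ?_, ?_, ?_, ?_, ?_⟩
  · intro i j hij
    exact ZMod.val_injective n (hv (ZMod.val_lt i) (ZMod.val_lt j) hij)
  · intro i j hij
    exact ZMod.val_injective n (he (ZMod.val_lt i) (ZMod.val_lt j) hij)
  · rw [hV]
    ext z; constructor
    · rintro ⟨i, hi, rfl⟩
      exact ⟨(i : ZMod n), by simp only [ZMod.val_natCast, Nat.mod_eq_of_lt hi]⟩
    · rintro ⟨i, rfl⟩
      exact ⟨i.val, ZMod.val_lt i, rfl⟩
  · rw [hE]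
    ext z; constructor
    · rintro ⟨i, hi, rfl⟩
      exact ⟨(i : ZMod n), by simp only [ZMod.val_natCast, Nat.mod_eq_of_lt hi]⟩
    · rintro ⟨i, rfl⟩
      exact ⟨i.val, ZMod.val_lt i, rfl⟩
  · intro i
    have := hl i.val (ZMod.val_lt i)
    simpa only [ZMod.val_add, ZMod.val_one] using this

/-- The ends of an edge of a tree are not joined by a walk that avoids the edge. -/
lemma IsTree.not_reflTransGen_deleteEdges (hT : T.IsTree) (he : T.IsLink e v w) :
    ¬ Relation.ReflTransGen (T.deleteEdges {e}).Adj v w := by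
  intro h
  have := hT.1
  have : Nonempty β := ⟨e⟩
  obtain ⟨n, s, t, hs, rfl, rfl⟩ := exists_isPathSeq_of_reflTransGen h
  have hne := he.ne
  have hn : 0 < n := by
    rcases Nat.eq_zero_or_pos n with rfl | hn
    · exact absurd rfl hne
    · exact hn
  have hl : ∀ i < n, T.IsLink (t i) (s i) (s (i + 1)) ∧ t i ≠ e := fun i hi => by
    simpa using hs.2 i hi
  -- The path avoiding `e` is closed up by `e` at index `n`. Since `n > 0`, this gives a cycle with
  -- `n + 1 ≥ 2` vertices.
  let t' : ℕ → β := fun i => if i < n then t i else e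
  have hl' : ∀ i < n + 1, T.IsLink (t' i) (s i) (s ((i + 1) % (n + 1))) := by
    intro i hi
    by_cases hin : i < n
    · rw [Nat.mod_eq_of_lt (by omega)]
      simp only [t', hin, if_true]
      exact (hl i hin).1
    · obtain rfl : i = n := by omega
      simpa [t'] using he.symm
  have hIio : Set.Iio (n + 1) = Set.Iic n := by ext; simp
  obtain ⟨C, hC, hCV, hCE⟩ := exists_subgraph (G := T) (U := s '' Set.Iio (n + 1))
    (F := t' '' Set.Iio (n + 1)) (by
      rintro _ ⟨i, hi, rfl⟩
      exact (hl' i hi).edge_mem) (by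
      rintro _ ⟨i, hi, rfl⟩
      exact (hl' i hi).left_mem) (by
      rintro _ ⟨i, hi, rfl⟩ x y hxy
      rcases hxy.left_eq_or_eq (hl' i hi) with rfl | rfl
      · exact ⟨i, hi, rfl⟩
      · exact ⟨_, Nat.mod_lt _ (by omega), rfl⟩)
  refine hT.2.2 C hC (isCycle_of_seq (n := n + 1) (v := s) (e := t') (by omega) (hIio ▸ hs.1) ?_
    hCV hCE fun i hi => (hC.isLink_iff (hCE ▸ ⟨i, hi, rfl⟩)).2 (hl' i hi))
  intro i hi j hj hij
  simp only [Set.mem_Iio] at hi hj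
  -- Equal edges of the path have the same pair of ends. As the vertices are distinct, a match in
  -- reverse would force `i = j + 1` and `i + 1 = j`. The closing edge `e` was deleted, so it is not
  -- on the path.
  by_cases hin : i < n <;> by_cases hjn : j < n <;>
    simp only [t', hin, hjn, if_true, if_false] at hij
  · have h1 := (hl i hin).1
    have h2 := (hl j hjn).1
    rw [hij] at h1
    rcases h1.eq_and_eq_or_eq_and_eq h2 with ⟨h, -⟩ | ⟨h, h'⟩
    · exact hs.1 (by simp; omega) (by simp; omega) h
    · have := hs.1 (by simp; omega) (by simp; omega) h
      have := hs.1 (by simp; omega) (by simp; omega) h'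
      omega
  · exact absurd hij (hl i hin).2
  · exact absurd hij.symm (hl j hjn).2
  · omega

lemma IsTree.of_le (hT : T.IsTree) (hX : X ≤ T) (hc : X.IsConnected) : X.IsTree :=
  ⟨⟨fun e x h => hT.1.not_isLoopAt e x (h.mono hX)⟩, hc, fun C hC => hT.2.2 C (hC.trans hX)⟩

/-- The component of `v`. After the deletion of an edge of a tree, the components of its two ends
are the two pieces. -/
lemma exists_component (hv : v ∈ V(G)) : ∃ A ≤ G, A.IsConnected ∧
    V(A) = {y | Relation.ReflTransGen G.Adj v y} ∧ E(A) = {f | ∃ x ∈ V(A), G.Inc f x} := by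
  obtain ⟨A, hA, hAV, hAE⟩ := exists_subgraph (G := G)
    (U := {y | Relation.ReflTransGen G.Adj v y})
    (F := {f | ∃ x ∈ {y | Relation.ReflTransGen G.Adj v y}, G.Inc f x}) (by
      rintro f ⟨x, -, hx⟩; exact hx.edge_mem) (by
      intro y hy
      exact mem_of_reflTransGen (fun a _ b hab => hab.right_mem) hv hy) (by
      rintro f ⟨x, hx, y, hxy⟩ a b hab
      rcases hab.left_eq_or_eq hxy with rfl | rfl
      · exact hx
      · exact Relation.ReflTransGen.tail hx ⟨f, hxy⟩)
  have key : ∀ y, Relation.ReflTransGen G.Adj v y → Relation.ReflTransGen A.Adj v y := by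
    intro y hy
    induction hy with
    | refl => exact .refl
    | tail hva hab ih =>
      obtain ⟨f, hf⟩ := hab
      refine ih.tail ⟨f, (hA.isLink_iff ?_).2 hf⟩
      rw [hAE]
      exact ⟨_, hva, hf.inc_left⟩
  refine ⟨A, hA, ⟨⟨v, ?_⟩, ?_⟩, hAV, by rw [hAE, hAV]⟩
  · rw [hAV]; exact .refl
  · rw [hAV]
    intro x hx y hy
    exact (reflTransGen_symm (key x hx)).trans (key y hy)

/-- Deleting an edge of a tree leaves two connected pieces. -/
lemma IsTree.exists_split (hT : T.IsTree) (he : T.IsLink e v w) :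
    ∃ A B, A ≤ T ∧ B ≤ T ∧ A.IsConnected ∧ B.IsConnected ∧ v ∈ V(A) ∧ w ∈ V(B) ∧
      Disjoint V(A) V(B) ∧ Disjoint E(A) E(B) ∧ e ∉ E(A) ∧ e ∉ E(B) ∧
      V(T) = V(A) ∪ V(B) ∧ E(T) = insert e (E(A) ∪ E(B)) := by
  have hle : T.deleteEdges {e} ≤ T := deleteEdges_le
  obtain ⟨A, hA, hAc, hAV, hAE⟩ := exists_component (G := T.deleteEdges {e}) (v := v) he.left_mem
  obtain ⟨B, hB, hBc, hBV, hBE⟩ := exists_component (G := T.deleteEdges {e}) (v := w) he.right_mem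
  have hvA : v ∈ V(A) := by rw [hAV]; exact .refl
  have hwB : w ∈ V(B) := by rw [hBV]; exact .refl
  have hdisj : Disjoint V(A) V(B) := by
    rw [Set.disjoint_left, hAV, hBV]
    intro z hz hz'
    exact hT.not_reflTransGen_deleteEdges he
      (Relation.ReflTransGen.trans hz (reflTransGen_symm hz'))
  have hVT : V(T) = V(A) ∪ V(B) := by
    refine Set.Subset.antisymm ?_ (Set.union_subset (hA.trans hle).vertexSet_mono
      (hB.trans hle).vertexSet_mono)
    intro z hz
    refine mem_of_reflTransGen (G := T) ?_ (Or.inl hvA) (hT.2.1.2 v he.left_mem z hz)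
    rintro a ha b ⟨f, hf⟩
    by_cases hfe : f = e
    · subst hfe
      rcases hf.right_eq_or_eq he with rfl | rfl
      · exact Or.inl hvA
      · exact Or.inr hwB
    · have hf' : (T.deleteEdges {e}).Adj a b := ⟨f, by simpa using ⟨hf, hfe⟩⟩
      rcases ha with ha | ha
      · left; rw [hAV] at ha ⊢; exact Relation.ReflTransGen.tail ha hf'
      · right; rw [hBV] at ha ⊢; exact Relation.ReflTransGen.tail ha hf'
  have heA : e ∉ E(A) := fun h => by simpa using hA.edgeSet_mono h
  have heB : e ∉ E(B) := fun h => by simpa using hB.edgeSet_mono h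
  refine ⟨A, B, hA.trans hle, hB.trans hle, hAc, hBc, hvA, hwB, hdisj, ?_, heA, heB, hVT, ?_⟩
  · rw [Set.disjoint_left]
    intro f hfA hfB
    obtain ⟨x, y, hxy⟩ := exists_isLink_of_mem_edgeSet hfA
    have hxB := ((hB.isLink_iff hfB).2 (hxy.mono hA)).left_mem
    exact Set.disjoint_left.1 hdisj hxy.left_mem hxB
  · refine Set.Subset.antisymm ?_ ?_
    · intro f hf
      by_cases hfe : f = e
      · exact Or.inl hfe
      right
      obtain ⟨x, y, hxy⟩ := exists_isLink_of_mem_edgeSet hf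
      have hi : (T.deleteEdges {e}).Inc f x := by simpa using ⟨hxy.inc_left, hfe⟩
      have hx : x ∈ V(A) ∪ V(B) := hVT ▸ hxy.left_mem
      rcases hx with hx | hx
      · left; rw [hAE]; exact ⟨x, hx, hi⟩
      · right; rw [hBE]; exact ⟨x, hx, hi⟩
    · rintro f (rfl | hf | hf)
      · exact he.edge_mem
      · exact (hA.trans hle).edgeSet_mono hf
      · exact (hB.trans hle).edgeSet_mono hf

end Graph

/-! ### Bushes and branches of a tree -/

namespace Graph

variable {α β : Type*} {G H X Y Z S T C P Q R : Graph α β} {ℓ : β → ℝ} {u v w x y z : α} {e f : β}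

/-- `X` is a connected subgraph of `T` attached to the rest of `T` at most at the vertex `v`. -/
structure IsBush (T X : Graph α β) (v : α) : Prop where
  le : X ≤ T
  isConnected : X.IsConnected
  mem : v ∈ V(X)
  closed : ∀ y ∈ V(X), y ≠ v → ∀ e, T.Inc e y → e ∈ E(X)

/-- A bush with exactly one edge at its vertex of attachment. -/
structure IsBranch (T X : Graph α β) (v : α) : Prop extends IsBush T X v where
  existsUnique : ∃! e, X.Inc e v

/-- `G` arises from its subgraphs `X` and `Y` by gluing them at the vertex `v`. -/
structure Glue (G X Y : Graph α β) (v : α) : Prop where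
  left_le : X ≤ G
  right_le : Y ≤ G
  vertexSet_eq : V(G) = V(X) ∪ V(Y)
  edgeSet_eq : E(G) = E(X) ∪ E(Y)
  inter_eq : V(X) ∩ V(Y) = {v}
  disjoint : Disjoint E(X) E(Y)

lemma Glue.left_mem (h : Glue G X Y v) : v ∈ V(X) := (h.inter_eq.ge rfl).1

lemma Glue.right_mem (h : Glue G X Y v) : v ∈ V(Y) := (h.inter_eq.ge rfl).2

lemma IsConnected.exists_inc (h : G.IsConnected) (hx : x ∈ V(G)) (hy : y ∈ V(G)) (hxy : x ≠ y) :
    ∃ e, G.Inc e x := by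
  rcases Relation.ReflTransGen.cases_head (h.2 x hx y hy) with rfl | ⟨z, ⟨e, he⟩, -⟩
  · exact absurd rfl hxy
  · exact ⟨e, he.inc_left⟩

/-- Splitting `Y` at the edge `f = wu` leaves a piece at `u`, which becomes a branch when `f` and
`w` are added to it, and a piece at `w`, which is still a bush. In this way the branches at `w` are
peeled off one at a time; the last clause keeps track of the edges not yet used. -/
lemma IsBush.exists_glue (hT : T.IsTree) (h : IsBush T Y w) (hf : Y.Inc f w) :
    ∃ Y₁ Y₂, Glue Y Y₁ Y₂ w ∧ IsBranch T Y₁ w ∧ IsBush T Y₂ w ∧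
      ∀ e, Y.Inc e w → e = f ∨ Y₂.Inc e w := by
  have hY := hT.of_le h.le h.isConnected
  obtain ⟨u, hu⟩ := hf
  obtain ⟨A, B, hA, hB, hAc, hBc, hwA, huB, hV, hE, hfA, hfB, hYV, hYE⟩ := hY.exists_split hu
  have hwB : w ∉ V(B) := fun h => Set.disjoint_left.1 hV hwA h
  obtain ⟨D, hD, hDV, hDE⟩ := exists_subgraph (G := Y) (U := insert w V(B)) (F := insert f E(B)) (by
      rw [hYE]; exact Set.insert_subset_insert Set.subset_union_right) (by
      rw [hYV]; exact Set.insert_subset (Or.inl hwA) Set.subset_union_right) (by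
      rintro e (rfl | he) x y hxy
      · rcases hxy.left_eq_or_eq hu with rfl | rfl
        · exact Or.inl rfl
        · exact Or.inr huB
      · exact Or.inr ((hB.isLink_iff he).2 hxy).left_mem)
  have hBD : B ≤ D := ((Compatible.of_le_le hB hD).le_iff).2
    ⟨hDV ▸ Set.subset_insert _ _, hDE ▸ Set.subset_insert _ _⟩
  have hfD : D.IsLink f w u := (hD.isLink_iff (hDE ▸ Or.inl rfl)).2 hu
  have hincA : ∀ e, Y.Inc e w → e = f ∨ A.Inc e w := by
    intro e he
    have : e ∈ insert f (E(A) ∪ E(B)) := hYE ▸ he.edge_mem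
    rcases this with h | h | h
    · exact Or.inl h
    · exact Or.inr ((hA.inc_congr h).2 he)
    · exact absurd ((hB.inc_congr h).2 he).vertex_mem hwB
  refine ⟨D, A, ⟨hD, hA, ?_, ?_, ?_, ?_⟩, ⟨⟨hD.trans h.le, ⟨⟨w, hDV ▸ Or.inl rfl⟩, ?_⟩,
    hDV ▸ Or.inl rfl, ?_⟩, f, hfD.inc_left, ?_⟩, ⟨hA.trans h.le, hAc, hwA, ?_⟩, hincA⟩
  · rw [hYV, hDV]
    ext z; constructor
    · rintro (hz | hz)
      · exact Or.inr hz
      · exact Or.inl (Or.inr hz)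
    · rintro ((rfl | hz) | hz)
      · exact Or.inl hwA
      · exact Or.inr hz
      · exact Or.inl hz
  · rw [hYE, hDE, Set.insert_union, Set.union_comm E(A)]
  · rw [hDV]
    ext z; constructor
    · rintro ⟨rfl | hz, hz'⟩
      · rfl
      · exact absurd hz (Set.disjoint_left.1 hV hz')
    · rintro rfl
      exact ⟨Or.inl rfl, hwA⟩
  · rw [hDE, Set.disjoint_left]
    rintro e (rfl | he) heA
    · exact hfA heA
    · exact Set.disjoint_left.1 hE heA he
  · have key : ∀ z ∈ V(D), Relation.ReflTransGen D.Adj z u := by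
      rw [hDV]
      rintro z (rfl | hz)
      · exact .single ⟨f, hfD⟩
      · exact reflTransGen_mono hBD (hBc.2 z hz u huB)
    exact fun a ha b hb => (key a ha).trans (reflTransGen_symm (key b hb))
  · rw [hDV]
    rintro y (rfl | hy) hyw e he
    · exact absurd rfl hyw
    · have heY := h.closed y (hYV ▸ Or.inr hy) hyw e he
      have : e ∈ insert f (E(A) ∪ E(B)) := hYE ▸ heY
      rw [hDE]
      rcases this with h' | h' | h'
      · exact Or.inl h'
      · exact absurd hy (Set.disjoint_left.1 hV
          (((hA.trans h.le).inc_congr h').2 he).vertex_mem)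
      · exact Or.inr h'
  · intro e he
    have : e ∈ insert f E(B) := hDE ▸ he.edge_mem
    rcases this with h' | h'
    · exact h'
    · exact absurd ((hB.inc_congr h').2 (he.mono hD)).vertex_mem hwB
  · intro y hy hyw e he
    have heY := h.closed y (hYV ▸ Or.inl hy) hyw e he
    have : e ∈ insert f (E(A) ∪ E(B)) := hYE ▸ heY
    rcases this with h' | h' | h'
    · subst h'
      rcases ((h.le.inc_congr heY).2 he).eq_or_eq_of_isLink hu with h' | h'
      · exact absurd h' hyw
      · exact absurd huB (Set.disjoint_left.1 hV (h' ▸ hy))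
    · exact h'
    · exact absurd (((hB.trans h.le).inc_congr h').2 he).vertex_mem (Set.disjoint_left.1 hV hy)

/-- Since `e` is the only edge of `X` at `v`, splitting at `e` isolates `v`. This is the step by
which one walks along a branch away from its root. -/
lemma IsBranch.exists_cons (hT : T.IsTree) (h : IsBranch T X v) :
    ∃ e w Y, v ≠ w ∧ X.IsLink e v w ∧ IsBush T Y w ∧ Y ≤ X ∧ v ∉ V(Y) ∧ e ∉ E(Y) ∧
      V(X) = insert v V(Y) ∧ E(X) = insert e E(Y) := by
  have hX := hT.of_le h.le h.isConnected
  have := hX.1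
  obtain ⟨e, ⟨w, he⟩, huniq⟩ := h.existsUnique
  obtain ⟨A, B, hA, hB, hAc, hBc, hvA, hwB, hV, hE, heA, heB, hXV, hXE⟩ := hX.exists_split he
  have hAV : V(A) = {v} := by
    refine Set.eq_singleton_iff_unique_mem.2 ⟨hvA, fun z hz => by_contra fun hzv => ?_⟩
    obtain ⟨f, hf⟩ := hAc.exists_inc hvA hz (Ne.symm hzv)
    exact heA (huniq f (hf.mono hA) ▸ hf.edge_mem)
  have hAE : E(A) = ∅ := by
    refine Set.eq_empty_of_forall_notMem fun f hf => ?_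
    obtain ⟨x, y, hxy⟩ := exists_isLink_of_mem_edgeSet hf
    have hx : x = v := by have := hxy.left_mem; rwa [hAV] at this
    subst hx
    exact heA (huniq f (hxy.inc_left.mono hA) ▸ hf)
  have hvB : v ∉ V(B) := Set.disjoint_left.1 hV hvA
  refine ⟨e, w, B, he.ne, he, ⟨hB.trans h.le, hBc, hwB, ?_⟩, hB, hvB, heB, ?_, ?_⟩
  · intro y hy hyw f hf
    have hyv : y ≠ v := fun h => hvB (h ▸ hy)
    have hfX := h.closed y (hB.vertexSet_mono hy) hyv f hf
    have : f ∈ insert e (E(A) ∪ E(B)) := hXE ▸ hfX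
    rw [hAE, Set.empty_union] at this
    rcases this with rfl | h'
    · rcases ((h.le.inc_congr hfX).2 hf).eq_or_eq_of_isLink he with h' | h'
      · exact absurd h' hyv
      · exact absurd h' hyw
    · exact h'
  · rw [hXV, hAV, Set.singleton_union]
  · rw [hXE, hAE, Set.empty_union]

lemma eq_of_le_of_sets (h : H ≤ G) (hV : V(H) = V(G)) (hE : E(H) = E(G)) : H = G :=
  (Compatible.of_le h).ext hV hE

/-- A branch is a path to a leaf, or a path to a vertex at which at least two further branches
are attached. -/
lemma IsBranch.isPath_or_exists_glue (hT : T.IsTree) (hfin : E(T).Finite) (h : IsBranch T X v) :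
    (∃ x, v ≠ x ∧ X.IsPath v x ∧ x ∈ T.leaves) ∨
    ∃ P w Y, v ≠ w ∧ P.IsPath v w ∧ Glue X P Y w ∧ IsBush T Y w ∧
      ∃ e f, e ≠ f ∧ Y.Inc e w ∧ Y.Inc f w := by
  induction hn : E(X).ncard using Nat.strong_induction_on generalizing X v with
  | _ n ih =>
  subst hn
  obtain ⟨e, w, Y, hvw, he, hY, hYX, hvY, heY, hXV, hXE⟩ := h.exists_cons hT
  obtain ⟨P₁, hP₁, hP₁V, hP₁E, hP₁p⟩ := exists_isPath_of_isLink he hvw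
  -- At `w` the walk ends in a leaf if no edge of `Y` is left, continues by induction if there is
  -- exactly one, and stops at a branching vertex if there are several.
  by_cases hYE : ∃ f, Y.Inc f w
  · obtain ⟨f, hf⟩ := hYE
    by_cases hu : ∃! f, Y.Inc f w
    · have hlt : E(Y).ncard < E(X).ncard := by
        rw [hXE, Set.ncard_insert_of_notMem heY (hfin.subset hY.le.edgeSet_mono)]
        omega
      rcases ih _ hlt ⟨hY, hu⟩ rfl with ⟨x, hwx, hYp, hx⟩ | ⟨P, w', Z, hww', hP, hg, hZ, hZ2⟩
      · left
        obtain ⟨Q, hQ, hQV, hQE, hQp⟩ := hYp.exists_cons hwx hYX he hvY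
        obtain rfl := eq_of_le_of_sets hQ (hQV.trans hXV.symm) (hQE.trans hXE.symm)
        exact ⟨x, fun h => hvY (h ▸ hYp.right_mem), hQp, hx⟩
      · right
        have hvP : v ∉ V(P) := fun h => hvY (hg.left_le.vertexSet_mono h)
        obtain ⟨Q, hQ, hQV, hQE, hQp⟩ := hP.exists_cons hww' (hg.left_le.trans hYX) he hvP
        refine ⟨Q, w', Z, fun h => hvP (h ▸ hP.right_mem), hQp,
          ⟨hQ, hg.right_le.trans hYX, ?_, ?_, ?_, ?_⟩, hZ, hZ2⟩
        · rw [hXV, hQV, hg.vertexSet_eq, Set.insert_union]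
        · rw [hXE, hQE, hg.edgeSet_eq, Set.insert_union]
        · rw [hQV, Set.insert_inter_of_notMem fun h => hvY (hg.right_le.vertexSet_mono h),
            hg.inter_eq]
        · rw [hQE, Set.disjoint_insert_left]
          exact ⟨fun h => heY (hg.right_le.edgeSet_mono h), hg.disjoint⟩
    · right
      have hu' : ∃ e, Y.Inc e w ∧ e ≠ f := by
        by_contra! hcon
        exact hu ⟨f, hf, fun g hg => hcon g hg⟩
      obtain ⟨g, hg, hgf⟩ := hu'
      refine ⟨P₁, w, Y, hvw, hP₁p, ⟨hP₁, hYX, ?_, ?_, ?_, ?_⟩, hY, g, f, hgf, hg, hf⟩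
      · rw [hXV, hP₁V]
        ext z; constructor
        · rintro (rfl | hz)
          · exact Or.inl (Or.inl rfl)
          · exact Or.inr hz
        · rintro ((rfl | rfl) | hz)
          · exact Or.inl rfl
          · exact Or.inr hY.mem
          · exact Or.inr hz
      · rw [hXE, hP₁E, Set.singleton_union]
      · rw [hP₁V]
        ext z; constructor
        · rintro ⟨rfl | rfl, hz⟩
          · exact absurd hz hvY
          · rfl
        · rintro rfl
          exact ⟨Or.inr rfl, hY.mem⟩
      · rw [hP₁E]
        exact Set.disjoint_singleton_left.2 heY
  · left
    have hYV : V(Y) = {w} := by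
      refine Set.eq_singleton_iff_unique_mem.2 ⟨hY.mem, fun z hz => by_contra fun hzw => ?_⟩
      exact hYE (hY.isConnected.exists_inc hY.mem hz (Ne.symm hzw))
    have hYE' : E(Y) = ∅ := by
      refine Set.eq_empty_of_forall_notMem fun f hf => ?_
      obtain ⟨x, y, hxy⟩ := exists_isLink_of_mem_edgeSet hf
      have hx : x = w := by have := hxy.left_mem; rwa [hYV] at this
      exact hYE ⟨f, hx ▸ hxy.inc_left⟩
    obtain rfl := eq_of_le_of_sets hP₁ (by rw [hP₁V, hXV, hYV]) (by rw [hP₁E, hXE, hYE']; simp)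
    refine ⟨w, hvw, hP₁p, h.le.vertexSet_mono he.right_mem, e, he.inc_right.mono h.le, ?_⟩
    intro f hf
    have := h.closed w he.right_mem hvw.symm f hf
    rw [hP₁E] at this
    exact this

/-- If the branch is not a path to a leaf, a branch at its first branching vertex has fewer edges,
as it lacks those of the initial path. The leaf found there is not `v`, since that path meets the
rest only in `w`. -/
lemma IsBranch.exists_leaf (hT : T.IsTree) (hfin : E(T).Finite) (h : IsBranch T X v) :
    ∃ x ∈ V(X), x ∈ T.leaves ∧ x ≠ v := by
  induction hn : E(X).ncard using Nat.strong_induction_on generalizing X v with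
  | _ n ih =>
  subst hn
  rcases h.isPath_or_exists_glue hT hfin with
    ⟨x, hvx, hX, hx⟩ | ⟨P, w, Y, hvw, hP, hg, hY, e, f, -, he, -⟩
  · exact ⟨x, hX.right_mem, hx, hvx.symm⟩
  · obtain ⟨Y₁, Y₂, hg', hY₁, -⟩ := hY.exists_glue hT he
    have hfX := hfin.subset h.le.edgeSet_mono
    have hlt : E(Y₁).ncard < E(X).ncard := by
      refine Set.ncard_lt_ncard (Set.ssubset_iff_subset_ne.2
        ⟨(hg'.left_le.trans hg.right_le).edgeSet_mono, fun heq => ?_⟩) hfX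
      obtain ⟨p, hp⟩ := (hP.isConnected hvw).exists_inc hP.left_mem hP.right_mem hvw
      have : p ∈ E(Y₁) := heq ▸ hg.left_le.edgeSet_mono hp.edge_mem
      exact Set.disjoint_left.1 hg.disjoint hp.edge_mem (hg'.left_le.edgeSet_mono this)
    obtain ⟨x, hx, hxl, hxw⟩ := ih _ hlt hY₁ rfl
    refine ⟨x, (hg'.left_le.trans hg.right_le).vertexSet_mono hx, hxl, ?_⟩
    rintro rfl
    have : x ∈ V(P) ∩ V(Y) := ⟨hP.left_mem, hg'.left_le.vertexSet_mono hx⟩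
    rw [hg.inter_eq] at this
    exact hxw this

end Graph

/-! ### Points on a circle and separation by arcs -/

/-- The length of the arc from `x` to `y` on a circle of circumference `G` with coordinate `θ`. -/
noncomputable def fwd {α : Type*} (θ : α → ℝ) (G : ℝ) (x y : α) : ℝ :=
  if θ x ≤ θ y then θ y - θ x else θ y - θ x + G

section fwd

variable {α : Type*} {θ : α → ℝ} {G : ℝ} {x y : α}

lemma fwd_of_le (h : θ x ≤ θ y) : fwd θ G x y = θ y - θ x := if_pos h

lemma fwd_of_lt (h : θ y < θ x) : fwd θ G x y = θ y - θ x + G := if_neg h.not_ge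

/-- Arc lengths do not depend on where the circle is cut open, so every statement made in terms of
`fwd` can be transferred to another origin. -/
lemma fwd_fwd {a : α} (hx : 0 ≤ θ x) (hx' : θ x < G) (hy : 0 ≤ θ y) (hy' : θ y < G) :
    fwd (fwd θ G a) G x y = fwd θ G x y := by
  unfold fwd
  split_ifs <;> linarith

end fwd

/-- The circular arrangement of the leaves of a shortcut tree: `L` is a set of points on a circle of
circumference `G`, and `Cov B t` says that the points of `B` are connected by a subtree of length
at most `t` of a tree of length `t₀`. -/
structure ShortcutCircle {α : Type*} (θ : α → ℝ) (G t₀ : ℝ) (L : Set α)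
    (Cov : Set α → ℝ → Prop) : Prop where
  finite : L.Finite
  nonneg : ∀ x ∈ L, 0 ≤ θ x
  lt : ∀ x ∈ L, θ x < G
  injOn : Set.InjOn θ L
  lt_circ : t₀ < G
  exists_notMem : ∀ B ⊂ L, ∀ t, Cov B t →
    ∃ z ∈ L, z ∉ B ∧ ∀ b ∈ B, ∀ b' ∈ B, fwd θ G b b' < fwd θ G b z → fwd θ G b b' ≤ t
  lt_of_next : ∀ p ∈ L, ∀ q ∈ L, p ≠ q → (∀ x ∈ L, x ≠ p → fwd θ G p q ≤ fwd θ G p x) →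
    t₀ < G - fwd θ G p q

namespace ShortcutCircle

variable {α : Type*} {θ : α → ℝ} {G t₀ : ℝ} {L : Set α} {Cov : Set α → ℝ → Prop}

lemma rebase (h : ShortcutCircle θ G t₀ L Cov) {a : α} (ha : a ∈ L) :
    ShortcutCircle (fwd θ G a) G t₀ L Cov := by
  have key : ∀ x ∈ L, ∀ y ∈ L, fwd (fwd θ G a) G x y = fwd θ G x y := fun x hx y hy =>
    fwd_fwd (h.nonneg x hx) (h.lt x hx) (h.nonneg y hy) (h.lt y hy)
  have h0 := h.nonneg a ha
  have h1 := h.lt a ha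
  refine ⟨h.finite, fun x hx => ?_, fun x hx => ?_, fun x hx y hy hxy => ?_, h.lt_circ, ?_, ?_⟩
  · have := h.nonneg x hx
    unfold fwd; split_ifs <;> linarith
  · have := h.lt x hx
    unfold fwd; split_ifs <;> linarith
  · have := h.nonneg x hx
    have := h.lt x hx
    have := h.nonneg y hy
    have := h.lt y hy
    refine h.injOn hx hy ?_
    unfold fwd at hxy; split_ifs at hxy <;> linarith
  · intro B hB t ht
    obtain ⟨z, hz, hzB, hk⟩ := h.exists_notMem B hB t ht
    refine ⟨z, hz, hzB, fun b hb b' hb' => ?_⟩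
    rw [key b (hB.1 hb) b' (hB.1 hb'), key b (hB.1 hb) z hz]
    exact hk b hb b' hb'
  · intro p hp q hq hpq hx
    rw [key p hp q hq] at hx ⊢
    refine h.lt_of_next p hp q hq hpq fun x hxL hxp => ?_
    rw [← key p hp x hxL]
    exact hx x hxL hxp

lemma fwd_self (a : α) : fwd θ G a a = 0 := by simp [fwd]

lemma lt_of_ne (h : ShortcutCircle θ G t₀ L Cov) {x y : α} (hx : x ∈ L) (hy : y ∈ L) (hxy : x ≠ y)
    (hle : θ x ≤ θ y) : θ x < θ y :=
  lt_of_le_of_ne hle fun heq => hxy (h.injOn hx hy heq)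

/-- Either set lies on an arc that misses a point of the other, of length at most `s` for `A` and
`t` for `B`. If these arcs overlapped, they would cover the circle, giving `G ≤ s + t`, or
everything except one gap between consecutive leaves, against `lt_of_next`. Cutting the circle at a
point `z` of `B` that the arc of `A` misses makes this arc an interval. -/
lemma separate_aux (h : ShortcutCircle θ G t₀ L Cov) {A B : Set α} {s t : ℝ}
    (hL : L = A ∪ B) (hAB : Disjoint A B) (hA : A.Nonempty) (ht : Cov B t) (hst : s + t ≤ t₀)
    {z : α} (hz : z ∈ B) (hz0 : θ z = 0)
    (hs : ∀ b ∈ A, ∀ b' ∈ A, fwd θ G b b' < fwd θ G b z → fwd θ G b b' ≤ s) :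
    ∃ q ∈ A, ∀ a ∈ A, ∀ b ∈ B, fwd θ G q a < fwd θ G q b := by
  have hAL : A ⊆ L := hL ▸ Set.subset_union_left
  have hBL : B ⊆ L := hL ▸ Set.subset_union_right
  obtain ⟨q, hq, hqmin⟩ := Set.exists_min_image A θ (h.finite.subset hAL) hA
  obtain ⟨p, hp, hpmax⟩ := Set.exists_max_image A θ (h.finite.subset hAL) hA
  have hne : ∀ a ∈ A, ∀ b ∈ B, a ≠ b := fun a ha b hb hab =>
    Set.disjoint_left.1 hAB ha (hab ▸ hb)
  have hlt : ∀ a ∈ A, ∀ b ∈ B, θ a ≤ θ b → θ a < θ b := fun a ha b hb =>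
    h.lt_of_ne (hAL ha) (hBL hb) (hne a ha b hb)
  have hlt' : ∀ a ∈ A, ∀ b ∈ B, θ b ≤ θ a → θ b < θ a := fun a ha b hb =>
    h.lt_of_ne (hBL hb) (hAL ha) (hne a ha b hb).symm
  have hpos : ∀ a ∈ A, 0 < θ a := fun a ha => by
    have := hlt' a ha z hz (hz0 ▸ h.nonneg a (hAL ha))
    linarith
  have hpq := hqmin p hp
  have hs' : θ p - θ q ≤ s := by
    have := hs q hq p hp (by
      rw [fwd_of_le hpq, fwd_of_lt (by rw [hz0]; exact hpos q hq)]
      have := h.lt p (hAL hp)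
      linarith)
    rwa [fwd_of_le hpq] at this
  have hgoal : (∀ b ∈ B, θ b < θ q ∨ θ p < θ b) →
      ∃ q ∈ A, ∀ a ∈ A, ∀ b ∈ B, fwd θ G q a < fwd θ G q b := by
    intro hb
    refine ⟨q, hq, fun a ha b hbB => ?_⟩
    have h1 := hqmin a ha
    have h2 := hpmax a ha
    rw [fwd_of_le h1]
    rcases hb b hbB with hb | hb
    · rw [fwd_of_lt hb]
      have := h.lt a (hAL ha)
      have := h.nonneg b (hBL hbB)
      linarith
    · rw [fwd_of_le (by linarith)]
      linarith
  obtain ⟨z₂, hz₂L, hz₂B, hk⟩ := h.exists_notMem B ⟨hBL, fun hLB => by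
    obtain ⟨a, ha⟩ := hA
    exact Set.disjoint_left.1 hAB ha (hLB (hAL ha))⟩ t ht
  have hz₂A : z₂ ∈ A := by
    rw [hL] at hz₂L
    exact hz₂L.resolve_right hz₂B
  have hqz := hqmin z₂ hz₂A
  have hzp := hpmax z₂ hz₂A
  -- `p'` and `q'` are the points of `B` on either side of `z₂`. The arc of `B` that avoids `z₂`
  -- runs from `q'` through the origin to `p'`, or from the origin to `p'` if there is no `q'`.
  obtain ⟨p', ⟨hp', hp'z⟩, hp'max⟩ := Set.exists_max_image {x ∈ B | θ x < θ z₂} θ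
    (h.finite.subset fun x hx => hBL hx.1) ⟨z, hz, by rw [hz0]; exact hpos z₂ hz₂A⟩
  have hleft : ∀ b ∈ B, θ b < θ z₂ → θ b ≤ θ p' := fun b hb hbz => hp'max b ⟨hb, hbz⟩
  by_cases hex : {x ∈ B | θ z₂ < θ x}.Nonempty
  · obtain ⟨q', ⟨hq', hzq'⟩, hq'min⟩ := Set.exists_min_image {x ∈ B | θ z₂ < θ x} θ
      (h.finite.subset fun x hx => hBL hx.1) hex
    have hright : ∀ b ∈ B, θ z₂ < θ b → θ q' ≤ θ b := fun b hb hbz => hq'min b ⟨hb, hbz⟩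
    have hdich : ∀ b ∈ B, θ b ≤ θ p' ∨ θ q' ≤ θ b := by
      intro b hb
      rcases le_or_gt (θ z₂) (θ b) with hzb | hzb
      · exact Or.inr (hright b hb (hlt z₂ hz₂A b hb hzb))
      · exact Or.inl (hleft b hb hzb)
    have ht' : θ p' - θ q' + G ≤ t := by
      have h1 : fwd θ G q' p' = θ p' - θ q' + G := fwd_of_lt (by linarith)
      have h2 : fwd θ G q' z₂ = θ z₂ - θ q' + G := fwd_of_lt hzq'
      have := hk q' hq' p' hp' (by rw [h1, h2]; linarith)
      rwa [h1] at this
    -- The interval from `q` to `p` can meet the arc of `B` at its lower end (`θ q ≤ θ p'`) or at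
    -- its upper end (`θ q' < θ p`). One overlap leaves a single gap uncovered, two cover the whole
    -- circle, and none is the desired situation.
    rcases le_or_gt (θ q) (θ p') with hqp' | hqp'
    · rcases le_or_gt (θ p) (θ q') with hpq' | hpq'
      · exfalso
        have hpq'' := hlt p hp q' hq' hpq'
        have := h.lt_of_next p (hAL hp) q' (hBL hq') (hne p hp q' hq') (by
          intro x hx hxp
          rw [fwd_of_le hpq']
          have hG := h.lt q' (hBL hq')
          have hx0 := h.nonneg x hx
          rw [hL] at hx
          rcases hx with hx | hx
          · rw [fwd_of_lt (h.lt_of_ne (hAL hx) (hAL hp) hxp (hpmax x hx))]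
            linarith
          · rcases hdich x hx with hx' | hx'
            · rw [fwd_of_lt (by linarith)]
              linarith
            · rw [fwd_of_le (by linarith)]
              linarith)
        rw [fwd_of_le hpq'] at this
        linarith
      · exfalso
        have := h.lt_circ
        linarith
    · rcases le_or_gt (θ p) (θ q') with hpq' | hpq'
      · refine hgoal fun b hb => ?_
        rcases hdich b hb with hb' | hb'
        · left; linarith
        · right
          exact hlt p hp b hb (by linarith)
      · exfalso
        have := h.lt_of_next p' (hBL hp') q (hAL hq) (hne q hq p' hp').symm (by
          intro x hx hxp
          rw [fwd_of_le hqp'.le]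
          have hG := h.lt q (hAL hq)
          have hx0 := h.nonneg x hx
          rw [hL] at hx
          rcases hx with hx | hx
          · have := hqmin x hx
            rw [fwd_of_le (by linarith)]
            linarith
          · rcases hdich x hx with hx' | hx'
            · rw [fwd_of_lt (h.lt_of_ne (hBL hx) (hBL hp') hxp hx')]
              linarith
            · rw [fwd_of_le (by linarith)]
              linarith)
        rw [fwd_of_le hqp'.le] at this
        linarith
  · have hall : ∀ b ∈ B, θ b ≤ θ p' := by
      intro b hb
      rcases le_or_gt (θ z₂) (θ b) with hzb | hzb
      · exact absurd ⟨b, hb, hlt z₂ hz₂A b hb hzb⟩ hex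
      · exact hleft b hb hzb
    have h0 := h.nonneg p' (hBL hp')
    have ht' : θ p' ≤ t := by
      have h1 : fwd θ G z p' = θ p' - θ z := fwd_of_le (by linarith)
      have h2 : fwd θ G z z₂ = θ z₂ - θ z := fwd_of_le (by linarith)
      have := hk z hz p' hp' (by rw [h1, h2]; linarith)
      rw [h1] at this
      linarith
    -- Now an overlap leaves uncovered only the gap from `p` back to the origin `z`.
    rcases le_or_gt (θ q) (θ p') with hqp' | hqp'
    · exfalso
      have hp0 := hpos p hp
      have h1 : fwd θ G p z = θ z - θ p + G := fwd_of_lt (by linarith)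
      have := h.lt_of_next p (hAL hp) z (hBL hz) (hne p hp z hz) (by
        intro x hx hxp
        rw [h1]
        have hx0 := h.nonneg x hx
        rw [hL] at hx
        rcases hx with hx | hx
        · rw [fwd_of_lt (h.lt_of_ne (hAL hx) (hAL hp) hxp (hpmax x hx))]
          linarith
        · have := hall x hx
          rw [fwd_of_lt (by linarith)]
          linarith)
      rw [h1] at this
      linarith
    · exact hgoal fun b hb => Or.inl ((hall b hb).trans_lt hqp')

/-- The leaf sets of two edge-disjoint subtrees that together contain all leaves lie on disjoint
arcs. -/
lemma separate (h : ShortcutCircle θ G t₀ L Cov) {A B : Set α} {s t : ℝ}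
    (hL : L = A ∪ B) (hAB : Disjoint A B) (hA : A.Nonempty) (hB : B.Nonempty)
    (hs : Cov A s) (ht : Cov B t) (hst : s + t ≤ t₀) :
    ∃ q ∈ A, ∀ a ∈ A, ∀ b ∈ B, fwd θ G q a < fwd θ G q b := by
  have hAL : A ⊆ L := hL ▸ Set.subset_union_left
  have hBL : B ⊆ L := hL ▸ Set.subset_union_right
  obtain ⟨z, hzL, hzA, hk⟩ := h.exists_notMem A ⟨hAL, fun hLA => by
    obtain ⟨b, hb⟩ := hB
    exact Set.disjoint_left.1 hAB (hLA (hBL hb)) hb⟩ s hs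
  have key : ∀ x ∈ L, ∀ y ∈ L, fwd (fwd θ G z) G x y = fwd θ G x y := fun x hx y hy =>
    fwd_fwd (h.nonneg x hx) (h.lt x hx) (h.nonneg y hy) (h.lt y hy)
  have hzB : z ∈ B := by
    have := hzL
    rw [hL] at this
    exact this.resolve_left hzA
  obtain ⟨q, hq, hsep⟩ := (h.rebase hzL).separate_aux hL hAB hA ht hst hzB (fwd_self z) (by
    intro b hb b' hb'
    rw [key b (hAL hb) b' (hAL hb'), key b (hAL hb) z hzL]
    exact hk b hb b' hb')
  refine ⟨q, hq, fun a ha b hb => ?_⟩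
  rw [← key q (hAL hq) a (hAL ha), ← key q (hAL hq) b (hBL hb)]
  exact hsep a ha b hb

/-- `θ a < θ b < θ a' ≤ θ b'` would make points of `A` and `B` alternate round the circle, which is
impossible when `A` lies on an arc that avoids `B`. This is the linear form in which separation is
used once the circle has been cut open. -/
lemma not_cross (h : ShortcutCircle θ G t₀ L Cov) {A B : Set α} {s t : ℝ}
    (hL : L = A ∪ B) (hAB : Disjoint A B) (hs : Cov A s) (ht : Cov B t) (hst : s + t ≤ t₀)
    {a a' b b' : α} (ha : a ∈ A) (ha' : a' ∈ A) (hb : b ∈ B) (hb' : b' ∈ B)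
    (h₁ : θ a < θ b) (h₂ : θ b < θ a') : θ b' < θ a' := by
  by_contra! h₃
  have hAL : A ⊆ L := hL ▸ Set.subset_union_left
  have hBL : B ⊆ L := hL ▸ Set.subset_union_right
  obtain ⟨q, hq, hsep⟩ := h.separate hL hAB ⟨a, ha⟩ ⟨b, hb⟩ hs ht hst
  have h1 := hsep a ha b hb
  have h2 := hsep a ha b' hb'
  have h3 := hsep a' ha' b hb
  have h4 := hsep a' ha' b' hb'
  have g1 := h.nonneg a (hAL ha)
  have g2 := h.lt a (hAL ha)
  have g3 := h.nonneg b (hBL hb)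
  have g4 := h.lt b (hBL hb)
  have g5 := h.nonneg a' (hAL ha')
  have g6 := h.lt a' (hAL ha')
  have g7 := h.nonneg b' (hBL hb')
  have g8 := h.lt b' (hBL hb')
  have g9 := h.nonneg q (hAL hq)
  have g10 := h.lt q (hAL hq)
  unfold fwd at h1 h2 h3 h4
  split_ifs at h1 h2 h3 h4 <;> linarith

/-- Four edge-disjoint subtrees with a common vertex cannot each contain a leaf. -/
lemma not_four (h : ShortcutCircle θ G t₀ L Cov) {I : Fin 4 → Set α} {u : Fin 4 → ℝ}
    (hL : L = ⋃ i, I i) (hdisj : ∀ i j, i ≠ j → Disjoint (I i) (I j)) (hne : ∀ i, (I i).Nonempty)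
    (hcov : ∀ i j, i ≠ j → Cov (I i ∪ I j) (u i + u j)) (hu : ∑ i, u i ≤ t₀) : False := by
  choose x hx using hne
  have hIL : ∀ i, I i ⊆ L := fun i => hL ▸ Set.subset_iUnion I i
  have hinj : Function.Injective fun i => θ (x i) := by
    intro i j hij
    by_contra hne
    have := h.injOn (hIL i (hx i)) (hIL j (hx j)) hij
    exact Set.disjoint_left.1 (hdisj i j hne) (hx i) (this ▸ hx j)
  -- One leaf is taken from each subtree. In sorted order the first and third are put against the
  -- second and fourth, and these pairs cross.
  let σ := Tuple.sort fun i => θ (x i)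
  have hmono : StrictMono ((fun i => θ (x i)) ∘ σ) :=
    (Tuple.monotone_sort _).strictMono_of_injective (hinj.comp σ.injective)
  have hσ : ∀ i j : Fin 4, i ≠ j → σ i ≠ σ j := fun i j hij heq => hij (σ.injective heq)
  have hsum : u (σ 0) + u (σ 2) + (u (σ 1) + u (σ 3)) ≤ t₀ := by
    have := Equiv.sum_comp σ u
    rw [Fin.sum_univ_four] at this
    linarith
  refine absurd (h.not_cross (A := I (σ 0) ∪ I (σ 2)) (B := I (σ 1) ∪ I (σ 3)) ?_ ?_
    (hcov _ _ (hσ 0 2 (by decide))) (hcov _ _ (hσ 1 3 (by decide))) hsum (a := x (σ 0))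
    (a' := x (σ 2)) (b := x (σ 1)) (b' := x (σ 3)) (Or.inl (hx _)) (Or.inr (hx _)) (Or.inl (hx _))
    (Or.inr (hx _)) (hmono (by decide)) (hmono (by decide))) (hmono (by decide)).not_gt
  · rw [hL]
    ext z
    simp only [Set.mem_iUnion, Set.mem_union]
    constructor
    · rintro ⟨i, hi⟩
      obtain ⟨j, rfl⟩ := σ.surjective i
      fin_cases j <;> simp_all
    · rintro ((h | h) | (h | h)) <;> exact ⟨_, h⟩
  · simp only [Set.disjoint_union_left, Set.disjoint_union_right]
    exact ⟨⟨hdisj _ _ (hσ 0 1 (by decide)), hdisj _ _ (hσ 2 1 (by decide))⟩,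
      hdisj _ _ (hσ 0 3 (by decide)), hdisj _ _ (hσ 2 3 (by decide))⟩

end ShortcutCircle

/-! ### Four subtrees at the ends of a path of the tree -/

/-- The leaf sets and lengths of four subtrees attached in pairs to the ends of a path of
length `q`. -/
structure IsQuad {α : Type*} (t₀ : ℝ) (L : Set α) (Cov : Set α → ℝ → Prop)
    (I₁ I₂ I₃ I₄ : Set α) (u₁ u₂ u₃ u₄ q : ℝ) : Prop where
  union_eq : L = (I₁ ∪ I₂) ∪ (I₃ ∪ I₄)
  disj₁₂ : Disjoint I₁ I₂
  disj₃₄ : Disjoint I₃ I₄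
  disj : Disjoint (I₁ ∪ I₂) (I₃ ∪ I₄)
  nonempty₁ : I₁.Nonempty
  nonempty₂ : I₂.Nonempty
  nonempty₃ : I₃.Nonempty
  nonempty₄ : I₄.Nonempty
  cov₁₂ : Cov (I₁ ∪ I₂) (u₁ + u₂)
  cov₃₄ : Cov (I₃ ∪ I₄) (u₃ + u₄)
  cov₁₃ : Cov (I₁ ∪ I₃) (u₁ + q + u₃)
  cov₁₄ : Cov (I₁ ∪ I₄) (u₁ + q + u₄)
  cov₂₃ : Cov (I₂ ∪ I₃) (u₂ + q + u₃)
  cov₂₄ : Cov (I₂ ∪ I₄) (u₂ + q + u₄)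
  cov₁ : Cov I₁ u₁
  cov₂ : Cov I₂ u₂
  cov₃ : Cov I₃ u₃
  cov₄ : Cov I₄ u₄
  cov₁' : Cov (I₂ ∪ (I₃ ∪ I₄)) (u₂ + q + (u₃ + u₄))
  cov₂' : Cov (I₁ ∪ (I₃ ∪ I₄)) (u₁ + q + (u₃ + u₄))
  cov₃' : Cov (I₄ ∪ (I₁ ∪ I₂)) (u₄ + q + (u₁ + u₂))
  cov₄' : Cov (I₃ ∪ (I₁ ∪ I₂)) (u₃ + q + (u₁ + u₂))
  q_nonneg : 0 ≤ q
  sum_le : u₁ + u₂ + q + (u₃ + u₄) ≤ t₀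

namespace IsQuad

variable {α : Type*} {θ : α → ℝ} {G t₀ : ℝ} {L : Set α} {Cov : Set α → ℝ → Prop}
  {I₁ I₂ I₃ I₄ : Set α} {u₁ u₂ u₃ u₄ q : ℝ}

/-- With `swap` and `swap_right`, this reduces the analysis to blocks in increasing order. -/
lemma swap_left (h : IsQuad t₀ L Cov I₁ I₂ I₃ I₄ u₁ u₂ u₃ u₄ q) :
    IsQuad t₀ L Cov I₂ I₁ I₃ I₄ u₂ u₁ u₃ u₄ q where
  union_eq := by rw [h.union_eq, Set.union_comm I₁]
  disj₁₂ := h.disj₁₂.symm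
  disj₃₄ := h.disj₃₄
  disj := by rw [Set.union_comm]; exact h.disj
  nonempty₁ := h.nonempty₂
  nonempty₂ := h.nonempty₁
  nonempty₃ := h.nonempty₃
  nonempty₄ := h.nonempty₄
  cov₁₂ := by rw [Set.union_comm, add_comm]; exact h.cov₁₂
  cov₃₄ := h.cov₃₄
  cov₁₃ := h.cov₂₃
  cov₁₄ := h.cov₂₄
  cov₂₃ := h.cov₁₃
  cov₂₄ := h.cov₁₄
  cov₁ := h.cov₂
  cov₂ := h.cov₁
  cov₃ := h.cov₃
  cov₄ := h.cov₄
  cov₁' := h.cov₂'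
  cov₂' := h.cov₁'
  cov₃' := by rw [Set.union_comm I₂, add_comm u₂]; exact h.cov₃'
  cov₄' := by rw [Set.union_comm I₂, add_comm u₂]; exact h.cov₄'
  q_nonneg := h.q_nonneg
  sum_le := by rw [add_comm u₂]; exact h.sum_le

lemma swap (h : IsQuad t₀ L Cov I₁ I₂ I₃ I₄ u₁ u₂ u₃ u₄ q) :
    IsQuad t₀ L Cov I₃ I₄ I₁ I₂ u₃ u₄ u₁ u₂ q where
  union_eq := by rw [h.union_eq, Set.union_comm]
  disj₁₂ := h.disj₃₄
  disj₃₄ := h.disj₁₂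
  disj := h.disj.symm
  nonempty₁ := h.nonempty₃
  nonempty₂ := h.nonempty₄
  nonempty₃ := h.nonempty₁
  nonempty₄ := h.nonempty₂
  cov₁₂ := h.cov₃₄
  cov₃₄ := h.cov₁₂
  cov₁₃ := by rw [Set.union_comm, show u₃ + q + u₁ = u₁ + q + u₃ by ring]; exact h.cov₁₃
  cov₁₄ := by rw [Set.union_comm, show u₃ + q + u₂ = u₂ + q + u₃ by ring]; exact h.cov₂₃
  cov₂₃ := by rw [Set.union_comm, show u₄ + q + u₁ = u₁ + q + u₄ by ring]; exact h.cov₁₄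
  cov₂₄ := by rw [Set.union_comm, show u₄ + q + u₂ = u₂ + q + u₄ by ring]; exact h.cov₂₄
  cov₁ := h.cov₃
  cov₂ := h.cov₄
  cov₃ := h.cov₁
  cov₄ := h.cov₂
  cov₁' := h.cov₃'
  cov₂' := h.cov₄'
  cov₃' := h.cov₁'
  cov₄' := h.cov₂'
  q_nonneg := h.q_nonneg
  sum_le := by linarith [h.sum_le]

lemma swap_right (h : IsQuad t₀ L Cov I₁ I₂ I₃ I₄ u₁ u₂ u₃ u₄ q) :
    IsQuad t₀ L Cov I₁ I₂ I₄ I₃ u₁ u₂ u₄ u₃ q := h.swap.swap_left.swap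

/-- Points of two sets that are not interleaved are ordered blockwise. -/
lemma lt_or_lt_of_not_interleaved {I J : Set α} (hI : I.Nonempty) (hJ : J.Nonempty)
    (hne : ∀ a ∈ I, ∀ b ∈ J, θ a ≠ θ b)
    (h₁ : ∀ a ∈ I, ∀ a' ∈ I, ∀ b ∈ J, θ a < θ b → θ b < θ a' → False)
    (h₂ : ∀ b ∈ J, ∀ b' ∈ J, ∀ a ∈ I, θ b < θ a → θ a < θ b' → False) :
    (∀ a ∈ I, ∀ b ∈ J, θ a < θ b) ∨ (∀ b ∈ J, ∀ a ∈ I, θ b < θ a) := by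
  obtain ⟨i, hi⟩ := hI
  obtain ⟨j, hj⟩ := hJ
  rcases lt_or_gt_of_ne (hne i hi j hj) with hij | hij
  · left
    intro a ha b hb
    by_contra! hba
    have hba := lt_of_le_of_ne hba (hne a ha b hb).symm
    rcases lt_or_gt_of_ne (hne a ha j hj) with haj | haj
    · exact h₂ b hb j hj a ha hba haj
    · exact h₁ i hi a ha j hj hij haj
  · right
    intro b hb a ha
    by_contra! hab
    have hab := lt_of_le_of_ne hab (hne a ha b hb)
    rcases lt_or_gt_of_ne (hne i hi b hb) with hib | hib
    · exact h₂ j hj b hb i hi hij hib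
    · exact h₁ a ha i hi b hb hab hib

/-- Put `δ = G - t₀` and let `d₁, …, d₄` be the gaps following the four blocks. All gaps are below
`δ`. The hulls of the two sides have lengths at most `u₁ + u₂` and `u₃ + u₄` and add up to `G - d₂ -
d₄`; hence `q ≤ d₂ + d₄ - δ < δ`. A third leaf on a side forces its hull to have length at least
`δ`. The arcs for the crossing pairs `I₁ ∪ I₃` and `I₂ ∪ I₄` have total length at most `t₀ + q`, but
each of their four possible positions needs more. -/
lemma false_of_ordered (h : IsQuad t₀ L Cov I₁ I₂ I₃ I₄ u₁ u₂ u₃ u₄ q)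
    (hc : ShortcutCircle θ G t₀ L Cov) (htop : ∀ B ⊂ L, Cov B t₀)
    (h₁₂ : ∀ a ∈ I₁, ∀ b ∈ I₂, θ a < θ b) (h₃₄ : ∀ a ∈ I₃, ∀ b ∈ I₄, θ a < θ b)
    (hlr : ∀ a ∈ I₁ ∪ I₂, ∀ b ∈ I₃ ∪ I₄, θ a < θ b)
    (hl : 3 ≤ (I₁ ∪ I₂).ncard) (hr : 3 ≤ (I₃ ∪ I₄).ncard) : False := by
  have hU := h.union_eq
  have s₁ : I₁ ⊆ L := fun x hx => hU ▸ Or.inl (Or.inl hx)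
  have s₂ : I₂ ⊆ L := fun x hx => hU ▸ Or.inl (Or.inr hx)
  have s₃ : I₃ ⊆ L := fun x hx => hU ▸ Or.inr (Or.inl hx)
  have s₄ : I₄ ⊆ L := fun x hx => hU ▸ Or.inr (Or.inr hx)
  have hmem : ∀ x ∈ L, x ∈ I₁ ∨ x ∈ I₂ ∨ x ∈ I₃ ∨ x ∈ I₄ := by
    intro x hx
    rw [hU] at hx
    rcases hx with (hx | hx) | (hx | hx) <;> tauto
  have fin := hc.finite
  obtain ⟨x₁, hx₁, mx₁⟩ := Set.exists_min_image I₁ θ (fin.subset s₁) h.nonempty₁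
  obtain ⟨y₁, hy₁, my₁⟩ := Set.exists_max_image I₁ θ (fin.subset s₁) h.nonempty₁
  obtain ⟨x₂, hx₂, mx₂⟩ := Set.exists_min_image I₂ θ (fin.subset s₂) h.nonempty₂
  obtain ⟨y₂, hy₂, my₂⟩ := Set.exists_max_image I₂ θ (fin.subset s₂) h.nonempty₂
  obtain ⟨x₃, hx₃, mx₃⟩ := Set.exists_min_image I₃ θ (fin.subset s₃) h.nonempty₃
  obtain ⟨y₃, hy₃, my₃⟩ := Set.exists_max_image I₃ θ (fin.subset s₃) h.nonempty₃
  obtain ⟨x₄, hx₄, mx₄⟩ := Set.exists_min_image I₄ θ (fin.subset s₄) h.nonempty₄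
  obtain ⟨y₄, hy₄, my₄⟩ := Set.exists_max_image I₄ θ (fin.subset s₄) h.nonempty₄
  have h₁₃ : ∀ a ∈ I₁, ∀ b ∈ I₃, θ a < θ b := fun a ha b hb => hlr a (Or.inl ha) b (Or.inl hb)
  have h₁₄ : ∀ a ∈ I₁, ∀ b ∈ I₄, θ a < θ b := fun a ha b hb => hlr a (Or.inl ha) b (Or.inr hb)
  have h₂₃ : ∀ a ∈ I₂, ∀ b ∈ I₃, θ a < θ b := fun a ha b hb => hlr a (Or.inr ha) b (Or.inl hb)
  have h₂₄ : ∀ a ∈ I₂, ∀ b ∈ I₄, θ a < θ b := fun a ha b hb => hlr a (Or.inr ha) b (Or.inr hb)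
  have o₁ := mx₁ y₁ hy₁
  have o₂ := h₁₂ y₁ hy₁ x₂ hx₂
  have o₃ := mx₂ y₂ hy₂
  have o₄ := h₂₃ y₂ hy₂ x₃ hx₃
  have o₅ := mx₃ y₃ hy₃
  have o₆ := h₃₄ y₃ hy₃ x₄ hx₄
  have o₇ := mx₄ y₄ hy₄
  have oG := hc.lt y₄ (s₄ hy₄)
  have o0 := hc.nonneg x₁ (s₁ hx₁)
  have hLne : ∀ {B : Set α} {x : α}, B ⊆ L → x ∈ L → x ∉ B → B ⊂ L := fun hB hx hxB =>
    ⟨hB, fun hLB => hxB (hLB hx)⟩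
  have n₁₃ : ∀ a ∈ I₁, a ∉ I₃ := fun a ha hb => lt_irrefl _ (h₁₃ a ha a hb)
  have n₁₄ : ∀ a ∈ I₁, a ∉ I₄ := fun a ha hb => lt_irrefl _ (h₁₄ a ha a hb)
  have n₁₂ : ∀ a ∈ I₁, a ∉ I₂ := fun a ha hb => lt_irrefl _ (h₁₂ a ha a hb)
  have n₂₃ : ∀ a ∈ I₂, a ∉ I₃ := fun a ha hb => lt_irrefl _ (h₂₃ a ha a hb)
  -- gaps between neighbouring blocks
  have gap : ∀ p ∈ L, ∀ r ∈ L, θ p < θ r → (∀ x ∈ L, θ x ≤ θ p ∨ θ r ≤ θ x) →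
      t₀ < G - (θ r - θ p) := by
    intro p hp r hr hpr hx
    have := hc.lt_of_next p hp r hr (fun h => by rw [h] at hpr; exact lt_irrefl _ hpr) (by
      intro x hxL hxp
      rw [fwd_of_le hpr.le]
      have := hc.nonneg x hxL
      have := hc.lt r hr
      rcases hx x hxL with hx | hx
      · rw [fwd_of_lt (hc.lt_of_ne hxL hp hxp hx)]
        linarith
      · rw [fwd_of_le (by linarith)]
        linarith)
    rwa [fwd_of_le hpr.le] at this
  have g₁ := gap y₁ (s₁ hy₁) x₂ (s₂ hx₂) o₂ fun x hx => by
    rcases hmem x hx with hx | hx | hx | hx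
    · exact Or.inl (my₁ x hx)
    · exact Or.inr (mx₂ x hx)
    · exact Or.inr (h₂₃ x₂ hx₂ x hx).le
    · exact Or.inr (h₂₄ x₂ hx₂ x hx).le
  have g₂ := gap y₂ (s₂ hy₂) x₃ (s₃ hx₃) o₄ fun x hx => by
    rcases hmem x hx with hx | hx | hx | hx
    · exact Or.inl (h₁₂ x hx y₂ hy₂).le
    · exact Or.inl (my₂ x hx)
    · exact Or.inr (mx₃ x hx)
    · exact Or.inr (h₃₄ x₃ hx₃ x hx).le
  have g₃ := gap y₃ (s₃ hy₃) x₄ (s₄ hx₄) o₆ fun x hx => by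
    rcases hmem x hx with hx | hx | hx | hx
    · exact Or.inl (h₁₃ x hx y₃ hy₃).le
    · exact Or.inl (h₂₃ x hx y₃ hy₃).le
    · exact Or.inl (my₃ x hx)
    · exact Or.inr (mx₄ x hx)
  -- The fourth gap passes through the origin.
  have g₄ : t₀ < θ y₄ - θ x₁ := by
    have e₁ : fwd θ G y₄ x₁ = θ x₁ - θ y₄ + G := fwd_of_lt (h₁₄ x₁ hx₁ y₄ hy₄)
    have := hc.lt_of_next y₄ (s₄ hy₄) x₁ (s₁ hx₁)
      (fun h => n₁₄ x₁ hx₁ (h ▸ hy₄)) (by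
      intro x hx hxp
      have hxy : θ x ≤ θ y₄ := by
        rcases hmem x hx with hx | hx | hx | hx
        · exact (h₁₄ x hx y₄ hy₄).le
        · exact (h₂₄ x hx y₄ hy₄).le
        · exact (h₃₄ x hx y₄ hy₄).le
        · exact my₄ x hx
      have hxx : θ x₁ ≤ θ x := by
        rcases hmem x hx with hx | hx | hx | hx
        · exact mx₁ x hx
        · exact (h₁₂ x₁ hx₁ x hx).le
        · exact (h₁₃ x₁ hx₁ x hx).le
        · exact (h₁₄ x₁ hx₁ x hx).le
      rw [e₁, fwd_of_lt (hc.lt_of_ne hx (s₄ hy₄) hxp hxy)]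
      linarith)
    rw [e₁] at this
    linarith
  -- the hulls of the two sides
  have e₁ : θ y₂ - θ x₁ ≤ u₁ + u₂ := by
    obtain ⟨z, hz, hzB, hk⟩ := hc.exists_notMem _ (hLne (Set.union_subset s₁ s₂) (s₃ hx₃)
      (fun hx => lt_irrefl _ (hlr x₃ hx x₃ (Or.inl hx₃)))) _ h.cov₁₂
    have hxz : θ y₂ < θ z := by
      rcases hmem z hz with hz | hz | hz | hz
      · exact absurd (Or.inl hz) hzB
      · exact absurd (Or.inr hz) hzB
      · exact h₂₃ _ hy₂ _ hz
      · exact h₂₄ _ hy₂ _ hz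
    have := hk x₁ (Or.inl hx₁) y₂ (Or.inr hy₂)
    rw [fwd_of_le (by linarith), fwd_of_le (by linarith)] at this
    exact this (by linarith)
  have e₂ : θ y₄ - θ x₃ ≤ u₃ + u₄ := by
    obtain ⟨z, hz, hzB, hk⟩ := hc.exists_notMem _ (hLne (Set.union_subset s₃ s₄) (s₁ hx₁)
      (fun hx => lt_irrefl _ (hlr x₁ (Or.inl hx₁) x₁ hx))) _ h.cov₃₄
    have hxz : θ z < θ x₃ := by
      rcases hmem z hz with hz | hz | hz | hz
      · exact h₁₃ _ hz _ hx₃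
      · exact h₂₃ _ hz _ hx₃
      · exact absurd (Or.inl hz) hzB
      · exact absurd (Or.inr hz) hzB
    have hz0 := hc.nonneg z hz
    have := hk x₃ (Or.inl hx₃) y₄ (Or.inr hy₄)
    rw [fwd_of_le (by linarith), fwd_of_lt (by linarith)] at this
    exact this (by linarith)
  -- All leaves but `m` are covered by `T` itself, so the missed leaf can only be `m`, and the arc
  -- from `y` round to `x` has length at most `t₀`.
  have hull : ∀ x ∈ L, ∀ y ∈ L, ∀ m ∈ L, θ x < θ m → θ m < θ y → G - (θ y - θ x) ≤ t₀ := by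
    intro x hx y hy m hm hxm hmy
    have hxm' : x ≠ m := fun h => by rw [h] at hxm; exact lt_irrefl _ hxm
    have hym' : y ≠ m := fun h => by rw [h] at hmy; exact lt_irrefl _ hmy
    have hss : L \ {m} ⊂ L := hLne Set.sdiff_subset hm (by simp)
    obtain ⟨z, hz, hzB, hk⟩ := hc.exists_notMem _ hss _ (htop _ hss)
    obtain rfl : z = m := by_contra fun h => hzB ⟨hz, h⟩
    have := hk y ⟨hy, hym'⟩ x ⟨hx, hxm'⟩
    rw [fwd_of_lt (by linarith), fwd_of_lt (by linarith)] at this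
    linarith [this (by linarith)]
  have third : ∀ {S : Set α} {x y : α}, 3 ≤ S.ncard → S ⊆ L → x ∈ S → y ∈ S →
      (∀ s ∈ S, θ x ≤ θ s) → (∀ s ∈ S, θ s ≤ θ y) → G - (θ y - θ x) ≤ t₀ := by
    intro S x y hS hSL hx hy hmin hmax
    have : ∃ m ∈ S, m ∉ ({x, y} : Set α) := by
      by_contra! hcon
      have h1 := Set.ncard_le_ncard (s := S) (t := {x, y}) hcon (Set.toFinite _)
      have h2 := Set.ncard_insert_le x {y}
      rw [Set.ncard_singleton] at h2
      omega
    obtain ⟨m, hm, hmxy⟩ := this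
    simp only [Set.mem_insert_iff, Set.mem_singleton_iff, not_or] at hmxy
    exact hull x (hSL hx) y (hSL hy) m (hSL hm)
      (hc.lt_of_ne (hSL hx) (hSL hm) (Ne.symm hmxy.1) (hmin m hm))
      (hc.lt_of_ne (hSL hm) (hSL hy) hmxy.2 (hmax m hm))
  have w₁ := third hl (Set.union_subset s₁ s₂) (Or.inl hx₁) (Or.inr hy₂)
    (by rintro s (hs | hs); exacts [mx₁ s hs, (h₁₂ x₁ hx₁ s hs).le])
    (by rintro s (hs | hs); exacts [(h₁₂ s hs y₂ hy₂).le, my₂ s hs])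
  have w₂ := third hr (Set.union_subset s₃ s₄) (Or.inl hx₃) (Or.inr hy₄)
    (by rintro s (hs | hs); exacts [mx₃ s hs, (h₃₄ x₃ hx₃ s hs).le])
    (by rintro s (hs | hs); exacts [(h₃₄ s hs y₄ hy₄).le, my₄ s hs])
  -- the two crossing pairs
  have k₁ : G - (θ x₃ - θ y₁) ≤ u₁ + q + u₃ ∨ θ y₃ - θ x₁ ≤ u₁ + q + u₃ := by
    obtain ⟨z, hz, hzB, hk⟩ := hc.exists_notMem _ (hLne (Set.union_subset s₁ s₃) (s₂ hx₂)
      (by rintro (hx | hx); exacts [n₁₂ _ hx hx₂, n₂₃ _ hx₂ hx])) _ h.cov₁₃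
    rcases hmem z hz with hz' | hz' | hz' | hz'
    · exact absurd (Or.inl hz') hzB
    · left
      have a₁ := h₁₂ y₁ hy₁ z hz'
      have a₂ := h₂₃ z hz' x₃ hx₃
      have := hk x₃ (Or.inr hx₃) y₁ (Or.inl hy₁)
      rw [fwd_of_lt (by linarith), fwd_of_lt (by linarith)] at this
      linarith [this (by linarith)]
    · exact absurd (Or.inr hz') hzB
    · right
      have a₁ := h₃₄ y₃ hy₃ z hz'
      have := hk x₁ (Or.inl hx₁) y₃ (Or.inr hy₃)
      rw [fwd_of_le (by linarith), fwd_of_le (by linarith)] at this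
      exact this (by linarith)
  have k₂ : θ y₄ - θ x₂ ≤ u₂ + q + u₄ ∨ G - (θ x₄ - θ y₂) ≤ u₂ + q + u₄ := by
    obtain ⟨z, hz, hzB, hk⟩ := hc.exists_notMem _ (hLne (Set.union_subset s₂ s₄) (s₁ hx₁)
      (by rintro (hx | hx); exacts [n₁₂ _ hx₁ hx, n₁₄ _ hx₁ hx])) _ h.cov₂₄
    rcases hmem z hz with hz' | hz' | hz' | hz'
    · left
      have a₁ := h₁₂ z hz' x₂ hx₂
      have a₂ := hc.nonneg z hz
      have := hk x₂ (Or.inl hx₂) y₄ (Or.inr hy₄)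
      rw [fwd_of_le (by linarith), fwd_of_lt (by linarith)] at this
      exact this (by linarith)
    · exact absurd (Or.inl hz') hzB
    · right
      have a₁ := h₂₃ y₂ hy₂ z hz'
      have a₂ := h₃₄ z hz' x₄ hx₄
      have := hk x₄ (Or.inr hx₄) y₂ (Or.inl hy₂)
      rw [fwd_of_lt (by linarith), fwd_of_lt (by linarith)] at this
      linarith [this (by linarith)]
    · exact absurd (Or.inr hz') hzB
  have hsum := h.sum_le
  -- In the first and last case the two arcs have total length `G` minus a gap plus a hull, which
  -- exceeds `t₀ + q` because the hull is at least `δ > q`. In the mixed cases the total is at least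
  -- `G` minus one of `d₂`, `d₄` plus the other, which exceeds `t₀ + q` by `q ≤ d₂ + d₄ - δ`.
  rcases k₁ with k₁ | k₁ <;> rcases k₂ with k₂ | k₂ <;> linarith

/-- A path of the tree cannot have three leaves on either side. -/
lemma ncard_le_two_or (h : IsQuad t₀ L Cov I₁ I₂ I₃ I₄ u₁ u₂ u₃ u₄ q)
    (hc : ShortcutCircle θ G t₀ L Cov) (htop : ∀ B ⊂ L, Cov B t₀) :
    (I₁ ∪ I₂).ncard ≤ 2 ∨ (I₃ ∪ I₄).ncard ≤ 2 := by
  by_contra! hcon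
  obtain ⟨hl, hr⟩ := hcon
  have hq := h.q_nonneg
  have hsum := h.sum_le
  have hne₁₂ := h.nonempty₁.inl (t := I₂)
  have hne₃₄ := h.nonempty₃.inl (t := I₄)
  have hU := h.union_eq
  -- With `a₀` as the new origin, all of `I₁ ∪ I₂` precedes all of `I₃ ∪ I₄`.
  obtain ⟨a₀, ha₀, hsep⟩ := hc.separate h.union_eq h.disj hne₁₂ hne₃₄ h.cov₁₂ h.cov₃₄
    (by linarith)
  have ha₀L : a₀ ∈ L := hU ▸ Or.inl ha₀
  have hc' := hc.rebase ha₀L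
  set φ := fwd θ G a₀ with hφ
  have sub₁₂ : I₁ ∪ I₂ ⊆ L := hU ▸ Set.subset_union_left
  have sub₃₄ : I₃ ∪ I₄ ⊆ L := hU ▸ Set.subset_union_right
  have ne : ∀ {A B : Set α}, Disjoint A B → A ⊆ L → B ⊆ L → ∀ a ∈ A, ∀ b ∈ B, φ a ≠ φ b :=
    fun hAB hA hB a ha b hb hab => by
      have := hc'.injOn (hA ha) (hB hb) hab
      exact Set.disjoint_left.1 hAB ha (this ▸ hb)
  have d := h.disj
  simp only [Set.disjoint_union_left, Set.disjoint_union_right] at d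
  obtain ⟨⟨d₁₃, d₂₃⟩, d₁₄, d₂₄⟩ := d
  have d₁₂ := h.disj₁₂
  have d₃₄ := h.disj₃₄
  have v₁ : L = I₁ ∪ (I₂ ∪ (I₃ ∪ I₄)) := by rw [hU, Set.union_assoc]
  have v₂ : L = I₂ ∪ (I₁ ∪ (I₃ ∪ I₄)) := by rw [hU, Set.union_comm I₁, Set.union_assoc]
  have v₃ : L = (I₄ ∪ (I₁ ∪ I₂)) ∪ I₃ := by
    rw [hU]; ext; simp only [Set.mem_union]; tauto
  have v₄ : L = (I₃ ∪ (I₁ ∪ I₂)) ∪ I₄ := by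
    rw [hU]; ext; simp only [Set.mem_union]; tauto
  obtain ⟨x₃, hx₃⟩ := h.nonempty₃
  -- Separating one block from the other three rules out interleaving. On the left side the later
  -- point `x₃` completes the forbidden alternation, on the right side the earlier point `a₀` does.
  have left := lt_or_lt_of_not_interleaved (θ := φ) h.nonempty₁ h.nonempty₂
    (ne d₁₂ (Set.subset_union_left.trans sub₁₂) (Set.subset_union_right.trans sub₁₂))
    (fun a ha a' ha' b hb h1 h2 => absurd (hc'.not_cross v₁ (by
      simp only [Set.disjoint_union_right]; exact ⟨d₁₂, d₁₃, d₁₄⟩) h.cov₁ h.cov₁' (by linarith)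
      ha ha' (Or.inl hb) (Or.inr (Or.inl hx₃)) h1 h2) (hsep a' (Or.inl ha') x₃ (Or.inl hx₃)).not_gt)
    (fun a ha a' ha' b hb h1 h2 => absurd (hc'.not_cross v₂ (by
      simp only [Set.disjoint_union_right]; exact ⟨d₁₂.symm, d₂₃, d₂₄⟩) h.cov₂ h.cov₂'
      (by linarith) ha ha' (Or.inl hb) (Or.inr (Or.inl hx₃)) h1 h2)
      (hsep a' (Or.inr ha') x₃ (Or.inl hx₃)).not_gt)
  have right := lt_or_lt_of_not_interleaved (θ := φ) h.nonempty₃ h.nonempty₄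
    (ne d₃₄ (Set.subset_union_left.trans sub₃₄) (Set.subset_union_right.trans sub₃₄))
    (fun a ha a' ha' b hb h1 h2 => absurd (hc'.not_cross v₃ (by
      simp only [Set.disjoint_union_left]; exact ⟨d₃₄.symm, d₁₃, d₂₃⟩) h.cov₃' h.cov₃
      (by linarith) (Or.inr ha₀) (Or.inl hb) ha ha' (hsep _ ha₀ a (Or.inl ha)) h1) h2.not_gt)
    (fun a ha a' ha' b hb h1 h2 => absurd (hc'.not_cross v₄ (by
      simp only [Set.disjoint_union_left]; exact ⟨d₃₄, d₁₄, d₂₄⟩) h.cov₄' h.cov₄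
      (by linarith) (Or.inr ha₀) (Or.inl hb) ha ha' (hsep _ ha₀ a (Or.inr ha)) h1) h2.not_gt)
  rcases left with left | left <;> rcases right with right | right
  · exact h.false_of_ordered hc' htop left right hsep hl hr
  · exact h.swap_right.false_of_ordered hc' htop left right (by rwa [Set.union_comm I₄]) hl
      (by rwa [Set.union_comm I₄])
  · exact h.swap_left.false_of_ordered hc' htop left right (by rwa [Set.union_comm I₂])
      (by rwa [Set.union_comm I₂]) hr
  · exact h.swap_left.swap_right.false_of_ordered hc' htop left right
      (by rwa [Set.union_comm I₂, Set.union_comm I₄]) (by rwa [Set.union_comm I₂])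
      (by rwa [Set.union_comm I₄])

end IsQuad

/-! ### Arc length on a cycle -/

namespace Graph

variable {α β : Type*} {G H X Y Z S T C P Q R : Graph α β} {ℓ : β → ℝ} {x y z : α}

/-- Periodic sequences of vertices and edges winding round a cycle with `n` vertices. -/
structure IsCycleSeq (C : Graph α β) (n : ℕ) (v : ℕ → α) (e : ℕ → β) : Prop where
  two_le : 2 ≤ n
  vert_add : ∀ i, v (i + n) = v i
  edge_add : ∀ i, e (i + n) = e i
  vert_injOn : Set.InjOn v (Set.Iio n)
  edge_injOn : Set.InjOn e (Set.Iio n)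
  vertexSet_eq : V(C) = v '' Set.Iio n
  edgeSet_eq : E(C) = e '' Set.Iio n
  isLink : ∀ i, C.IsLink (e i) (v i) (v (i + 1))

lemma IsCycle.exists_isCycleSeq (h : C.IsCycle) : ∃ n v e, C.IsCycleSeq n v e := by
  obtain ⟨n, v, e, hn, hv, he, hV, hE, hl⟩ := h
  have : NeZero n := ⟨by omega⟩
  have hinj : ∀ i < n, ∀ j < n, (i : ZMod n) = j → i = j := by
    intro i hi j hj hij
    rw [ZMod.natCast_eq_natCast_iff'] at hij
    rwa [Nat.mod_eq_of_lt hi, Nat.mod_eq_of_lt hj] at hij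
  refine ⟨n, fun i => v i, fun i => e i, hn, ?_, ?_, ?_, ?_, ?_, ?_, ?_⟩
  · intro i; simp
  · intro i; simp
  · intro i hi j hj hij
    exact hinj i hi j hj (hv hij)
  · intro i hi j hj hij
    exact hinj i hi j hj (he hij)
  · rw [hV]; ext z; constructor
    · rintro ⟨i, rfl⟩
      exact ⟨i.val, ZMod.val_lt i, by simp⟩
    · rintro ⟨i, -, rfl⟩
      exact ⟨_, rfl⟩
  · rw [hE]; ext z; constructor
    · rintro ⟨i, rfl⟩
      exact ⟨i.val, ZMod.val_lt i, by simp⟩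
    · rintro ⟨i, -, rfl⟩
      exact ⟨_, rfl⟩
  · intro i
    simpa using hl i

/-- The index below `n` of a vertex in a sequence. -/
noncomputable def seqPos (v : ℕ → α) (n : ℕ) (x : α) : ℕ := Function.invFunOn v (Set.Iio n) x

/-- The total length of the first `i` edges of a sequence. -/
noncomputable def seqLength (ℓ : β → ℝ) (e : ℕ → β) (i : ℕ) : ℝ := ∑ j ∈ Finset.range i, ℓ (e j)

namespace IsCycleSeq

variable {n : ℕ} {v : ℕ → α} {e : ℕ → β}

lemma pos (h : C.IsCycleSeq n v e) : 0 < n := by have := h.two_le; omega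

lemma seqPos_lt (h : C.IsCycleSeq n v e) (hx : x ∈ V(C)) : seqPos v n x < n :=
  Function.invFunOn_mem (h.vertexSet_eq ▸ hx : x ∈ v '' Set.Iio n)

lemma vert_seqPos (h : C.IsCycleSeq n v e) (hx : x ∈ V(C)) : v (seqPos v n x) = x :=
  Function.invFunOn_eq (h.vertexSet_eq ▸ hx : x ∈ v '' Set.Iio n)

lemma vert_mod (h : C.IsCycleSeq n v e) (i : ℕ) : v (i % n) = v i :=
  Function.Periodic.map_mod_nat h.vert_add i

lemma edge_mod (h : C.IsCycleSeq n v e) (i : ℕ) : e (i % n) = e i :=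
  Function.Periodic.map_mod_nat h.edge_add i

lemma eq_of_mod_eq {i j : ℕ} (hij : i % n = j % n) (h₁ : i ≤ j) (h₂ : j < i + n) : i = j := by
  have hd : n ∣ j - i := (Nat.modEq_iff_dvd' h₁).1 hij
  have := Nat.eq_zero_of_dvd_of_lt hd (by omega)
  omega

lemma vert_inj (h : C.IsCycleSeq n v e) {i j : ℕ} (hij : v i = v j) (h₁ : i ≤ j) (h₂ : j < i + n) :
    i = j := by
  rw [← h.vert_mod i, ← h.vert_mod j] at hij
  exact eq_of_mod_eq (h.vert_injOn (Nat.mod_lt _ h.pos) (Nat.mod_lt _ h.pos) hij) h₁ h₂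

lemma edge_inj (h : C.IsCycleSeq n v e) {i j : ℕ} (hij : e i = e j) (h₁ : i ≤ j) (h₂ : j < i + n) :
    i = j := by
  rw [← h.edge_mod i, ← h.edge_mod j] at hij
  exact eq_of_mod_eq (h.edge_injOn (Nat.mod_lt _ h.pos) (Nat.mod_lt _ h.pos) hij) h₁ h₂

lemma edge_mem (h : C.IsCycleSeq n v e) (i : ℕ) : e i ∈ E(C) := (h.isLink i).edge_mem

lemma edgeSet_finite (h : C.IsCycleSeq n v e) : E(C).Finite :=
  h.edgeSet_eq ▸ (Set.finite_Iio n).image e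

lemma isConnected (h : C.IsCycleSeq n v e) : C.IsConnected := by
  have key : ∀ i, Relation.ReflTransGen C.Adj (v 0) (v i) := by
    intro i
    induction i with
    | zero => exact .refl
    | succ i ih => exact ih.tail ⟨_, h.isLink i⟩
  refine ⟨⟨v 0, (h.isLink 0).left_mem⟩, ?_⟩
  rw [h.vertexSet_eq]
  rintro _ ⟨i, -, rfl⟩ _ ⟨j, -, rfl⟩
  exact (reflTransGen_symm (key i)).trans (key j)

lemma seqLength_succ (i : ℕ) : seqLength ℓ e (i + 1) = seqLength ℓ e i + ℓ (e i) :=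
  Finset.sum_range_succ _ _

lemma seqLength_strictMono (h : C.IsCycleSeq n v e) (hpos : ∀ e ∈ E(C), 0 < ℓ e) :
    StrictMono (seqLength ℓ e) :=
  strictMono_nat_of_lt_succ fun i => by
    rw [seqLength_succ]
    linarith [hpos _ (h.edge_mem i)]

lemma seqLength_add (h : C.IsCycleSeq n v e) (i : ℕ) :
    seqLength ℓ e (i + n) = seqLength ℓ e i + seqLength ℓ e n := by
  unfold seqLength
  rw [add_comm i n, Finset.sum_range_add, add_comm]
  congr 1
  refine Finset.sum_congr rfl fun j _ => ?_
  rw [add_comm n j, h.edge_add]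

lemma sum_Ico (i j : ℕ) (hij : i ≤ j) :
    ∑ k ∈ Finset.Ico i j, ℓ (e k) = seqLength ℓ e j - seqLength ℓ e i :=
  Finset.sum_Ico_eq_sub _ hij

lemma length_eq_sum {J : Finset ℕ} (hJ : Set.InjOn e J) (hE : E(S) = e '' J) :
    S.length ℓ = ∑ j ∈ J, ℓ (e j) := by
  unfold length
  rw [hE, finsum_mem_image hJ, finsum_mem_coe_finset]

lemma length_eq (h : C.IsCycleSeq n v e) : C.length ℓ = seqLength ℓ e n :=
  length_eq_sum (J := Finset.range n) (by simpa using h.edge_injOn) (by simpa using h.edgeSet_eq)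

lemma sum_le_length (h : C.IsCycleSeq n v e) (hpos : ∀ e ∈ E(C), 0 < ℓ e) (hS : S ≤ C)
    {J : Finset ℕ} (hJ : ∀ j ∈ J, j < n) (hJS : ∀ j ∈ J, e j ∈ E(S)) :
    ∑ j ∈ J, ℓ (e j) ≤ S.length ℓ := by
  have hinj : Set.InjOn e J := fun i hi j hj => h.edge_injOn (hJ i hi) (hJ j hj)
  have hfin : E(S).Finite := h.edgeSet_finite.subset hS.edgeSet_mono
  classical
  unfold length
  rw [finsum_mem_eq_finite_toFinset_sum _ hfin, ← Finset.sum_image hinj]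
  refine Finset.sum_le_sum_of_subset_of_nonneg ?_ fun f hf _ => ?_
  · intro f hf
    obtain ⟨j, hj, rfl⟩ := Finset.mem_image.1 hf
    simpa using hJS j hj
  · exact (hpos f (hS.edgeSet_mono (by simpa using hf))).le

/-- The path in the cycle from `v i` to `v j`. -/
lemma exists_arc (h : C.IsCycleSeq n v e) {i j : ℕ} (hij : i ≤ j) (hj : j < i + n) :
    ∃ P ≤ C, V(P) = v '' Set.Icc i j ∧ E(P) = e '' Set.Ico i j ∧ P.IsPath (v i) (v j) ∧
      P.length ℓ = seqLength ℓ e j - seqLength ℓ e i := by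
  have hs : C.IsPathSeq (j - i) (fun k => v (i + k)) (fun k => e (i + k)) := by
    constructor
    · intro a ha b hb hab
      simp only [Set.mem_Iic] at ha hb
      rcases le_total a b with hle | hle
      · have := h.vert_inj hab (by omega) (by omega); omega
      · have := h.vert_inj hab.symm (by omega) (by omega); omega
    · intro k _
      exact h.isLink (i + k)
  obtain ⟨P, hP, hV, hE, hp⟩ := hs.exists_isPath (h.isLink _).left_mem
  have hE' : E(P) = e '' Set.Ico i j := by
    rw [hE]; ext z; constructor
    · rintro ⟨k, hk, rfl⟩
      exact ⟨i + k, by simp at hk ⊢; omega, rfl⟩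
    · rintro ⟨k, hk, rfl⟩
      simp only [Set.mem_Ico] at hk
      exact ⟨k - i, by simp; omega, by simp only; congr 1; omega⟩
  refine ⟨P, hP, ?_, hE', ?_, ?_⟩
  · rw [hV]; ext z; constructor
    · rintro ⟨k, hk, rfl⟩
      exact ⟨i + k, by simp at hk ⊢; omega, rfl⟩
    · rintro ⟨k, hk, rfl⟩
      simp only [Set.mem_Icc] at hk
      exact ⟨k - i, by simp; omega, by simp only; congr 1; omega⟩
  · simpa [Nat.add_sub_cancel' hij] using hp
  · rw [length_eq_sum (J := Finset.Ico i j) (e := e) ?_ (by simpa using hE'), sum_Ico i j hij]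
    intro a ha b hb hab
    simp only [Finset.coe_Ico, Set.mem_Ico] at ha hb
    rcases le_total a b with hle | hle
    · exact h.edge_inj hab (by omega) (by omega)
    · exact (h.edge_inj hab.symm (by omega) (by omega)).symm

lemma exists_of_isLink (h : C.IsCycleSeq n v e) (hS : S ≤ C) (hxy : S.Adj x y) :
    ∃ i < n, e i ∈ E(S) ∧ v i ∈ V(S) ∧ v (i + 1) ∈ V(S) ∧
      ((x = v i ∧ y = v (i + 1)) ∨ (x = v (i + 1) ∧ y = v i)) := by
  obtain ⟨f, hf⟩ := hxy
  obtain ⟨i, hi, rfl⟩ : f ∈ e '' Set.Iio n := h.edgeSet_eq ▸ hS.edgeSet_mono hf.edge_mem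
  have hl := (hS.isLink_iff hf.edge_mem).2 (h.isLink i)
  exact ⟨i, hi, hf.edge_mem, hl.left_mem, hl.right_mem, hf.eq_and_eq_or_eq_and_eq hl⟩

/-- The vertices with index in `(z, j]` are closed under adjacency in `S`: leaving downwards would
lead to the missing vertex `v z`, and leaving upwards would use the missing edge `e j`. -/
lemma mem_after (h : C.IsCycleSeq n v e) (hS : S ≤ C) (hc : S.IsConnected) {z j k l : ℕ}
    (hz : v z ∉ V(S)) (hj : j < n) (hjS : e j ∉ E(S)) (hk : z < k) (hkj : k ≤ j)
    (hkS : v k ∈ V(S)) (hl : l < n) (hlS : v l ∈ V(S)) : z < l ∧ l ≤ j := by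
  have hU := mem_of_reflTransGen (G := S) (U := {x | ∃ i, z < i ∧ i ≤ j ∧ v i = x}) (by
    rintro _ ⟨k, hzk, hkj, rfl⟩ b hab
    obtain ⟨i, hi, hiS, hiV, hiV', h' | h'⟩ := h.exists_of_isLink hS hab
    · obtain ⟨h₁, rfl⟩ := h'
      obtain rfl := h.vert_injOn (show k < n by omega) hi h₁
      have : k ≠ j := fun heq => hjS (heq ▸ hiS)
      exact ⟨k + 1, by omega, by omega, rfl⟩
    · obtain ⟨h₁, rfl⟩ := h'
      -- If `i` is the last index, `v (i + 1)` is `v 0`, and `k = 0` contradicts `z < k`.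
      have hik : k = i + 1 := by
        rcases Nat.lt_or_ge (i + 1) n with hlt | hge
        · exact h.vert_injOn (show k < n by omega) hlt h₁
        · obtain rfl : i + 1 = n := by omega
          have h0 := h.vert_add 0
          rw [zero_add] at h0
          rw [h0] at h₁
          have := h.vert_injOn (show k < i + 1 by omega) (show 0 < i + 1 by omega) h₁
          omega
      subst hik
      have : i ≠ z := fun heq => hz (heq ▸ hiV)
      exact ⟨i, by omega, by omega, rfl⟩) ⟨k, hk, hkj, rfl⟩ (hc.2 _ hkS _ hlS)
  obtain ⟨i, hzi, hij, hil⟩ := hU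
  obtain rfl := h.vert_injOn (show i < n by omega) hl hil
  exact ⟨hzi, hij⟩

/-- The mirror image of `mem_after`: the missing edge `e j` bounds the interval from below and the
missing vertex `v z` from above. -/
lemma mem_before (h : C.IsCycleSeq n v e) (hS : S ≤ C) (hc : S.IsConnected) {z j k l : ℕ}
    (hzn : z < n) (hz : v z ∉ V(S)) (hjS : e j ∉ E(S)) (hk : j < k) (hkz : k < z)
    (hkS : v k ∈ V(S)) (hl : l < n) (hlS : v l ∈ V(S)) : j < l ∧ l < z := by
  have hU := mem_of_reflTransGen (G := S) (U := {x | ∃ i, j < i ∧ i < z ∧ v i = x}) (by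
    rintro _ ⟨k, hjk, hkz, rfl⟩ b hab
    obtain ⟨i, hi, hiS, hiV, hiV', h' | h'⟩ := h.exists_of_isLink hS hab
    · obtain ⟨h₁, rfl⟩ := h'
      obtain rfl := h.vert_injOn (show k < n by omega) hi h₁
      have : k + 1 ≠ z := fun heq => hz (heq ▸ hiV')
      exact ⟨k + 1, by omega, by omega, rfl⟩
    · obtain ⟨h₁, rfl⟩ := h'
      have hik : k = i + 1 := by
        rcases Nat.lt_or_ge (i + 1) n with hlt | hge
        · exact h.vert_injOn (show k < n by omega) hlt h₁
        · obtain rfl : i + 1 = n := by omega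
          have h0 := h.vert_add 0
          rw [zero_add] at h0
          rw [h0] at h₁
          have := h.vert_injOn (show k < i + 1 by omega) (show 0 < i + 1 by omega) h₁
          omega
      subst hik
      have : i ≠ j := fun heq => hjS (heq ▸ hiS)
      exact ⟨i, by omega, by omega, rfl⟩) ⟨k, hk, hkz, rfl⟩ (hc.2 _ hkS _ hlS)
  obtain ⟨i, hji, hiz, hil⟩ := hU
  obtain rfl := h.vert_injOn (show i < n by omega) hl hil
  exact ⟨hji, hiz⟩

/-- A connected subgraph avoiding a vertex contains, with any two vertices, the arc between them
that avoids this vertex. -/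
lemma fwd_le_length (h : C.IsCycleSeq n v e) (hpos : ∀ e ∈ E(C), 0 < ℓ e) (hS : S ≤ C)
    (hc : S.IsConnected) (hz : z ∈ V(C)) (hzS : z ∉ V(S)) (hx : x ∈ V(S)) (hy : y ∈ V(S))
    (hlt : fwd (fun x => seqLength ℓ e (seqPos v n x)) (seqLength ℓ e n) x y <
      fwd (fun x => seqLength ℓ e (seqPos v n x)) (seqLength ℓ e n) x z) :
    fwd (fun x => seqLength ℓ e (seqPos v n x)) (seqLength ℓ e n) x y ≤ S.length ℓ := by
  have hmono := h.seqLength_strictMono hpos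
  have hxC := hS.vertexSet_mono hx
  have hyC := hS.vertexSet_mono hy
  have hxn := h.seqPos_lt hxC
  have hyn := h.seqPos_lt hyC
  have hzn := h.seqPos_lt hz
  have hx' := h.vert_seqPos hxC
  have hy' := h.vert_seqPos hyC
  have hz' := h.vert_seqPos hz
  set a := seqPos v n x with ha
  set b := seqPos v n y with hb
  set c := seqPos v n z with hcc
  have hac : a ≠ c := fun heq => hzS (by rw [← hz', ← heq, hx']; exact hx)
  have hbc : b ≠ c := fun heq => hzS (by rw [← hz', ← heq, hy']; exact hy)
  rw [← hx'] at hx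
  rw [← hy'] at hy
  rw [← hz'] at hzS
  have hWc := hmono hzn
  have hW0 : ∀ i, 0 ≤ seqLength ℓ e i := fun i => by
    have := hmono.monotone (Nat.zero_le i)
    simpa [seqLength] using this
  unfold fwd at hlt ⊢
  simp only [← ha, ← hb, ← hcc, hmono.le_iff_le] at hlt ⊢
  rcases le_or_gt a b with hab | hab
  · rw [if_pos hab] at hlt ⊢
    have hbetween : ¬ (a < c ∧ c < b) := by
      rintro ⟨h₁, h₂⟩
      rw [if_pos h₁.le] at hlt
      have := hmono h₂
      linarith
    rw [← sum_Ico a b hab]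
    refine h.sum_le_length hpos hS (fun j hj => ?_) fun j hj => ?_
    · rw [Finset.mem_Ico] at hj; omega
    · rw [Finset.mem_Ico] at hj
      by_contra hjS
      -- An edge of the arc missing from `S`, together with the missing vertex `z` off the arc,
      -- would separate `x` from `y` in `S`.
      rcases Nat.lt_or_ge c a with hca | hca
      · have := h.mem_after hS hc hzS (by omega) hjS hca hj.1 hx hyn hy
        omega
      · have := h.mem_before hS hc hzn hzS hjS hj.2 (by omega) hy hxn hx
        omega
  · rw [if_neg hab.not_ge] at hlt ⊢
    have hbetween : b < c ∧ c < a := by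
      constructor
      · by_contra! hcb
        rw [if_neg (by omega)] at hlt
        have := hmono.monotone hcb
        linarith
      · by_contra! hca
        rw [if_pos hca] at hlt
        have := hW0 b
        linarith
    -- An arc through the origin consists of the edges outside the opposite arc.
    have hsum : seqLength ℓ e b - seqLength ℓ e a + seqLength ℓ e n =
        ∑ j ∈ Finset.range n \ Finset.Ico b a, ℓ (e j) := by
      rw [Finset.sum_sdiff_eq_sub, sum_Ico b a hab.le]
      · unfold seqLength; ring
      · intro j hj
        rw [Finset.mem_Ico] at hj
        rw [Finset.mem_range]; omega
    rw [hsum]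
    refine h.sum_le_length hpos hS (fun j hj => ?_) fun j hj => ?_
    · rw [Finset.mem_sdiff, Finset.mem_range] at hj; exact hj.1
    · rw [Finset.mem_sdiff, Finset.mem_range, Finset.mem_Ico] at hj
      by_contra hjS
      rcases Nat.lt_or_ge j b with hjb | hjb
      · have := h.mem_before hS hc hzn hzS hjS hjb hbetween.1 hy hxn hx
        omega
      · have := h.mem_after hS hc hzS hj.1 hjS hbetween.2 (by omega) hx hyn hy
        omega

end IsCycleSeq

/-- The set `B` is contained in a connected subgraph of `T` of length at most `t`. -/
def Covers (ℓ : β → ℝ) (T : Graph α β) (B : Set α) (t : ℝ) : Prop :=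
  ∃ S ≤ T, S.IsConnected ∧ B ⊆ V(S) ∧ S.length ℓ ≤ t

/-- Condition (4) supplies a connected subgraph of `C` that contains `B` and is no longer than the
given subtree, hence no longer than `T`. By (3) it misses a leaf `z`, and `fwd_le_length` bounds the
arcs that avoid `z`. The bound on gaps is (3) applied to the arc complementary to the gap. -/
lemma IsShortcutTree.shortcutCircle (hT : IsShortcutTree ℓ T C) (hTV : V(T).Finite)
    (hTE : E(T).Finite) {n : ℕ} {v : ℕ → α} {e : ℕ → β} (hC : C.IsCycleSeq n v e) :
    ShortcutCircle (fun x => seqLength ℓ e (seqPos v n x)) (seqLength ℓ e n) (T.length ℓ) T.leaves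
      (Covers ℓ T) := by
  have hpos : ∀ e ∈ E(C), 0 < ℓ e := fun e he => hT.length_pos e (Or.inr he)
  have hposT : ∀ e ∈ E(T), 0 < ℓ e := fun e he => hT.length_pos e (Or.inl he)
  have hLC : T.leaves ⊆ V(C) := fun x hx => (hT.vert.ge hx).2
  have hmono := hC.seqLength_strictMono hpos
  have hW0 : ∀ i, 0 ≤ seqLength ℓ e i := fun i => by
    have := hmono.monotone (Nat.zero_le i)
    simpa [seqLength] using this
  have hshort : ∀ S ≤ C, S.IsConnected → T.leaves ⊆ V(S) → T.length ℓ < S.length ℓ := by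
    intro S hS hc hL
    exact_mod_cast hT.shorter.trans_le (steinerDist_le hS hc hL)
  refine ⟨hTV.subset fun x hx => hx.1, fun x _ => hW0 _, fun x hx => hmono (hC.seqPos_lt (hLC hx)),
    ?_, ?_, ?_, ?_⟩
  · intro x hx y hy hxy
    have := hmono.injective hxy
    rw [← hC.vert_seqPos (hLC hx), this, hC.vert_seqPos (hLC hy)]
  · rw [← hC.length_eq]
    exact hshort C le_rfl hC.isConnected hLC
  · rintro B hB t ⟨S, hS, hSc, hBS, hSt⟩
    obtain ⟨S', hS', hc', hBS', heq⟩ :=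
      exists_steinerDist_eq (ℓ := ℓ) hC.edgeSet_finite hC.isConnected
      (hB.1.trans hLC)
    have hle : S'.length ℓ ≤ S.length ℓ := by
      have := (hT.minimal B hB).trans (steinerDist_le hS hSc hBS)
      rw [heq] at this
      exact_mod_cast this
    have hnot : ¬ T.leaves ⊆ V(S') := fun hL => by
      have h1 := hshort S' hS' hc' hL
      have h2 := length_mono hS hTE hposT
      linarith
    obtain ⟨z, hz, hzS⟩ := Set.not_subset.1 hnot
    refine ⟨z, hz, fun h => hzS (hBS' h), fun b hb b' hb' hlt => ?_⟩
    exact (hC.fwd_le_length hpos hS' hc' (hLC hz) hzS (hBS' hb) (hBS' hb') hlt).trans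
      (hle.trans hSt)
  · intro p hp q hq hpq hnext
    have hpn := hC.seqPos_lt (hLC hp)
    have hqn := hC.seqPos_lt (hLC hq)
    have hp' := hC.vert_seqPos (hLC hp)
    have hq' := hC.vert_seqPos (hLC hq)
    have hne : seqPos v n p ≠ seqPos v n q := fun h => hpq (by rw [← hp', h, hq'])
    unfold fwd at hnext ⊢
    simp only [hmono.le_iff_le] at hnext ⊢
    rcases lt_or_gt_of_ne hne with hlt | hlt
    -- The complementary arc passes the origin, so `p` is represented by its index in the next
    -- period.
    · obtain ⟨P, hP, hV, hE, hPp, hPl⟩ := hC.exists_arc (ℓ := ℓ) (i := seqPos v n q)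
        (j := seqPos v n p + n) (by omega) (by omega)
      have hPne : v (seqPos v n q) ≠ v (seqPos v n p + n) := by
        rw [hC.vert_add, hp', hq']; exact hpq.symm
      have := hshort P hP (hPp.isConnected hPne) (by
        intro x hx
        have hxn := hC.seqPos_lt (hLC hx)
        have hx' := hC.vert_seqPos (hLC hx)
        rw [hV]
        by_cases hxp : x = p
        · exact ⟨seqPos v n p + n, ⟨by omega, le_rfl⟩, by rw [hC.vert_add, hp', hxp]⟩
        have := hnext x hx hxp
        rw [if_pos hlt.le] at this
        rcases Nat.lt_or_ge (seqPos v n x) (seqPos v n p) with hxp' | hxp'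
        · exact ⟨seqPos v n x + n, ⟨by omega, by omega⟩, by rw [hC.vert_add, hx']⟩
        · rw [if_pos hxp'] at this
          have hle : seqPos v n q ≤ seqPos v n x := hmono.le_iff_le.1 (by linarith)
          exact ⟨seqPos v n x, ⟨hle, by omega⟩, hx'⟩)
      rw [hPl, hC.seqLength_add] at this
      rw [if_pos hlt.le]
      linarith
    · obtain ⟨P, hP, hV, hE, hPp, hPl⟩ := hC.exists_arc (ℓ := ℓ) (i := seqPos v n q)
        (j := seqPos v n p) (by omega) (by omega)
      have hPne : v (seqPos v n q) ≠ v (seqPos v n p) := by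
        rw [hp', hq']; exact hpq.symm
      have := hshort P hP (hPp.isConnected hPne) (by
        intro x hx
        have hxn := hC.seqPos_lt (hLC hx)
        have hx' := hC.vert_seqPos (hLC hx)
        rw [hV]
        by_cases hxp : x = p
        · exact ⟨seqPos v n p, ⟨by omega, le_rfl⟩, by rw [hp', hxp]⟩
        have := hnext x hx hxp
        rw [if_neg (by omega)] at this
        rcases Nat.lt_or_ge (seqPos v n x) (seqPos v n p) with hxp' | hxp'
        · rw [if_neg (by omega)] at this
          have hle : seqPos v n q ≤ seqPos v n x := hmono.le_iff_le.1 (by linarith)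
          exact ⟨seqPos v n x, ⟨hle, by omega⟩, hx'⟩
        · rw [if_pos hxp'] at this
          have h1 := hmono hxn
          have h2 := hW0 (seqPos v n q)
          linarith)
      rw [hPl] at this
      rw [if_neg (by omega)]
      linarith

end Graph

/-! ### Tripods, and the bound on the degrees of the tree -/

namespace Graph

variable {α β : Type*} {G H X Y Z S T C P Q R X₁ X₂ : Graph α β} {ℓ : β → ℝ}
  {c r u v w x y z : α} {e f : β}

/-- `G` arises from three connected subgraphs by gluing them at the vertex `c`. -/
structure Tripod (G : Graph α β) (c : α) (X Y Z : Graph α β) : Prop where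
  le₁ : X ≤ G
  le₂ : Y ≤ G
  le₃ : Z ≤ G
  conn₁ : X.IsConnected
  conn₂ : Y.IsConnected
  conn₃ : Z.IsConnected
  vertexSet_eq : V(G) = V(X) ∪ V(Y) ∪ V(Z)
  edgeSet_eq : E(G) = E(X) ∪ E(Y) ∪ E(Z)
  inter₁₂ : V(X) ∩ V(Y) = {c}
  inter₁₃ : V(X) ∩ V(Z) = {c}
  inter₂₃ : V(Y) ∩ V(Z) = {c}
  disj₁₂ : Disjoint E(X) E(Y)
  disj₁₃ : Disjoint E(X) E(Z)
  disj₂₃ : Disjoint E(Y) E(Z)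

namespace Tripod

lemma mem₁ (h : Tripod G c X Y Z) : c ∈ V(X) := (h.inter₁₂.ge rfl).1

lemma mem₂ (h : Tripod G c X Y Z) : c ∈ V(Y) := (h.inter₁₂.ge rfl).2

lemma mem₃ (h : Tripod G c X Y Z) : c ∈ V(Z) := (h.inter₁₃.ge rfl).2

lemma eq₁₂ (h : Tripod G c X Y Z) (hx : x ∈ V(X)) (hy : x ∈ V(Y)) : x = c :=
  h.inter₁₂.le ⟨hx, hy⟩

lemma eq₁₃ (h : Tripod G c X Y Z) (hx : x ∈ V(X)) (hz : x ∈ V(Z)) : x = c :=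
  h.inter₁₃.le ⟨hx, hz⟩

lemma eq₂₃ (h : Tripod G c X Y Z) (hy : x ∈ V(Y)) (hz : x ∈ V(Z)) : x = c :=
  h.inter₂₃.le ⟨hy, hz⟩

lemma swap (h : Tripod G c X Y Z) : Tripod G c Y X Z where
  le₁ := h.le₂
  le₂ := h.le₁
  le₃ := h.le₃
  conn₁ := h.conn₂
  conn₂ := h.conn₁
  conn₃ := h.conn₃
  vertexSet_eq := by rw [h.vertexSet_eq, Set.union_comm V(X)]
  edgeSet_eq := by rw [h.edgeSet_eq, Set.union_comm E(X)]
  inter₁₂ := by rw [← h.inter₁₂, Set.inter_comm]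
  inter₁₃ := h.inter₂₃
  inter₂₃ := h.inter₁₃
  disj₁₂ := h.disj₁₂.symm
  disj₁₃ := h.disj₂₃
  disj₂₃ := h.disj₁₃

lemma rotate (h : Tripod G c X Y Z) : Tripod G c Y Z X where
  le₁ := h.le₂
  le₂ := h.le₃
  le₃ := h.le₁
  conn₁ := h.conn₂
  conn₂ := h.conn₃
  conn₃ := h.conn₁
  vertexSet_eq := by rw [h.vertexSet_eq, Set.union_assoc, Set.union_comm]
  edgeSet_eq := by rw [h.edgeSet_eq, Set.union_assoc, Set.union_comm]
  inter₁₂ := h.inter₂₃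
  inter₁₃ := by rw [← h.inter₁₂, Set.inter_comm]
  inter₂₃ := by rw [← h.inter₁₃, Set.inter_comm]
  disj₁₂ := h.disj₂₃
  disj₁₃ := h.disj₁₂.symm
  disj₂₃ := h.disj₁₃.symm

lemma swap_right (h : Tripod G c X Y Z) : Tripod G c X Z Y := h.swap.rotate

lemma length_eq (h : Tripod G c X Y Z) (hE : E(G).Finite) :
    G.length ℓ = X.length ℓ + Y.length ℓ + Z.length ℓ := by
  have hX := hE.subset h.le₁.edgeSet_mono
  have hY := hE.subset h.le₂.edgeSet_mono
  have hZ := hE.subset h.le₃.edgeSet_mono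
  rw [length_eq_add (X := X ∪ Y) (hX.union hY) hZ
    (Set.disjoint_union_left.2 ⟨h.disj₁₃, h.disj₂₃⟩) h.edgeSet_eq,
    length_eq_add (G := X ∪ Y) hX hY h.disj₁₂ rfl]

lemma compat₁₂ (h : Tripod G c X Y Z) : X.Compatible Y := .of_le_le h.le₁ h.le₂

lemma conn_union (h : Tripod G c X Y Z) : (X ∪ Y).IsConnected :=
  h.conn₁.union h.conn₂ h.compat₁₂ h.mem₁ h.mem₂

lemma glue (h : Tripod G c X Y Z) : Glue G (Y ∪ Z) X c where
  left_le := union_le h.le₂ h.le₃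
  right_le := h.le₁
  vertexSet_eq := by rw [h.vertexSet_eq, Set.union_assoc, Set.union_comm]; rfl
  edgeSet_eq := by rw [h.edgeSet_eq, Set.union_assoc, Set.union_comm]; rfl
  inter_eq := by
    rw [vertexSet_union, Set.union_inter_distrib_right, Set.inter_comm, h.inter₁₂, Set.inter_comm,
      h.inter₁₃, Set.union_self]
  disjoint := Set.disjoint_union_left.2 ⟨h.disj₁₂.symm, h.disj₁₃.symm⟩

lemma of_glue (h : Glue G P Y w) (h' : Glue Y X₁ X₂ w) (hP : P.IsConnected)
    (h₁ : X₁.IsConnected) (h₂ : X₂.IsConnected) : Tripod G w P X₁ X₂ where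
  le₁ := h.left_le
  le₂ := h'.left_le.trans h.right_le
  le₃ := h'.right_le.trans h.right_le
  conn₁ := hP
  conn₂ := h₁
  conn₃ := h₂
  vertexSet_eq := by rw [h.vertexSet_eq, h'.vertexSet_eq, Set.union_assoc]
  edgeSet_eq := by rw [h.edgeSet_eq, h'.edgeSet_eq, Set.union_assoc]
  inter₁₂ := by
    refine Set.Subset.antisymm (fun x hx => h.inter_eq.le ⟨hx.1, h'.left_le.vertexSet_mono hx.2⟩) ?_
    rintro x rfl
    exact ⟨h.left_mem, h'.left_mem⟩
  inter₁₃ := by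
    refine Set.Subset.antisymm
      (fun x hx => h.inter_eq.le ⟨hx.1, h'.right_le.vertexSet_mono hx.2⟩) ?_
    rintro x rfl
    exact ⟨h.left_mem, h'.right_mem⟩
  inter₂₃ := h'.inter_eq
  disj₁₂ := h.disjoint.mono_right h'.left_le.edgeSet_mono
  disj₁₃ := h.disjoint.mono_right h'.right_le.edgeSet_mono
  disj₂₃ := h'.disjoint

/-- If the first part of a tripod is again a tripod, the centre can be moved. -/
lemma move (h : Tripod G c X Y Z) (h' : Tripod X w Q X₁ X₂) (hc : c ∈ V(Q)) (hcw : c ≠ w) :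
    Tripod G w X₁ X₂ (Q ∪ Y ∪ Z) ∧ Tripod (Q ∪ Y ∪ Z) c Q Y Z := by
  have hQ := h'.le₁.trans h.le₁
  have hQY : Q ∪ Y ≤ G := union_le hQ h.le₂
  have hU : Q ∪ Y ∪ Z ≤ G := union_le hQY h.le₃
  have cQY : Q.Compatible Y := .of_le_le hQ h.le₂
  have cQYZ : (Q ∪ Y).Compatible Z := .of_le_le hQY h.le₃
  have hwQ := h'.mem₁
  have hc₁ : c ∉ V(X₁) := fun hx => hcw (h'.eq₁₂ hc hx)
  have hc₂ : c ∉ V(X₂) := fun hx => hcw (h'.eq₁₃ hc hx)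
  have inter : ∀ {D : Graph α β}, D ≤ X → c ∉ V(D) → V(Q) ∩ V(D) = {w} →
      V(D) ∩ V(Q ∪ Y ∪ Z) = {w} := by
    intro D hD hcD hQD
    refine Set.Subset.antisymm ?_ ?_
    · rintro x ⟨hx, (hx' | hx') | hx'⟩
      · exact hQD.le ⟨hx', hx⟩
      · exact absurd (h.eq₁₂ (hD.vertexSet_mono hx) hx' ▸ hx) hcD
      · exact absurd (h.eq₁₃ (hD.vertexSet_mono hx) hx' ▸ hx) hcD
    · rintro x rfl
      exact ⟨(hQD.ge rfl).2, Or.inl (Or.inl hwQ)⟩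
  have disj : ∀ {D : Graph α β}, D ≤ X → Disjoint E(Q) E(D) → Disjoint E(D) E(Q ∪ Y ∪ Z) := by
    intro D hD hQD
    simp only [edgeSet_union, Set.disjoint_union_right]
    exact ⟨⟨hQD.symm, h.disj₁₂.mono_left hD.edgeSet_mono⟩, h.disj₁₃.mono_left hD.edgeSet_mono⟩
  constructor
  · refine ⟨h'.le₂.trans h.le₁, h'.le₃.trans h.le₁, hU, h'.conn₂, h'.conn₃, ?_, ?_, ?_, h'.inter₂₃,
      inter h'.le₂ hc₁ h'.inter₁₂, inter h'.le₃ hc₂ h'.inter₁₃, h'.disj₂₃, disj h'.le₂ h'.disj₁₂,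
      disj h'.le₃ h'.disj₁₃⟩
    · exact (h'.conn₁.union h.conn₂ cQY hc h.mem₂).union h.conn₃ cQYZ (Or.inl hc) h.mem₃
    · rw [h.vertexSet_eq, h'.vertexSet_eq]
      ext; simp only [vertexSet_union, Set.mem_union]; tauto
    · rw [h.edgeSet_eq, h'.edgeSet_eq]
      ext; simp only [edgeSet_union, Set.mem_union]; tauto
  · refine ⟨le_union_left.trans le_union_left, cQY.le_union_right.trans le_union_left,
      cQYZ.le_union_right, h'.conn₁, h.conn₂, h.conn₃, rfl, rfl, ?_, ?_, h.inter₂₃,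
      h.disj₁₂.mono_left h'.le₁.edgeSet_mono, h.disj₁₃.mono_left h'.le₁.edgeSet_mono, h.disj₂₃⟩
    · refine Set.Subset.antisymm
        (fun x hx => h.inter₁₂.le ⟨h'.le₁.vertexSet_mono hx.1, hx.2⟩) ?_
      rintro x rfl
      exact ⟨hc, h.mem₂⟩
    · refine Set.Subset.antisymm
        (fun x hx => h.inter₁₃.le ⟨h'.le₁.vertexSet_mono hx.1, hx.2⟩) ?_
      rintro x rfl
      exact ⟨hc, h.mem₃⟩

end Tripod

lemma notMem_leaves (he : T.Inc e v) (hf : T.Inc f v) (hef : e ≠ f) : v ∉ T.leaves := by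
  rintro ⟨-, g, -, hg⟩
  exact hef ((hg e he).trans (hg f hf).symm)

lemma notMem_leaves_of_disjoint (hX : X ≤ T) (hY : Y ≤ T) (h : Disjoint E(X) E(Y))
    (he : X.Inc e v) (hf : Y.Inc f v) : v ∉ T.leaves :=
  notMem_leaves (he.mono hX) (hf.mono hY) fun hef =>
    Set.disjoint_left.1 h he.edge_mem (hef ▸ hf.edge_mem)

lemma IsPath.inter_leaves (hP : P.IsPath x y) (hPT : P ≤ T) : T.leaves ∩ V(P) ⊆ {x, y} := by
  rintro z ⟨hz, hzP⟩
  by_contra hcon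
  simp only [Set.mem_insert_iff, Set.mem_singleton_iff, not_or] at hcon
  obtain ⟨e, f, hef, he, hf⟩ := hP.exists_two_inc hzP hcon.1 hcon.2
  exact notMem_leaves (he.mono hPT) (hf.mono hPT) hef hz

lemma IsPath.existsUnique_inc (h : P.IsPath x y) (hxy : x ≠ y) : ∃! e, P.Inc e x := by
  obtain ⟨n, v, e, hn, hs, hV, hE, rfl, rfl⟩ := h.exists_isPathSeq hxy
  refine ⟨e 0, (hs.2 0 hn).inc_left, fun f hf => ?_⟩
  obtain ⟨i, hi, rfl⟩ : f ∈ e '' Set.Iio n := hE ▸ hf.edge_mem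
  simp only [Set.mem_Iio] at hi
  rcases hf.eq_or_eq_of_isLink (hs.2 i hi) with h | h
  · rw [← hs.1 (by simp) (by simp; omega) h]
  · have := hs.1 (by simp) (by simp; omega) h
    omega

/-- The tree `T` is glued from the branch `X` and the connected rest `R`, which also contains a
leaf. -/
structure Rooted (T R X : Graph α β) (v : α) : Prop where
  isBranch : IsBranch T X v
  glue : Glue T R X v
  isConnected : R.IsConnected
  nonempty : (T.leaves ∩ V(R)).Nonempty

/-- For the recursion into `X₁`: seen from `w`, the rest of the tree is the old rest, the stem `Q`
and the sibling `X₂`. -/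
lemma Rooted.child (h : Rooted T R X v) (h' : Tripod X w Q X₁ X₂) (hvw : v ≠ w) (hv : v ∈ V(Q))
    (h₁ : IsBranch T X₁ w) : Rooted T (R ∪ Q ∪ X₂) X₁ w := by
  have hXT := h.glue.right_le
  have hQT := h'.le₁.trans hXT
  have hRQ : R ∪ Q ≤ T := union_le h.glue.left_le hQT
  have h₂T := h'.le₃.trans hXT
  have hv₁ : v ∉ V(X₁) := fun hx => hvw (h'.eq₁₂ hv hx)
  refine ⟨h₁, ⟨union_le hRQ h₂T, h₁.le, ?_, ?_, ?_, ?_⟩, ?_, ?_⟩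
  · rw [h.glue.vertexSet_eq, h'.vertexSet_eq]
    ext; simp only [vertexSet_union, Set.mem_union]; tauto
  · rw [h.glue.edgeSet_eq, h'.edgeSet_eq]
    ext; simp only [edgeSet_union, Set.mem_union]; tauto
  · refine Set.Subset.antisymm ?_ ?_
    · rintro x ⟨(hx | hx) | hx, hx₁⟩
      · exact absurd (h.glue.inter_eq.le ⟨hx, h'.le₂.vertexSet_mono hx₁⟩ ▸ hx₁) hv₁
      · exact h'.eq₁₂ hx hx₁
      · exact h'.eq₂₃ hx₁ hx
    · rintro x rfl
      exact ⟨Or.inl (Or.inr h'.mem₁), h'.mem₂⟩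
  · simp only [edgeSet_union, Set.disjoint_union_left]
    exact ⟨⟨h.glue.disjoint.mono_right h'.le₂.edgeSet_mono, h'.disj₁₂⟩, h'.disj₂₃.symm⟩
  · exact (h.isConnected.union h'.conn₁ (.of_le_le h.glue.left_le hQT) h.glue.left_mem hv).union
      h'.conn₃ (.of_le_le hRQ h₂T) (Or.inr h'.mem₁) h'.mem₃
  · obtain ⟨x, hx, hxR⟩ := h.nonempty
    exact ⟨x, hx, Or.inl (Or.inl hxR)⟩

section Shortcut

lemma covers_of_le (hS : S ≤ T) (hc : S.IsConnected) : Covers ℓ T (T.leaves ∩ V(S)) (S.length ℓ) :=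
  ⟨S, hS, hc, Set.inter_subset_right, le_rfl⟩

lemma covers_union (hE : E(T).Finite) (hX : X ≤ T) (hY : Y ≤ T) (hXc : X.IsConnected)
    (hYc : Y.IsConnected) (hx : v ∈ V(X)) (hy : v ∈ V(Y)) (h : Disjoint E(X) E(Y)) :
    Covers ℓ T (T.leaves ∩ V(X) ∪ T.leaves ∩ V(Y)) (X.length ℓ + Y.length ℓ) := by
  rw [← Set.inter_union_distrib_left, ← length_eq_add (G := X ∪ Y) (hE.subset hX.edgeSet_mono)
    (hE.subset hY.edgeSet_mono) h rfl]
  exact covers_of_le (union_le hX hY) (hXc.union hYc (.of_le_le hX hY) hx hy)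

/-- This accounts for the summand `q` in `IsQuad`: connecting subtrees at opposite ends of the path
also costs the path. -/
lemma covers_bridge (hE : E(T).Finite) (hX : X ≤ T) (hQ : Q ≤ T) (hY : Y ≤ T)
    (hXc : X.IsConnected) (hQc : Q.IsConnected) (hYc : Y.IsConnected) (hvX : v ∈ V(X))
    (hvQ : v ∈ V(Q)) (hwQ : w ∈ V(Q)) (hwY : w ∈ V(Y)) (hXQ : Disjoint E(X) E(Q))
    (hXY : Disjoint E(X) E(Y)) (hQY : Disjoint E(Q) E(Y)) :
    Covers ℓ T (T.leaves ∩ V(X) ∪ T.leaves ∩ V(Y)) (X.length ℓ + Q.length ℓ + Y.length ℓ) := by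
  have fin : ∀ {D : Graph α β}, D ≤ T → E(D).Finite := fun h => hE.subset h.edgeSet_mono
  have hXQT : X ∪ Q ≤ T := union_le hX hQ
  rw [← length_eq_add (G := X ∪ Q) (fin hX) (fin hQ) hXQ rfl,
    ← length_eq_add (G := X ∪ Q ∪ Y) (fin hXQT) (fin hY) (Set.disjoint_union_left.2 ⟨hXY, hQY⟩) rfl]
  refine ⟨X ∪ Q ∪ Y, union_le hXQT hY, (hXc.union hQc (.of_le_le hX hQ) hvX hvQ).union hYc
    (.of_le_le hXQT hY) (Or.inr hwQ) hwY, ?_, le_rfl⟩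
  rintro x (hx | hx)
  · exact Or.inl (Or.inl hx.2)
  · exact Or.inr hx.2

variable {θ : α → ℝ} {K : ℝ}

lemma disjoint_leaves (hc : c ∉ T.leaves) (h : V(X) ∩ V(Y) ⊆ {c}) :
    Disjoint (T.leaves ∩ V(X)) (T.leaves ∩ V(Y)) := by
  rw [Set.disjoint_left]
  rintro x ⟨hx, hxX⟩ ⟨-, hxY⟩
  exact hc (h ⟨hxX, hxY⟩ ▸ hx)

lemma IsBush.nonempty_leaves (hT : T.IsTree) (hE : E(T).Finite) (h : IsBush T Y w)
    (he : Y.Inc e w) : (T.leaves ∩ V(Y)).Nonempty := by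
  obtain ⟨Y₁, Y₂, hg, h₁, -⟩ := h.exists_glue hT he
  obtain ⟨x, hx, hxl, -⟩ := h₁.exists_leaf hT hE
  exact ⟨x, hxl, hg.left_le.vertexSet_mono hx⟩

/-- No vertex of a shortcut tree has degree greater than three. -/
lemma exists_glue_branches (hT : T.IsTree) (hE : E(T).Finite)
    (hcirc : ShortcutCircle θ K (T.length ℓ) T.leaves (Covers ℓ T))
    (hg : Glue T R Y w) (hR : R.IsConnected) (hRl : (T.leaves ∩ V(R)).Nonempty)
    (hY : IsBush T Y w) (hef : e ≠ f) (he : Y.Inc e w) (hf : Y.Inc f w) :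
    ∃ Y₁ Y₂, Glue Y Y₁ Y₂ w ∧ IsBranch T Y₁ w ∧ IsBranch T Y₂ w := by
  have hw : w ∉ T.leaves := notMem_leaves (he.mono hY.le) (hf.mono hY.le) hef
  obtain ⟨Y₁, Y₂, hg₁, h₁, h₂, hinc⟩ := hY.exists_glue hT hf
  have he₂ := (hinc e he).resolve_left hef
  by_cases hu : ∃! g, Y₂.Inc g w
  · exact ⟨Y₁, Y₂, hg₁, h₁, h₂, hu⟩
  -- If `Y₂` had two edges at `w`, a further branch `Y₃` could be split off it. Then `R`, `Y₁`, `Y₃`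
  -- and the remainder `Y₄` would be four edge-disjoint subtrees at `w`, each with a leaf.
  exfalso
  obtain ⟨g, hg', hge⟩ : ∃ g, Y₂.Inc g w ∧ g ≠ e := by
    by_contra! hcon
    exact hu ⟨e, he₂, hcon⟩
  obtain ⟨Y₃, Y₄, hg₂, h₃, h₄, hinc'⟩ := h₂.exists_glue hT he₂
  have hg₄ := (hinc' g hg').resolve_left hge
  have l₂ : Y₂ ≤ Y := hg₁.right_le
  have l₃ : Y₃ ≤ Y := hg₂.left_le.trans l₂
  have l₄ : Y₄ ≤ Y := hg₂.right_le.trans l₂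
  have hfirst : ∃ g, Y₁.Inc g w := h₁.existsUnique.exists
  have hthird : ∃ g, Y₃.Inc g w := h₃.existsUnique.exists
  obtain ⟨g₁, hg₁'⟩ := hfirst
  obtain ⟨g₃, hg₃'⟩ := hthird
  have fin : ∀ {D : Graph α β}, D ≤ T → E(D).Finite := fun h => hE.subset h.edgeSet_mono
  have hlen : R.length ℓ + Y₁.length ℓ + Y₃.length ℓ + Y₄.length ℓ = T.length ℓ := by
    rw [length_eq_add (G := T) (fin hg.left_le) (fin hg.right_le) hg.disjoint hg.edgeSet_eq,
      length_eq_add (G := Y) (fin h₁.le) (fin h₂.le) hg₁.disjoint hg₁.edgeSet_eq,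
      length_eq_add (G := Y₂) (fin h₃.le) (fin h₄.le) hg₂.disjoint hg₂.edgeSet_eq]
    ring
  let D : Fin 4 → Graph α β := ![R, Y₁, Y₃, Y₄]
  have hD : ∀ i, D i ≤ T ∧ (D i).IsConnected ∧ w ∈ V(D i) ∧ (T.leaves ∩ V(D i)).Nonempty := by
    intro i
    fin_cases i
    · exact ⟨hg.left_le, hR, hg.left_mem, hRl⟩
    · exact ⟨h₁.le, h₁.isConnected, h₁.mem, h₁.nonempty_leaves hT hE hg₁'⟩
    · exact ⟨h₃.le, h₃.isConnected, h₃.mem, h₃.nonempty_leaves hT hE hg₃'⟩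
    · exact ⟨h₄.le, h₄.isConnected, h₄.mem, h₄.nonempty_leaves hT hE hg₄⟩
  have hpair : ∀ i j, i < j → V(D i) ∩ V(D j) ⊆ {w} ∧ Disjoint E(D i) E(D j) := by
    have hRY : ∀ {A : Graph α β}, A ≤ Y → V(R) ∩ V(A) ⊆ {w} ∧ Disjoint E(R) E(A) := fun hA =>
      ⟨fun x hx => hg.inter_eq.le ⟨hx.1, hA.vertexSet_mono hx.2⟩,
        hg.disjoint.mono_right hA.edgeSet_mono⟩
    have hYY : ∀ {A : Graph α β}, A ≤ Y₂ → V(Y₁) ∩ V(A) ⊆ {w} ∧ Disjoint E(Y₁) E(A) := fun hA =>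
      ⟨fun x hx => hg₁.inter_eq.le ⟨hx.1, hA.vertexSet_mono hx.2⟩,
        hg₁.disjoint.mono_right hA.edgeSet_mono⟩
    intro i j hij
    fin_cases i <;> fin_cases j <;> first | exact absurd hij (by decide) | skip
    · exact hRY hg₁.left_le
    · exact hRY l₃
    · exact hRY l₄
    · exact hYY hg₂.left_le
    · exact hYY hg₂.right_le
    · exact ⟨hg₂.inter_eq.le, hg₂.disjoint⟩
  have hpair' : ∀ i j, i ≠ j → V(D i) ∩ V(D j) ⊆ {w} ∧ Disjoint E(D i) E(D j) := by
    intro i j hij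
    rcases lt_or_gt_of_ne hij with h | h
    · exact hpair i j h
    · rw [Set.inter_comm]
      exact ⟨(hpair j i h).1, (hpair j i h).2.symm⟩
  refine hcirc.not_four (I := fun i => T.leaves ∩ V(D i)) (u := fun i => (D i).length ℓ) ?_
    (fun i j hij => disjoint_leaves hw (hpair' i j hij).1) (fun i => (hD i).2.2.2)
    (fun i j hij => covers_union hE (hD i).1 (hD j).1 (hD i).2.1 (hD j).2.1 (hD i).2.2.1
      (hD j).2.2.1 (hpair' i j hij).2) ?_
  · rw [← Set.inter_iUnion]
    refine (Set.inter_eq_left.2 fun x hx => ?_).symm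
    have hx' := hx.1
    rw [hg.vertexSet_eq, hg₁.vertexSet_eq, hg₂.vertexSet_eq] at hx'
    rw [Set.mem_iUnion]
    rcases hx' with hx' | hx' | hx' | hx'
    exacts [⟨0, hx'⟩, ⟨1, hx'⟩, ⟨2, hx'⟩, ⟨3, hx'⟩]
  · rw [Fin.sum_univ_four]
    exact hlen.le

/-- A branch of a shortcut tree is a path to a leaf, or a path to a vertex at which exactly two
further branches are attached. -/
lemma Rooted.cases (hT : T.IsTree) (hE : E(T).Finite)
    (hcirc : ShortcutCircle θ K (T.length ℓ) T.leaves (Covers ℓ T)) (h : Rooted T R X v) :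
    (∃ x, v ≠ x ∧ X.IsPath v x ∧ x ∈ T.leaves) ∨
    ∃ Q w X₁ X₂, v ≠ w ∧ Q.IsPath v w ∧ Tripod X w Q X₁ X₂ ∧ IsBranch T X₁ w ∧
      IsBranch T X₂ w := by
  rcases h.isBranch.isPath_or_exists_glue hT hE with
    h' | ⟨Q, w, Y, hvw, hQ, hg, hY, e, f, hef, he, hf⟩
  · exact Or.inl h'
  right
  have hQT := hg.left_le.trans h.glue.right_le
  have hvY : v ∉ V(Y) := fun hv => hvw (hg.inter_eq.le ⟨hQ.left_mem, hv⟩)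
  have hQc := hQ.isConnected hvw
  -- The degree bound is applied at `w`, where the rest of the tree includes the path `Q`.
  have hglue : Glue T (R ∪ Q) Y w := by
    refine ⟨union_le h.glue.left_le hQT, hY.le, ?_, ?_, ?_, ?_⟩
    · rw [h.glue.vertexSet_eq, hg.vertexSet_eq, ← Set.union_assoc]; rfl
    · rw [h.glue.edgeSet_eq, hg.edgeSet_eq, ← Set.union_assoc]; rfl
    · refine Set.Subset.antisymm ?_ ?_
      · rintro x ⟨hx | hx, hxY⟩
        · exact absurd (h.glue.inter_eq.le ⟨hx, hg.right_le.vertexSet_mono hxY⟩ ▸ hxY) hvY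
        · exact hg.inter_eq.le ⟨hx, hxY⟩
      · rintro x rfl
        exact ⟨Or.inr hg.left_mem, hg.right_mem⟩
    · exact Set.disjoint_union_left.2 ⟨h.glue.disjoint.mono_right hg.right_le.edgeSet_mono,
        hg.disjoint⟩
  obtain ⟨x, hx, hxR⟩ := h.nonempty
  obtain ⟨Y₁, Y₂, hg', h₁, h₂⟩ := exists_glue_branches hT hE hcirc hglue
    (h.isConnected.union hQc (.of_le_le h.glue.left_le hQT) h.glue.left_mem hQ.left_mem)
    ⟨x, hx, Or.inl hxR⟩ hY hef he hf
  exact ⟨Q, w, Y₁, Y₂, hvw, hQ, Tripod.of_glue hg hg' hQc h₁.isConnected h₂.isConnected, h₁, h₂⟩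

end Shortcut

end Graph

/-! ### The shape of a shortcut tree -/

namespace Graph

variable {α β : Type*} {G H X Y Z S T C P Q R X₁ X₂ : Graph α β} {ℓ : β → ℝ}
  {c r u v w x y z : α} {e f : β} {θ : α → ℝ} {K : ℝ}

/-- The tree `T` consists of three branches glued at `c`. -/
structure Centre (T : Graph α β) (c : α) (X Y Z : Graph α β) : Prop extends Tripod T c X Y Z where
  branch₁ : IsBranch T X c
  branch₂ : IsBranch T Y c
  branch₃ : IsBranch T Z c

lemma Centre.swap (h : Centre T c X Y Z) : Centre T c Y X Z :=
  ⟨h.toTripod.swap, h.branch₂, h.branch₁, h.branch₃⟩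

lemma Centre.rotate (h : Centre T c X Y Z) : Centre T c Y Z X :=
  ⟨h.toTripod.rotate, h.branch₂, h.branch₃, h.branch₁⟩

lemma IsBranch.notMem_leaves (h₁ : IsBranch T X c) (h₂ : IsBranch T Y c)
    (h : Disjoint E(X) E(Y)) : c ∉ T.leaves := by
  obtain ⟨e, he⟩ := h₁.existsUnique.exists
  obtain ⟨f, hf⟩ := h₂.existsUnique.exists
  exact notMem_leaves_of_disjoint h₁.le h₂.le h he hf

lemma Centre.notMem_leaves (h : Centre T c X Y Z) : c ∉ T.leaves :=
  h.branch₁.notMem_leaves h.branch₂ h.disj₁₂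

lemma IsBranch.nonempty_leaves (hT : T.IsTree) (hE : E(T).Finite) (h : IsBranch T X c) :
    (T.leaves ∩ V(X)).Nonempty := by
  obtain ⟨x, hx, hxl, -⟩ := h.exists_leaf hT hE
  exact ⟨x, hxl, hx⟩

lemma Centre.rooted (hT : T.IsTree) (hE : E(T).Finite) (h : Centre T c X Y Z) :
    Rooted T (Y ∪ Z) X c := by
  refine ⟨h.branch₁, h.toTripod.glue, h.toTripod.rotate.conn_union, ?_⟩
  obtain ⟨x, hx, hxY⟩ := h.branch₂.nonempty_leaves hT hE
  exact ⟨x, hx, Or.inl hxY⟩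

lemma Tripod.inter_leaves (h : Tripod X w Q X₁ X₂) (hX : X ≤ T) (hQ : Q.IsPath v w)
    (hv : v ∉ T.leaves) (hw : w ∉ T.leaves) :
    T.leaves ∩ V(X) = T.leaves ∩ V(X₁) ∪ T.leaves ∩ V(X₂) := by
  rw [h.vertexSet_eq, Set.inter_union_distrib_left, Set.inter_union_distrib_left]
  have : T.leaves ∩ V(Q) = ∅ := by
    refine Set.eq_empty_of_forall_notMem fun z hz => ?_
    rcases hQ.inter_leaves (h.le₁.trans hX) hz with rfl | rfl
    · exact hv hz.1
    · exact hw hz.1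
  rw [this, Set.empty_union]

/-- The path is the stem `Q` of `X`: it has `Y` and `Z` at its end `c`, and `X₁` and `X₂` at its end
`w`. Since `Q` has no leaf, the leaves of these four subtrees are all leaves of `T`. -/
lemma Centre.ncard_le_two_or (hT : IsShortcutTree ℓ T C) (hE : E(T).Finite)
    (hcirc : ShortcutCircle θ K (T.length ℓ) T.leaves (Covers ℓ T)) (h : Centre T c X Y Z)
    (h' : Tripod X w Q X₁ X₂) (hQ : Q.IsPath c w) (h₁ : IsBranch T X₁ w)
    (h₂ : IsBranch T X₂ w) :
    (T.leaves ∩ V(Y) ∪ T.leaves ∩ V(Z)).ncard ≤ 2 ∨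
      (T.leaves ∩ V(X₁) ∪ T.leaves ∩ V(X₂)).ncard ≤ 2 := by
  have hc := h.notMem_leaves
  have hw := h₁.notMem_leaves h₂ h'.disj₂₃
  have hcQ := hQ.left_mem
  have hwQ := hQ.right_mem
  have hQT := h'.le₁.trans h.le₁
  have hpos : ∀ e ∈ E(T), 0 < ℓ e := fun e he => hT.length_pos e (Or.inl he)
  have fin : ∀ {D : Graph α β}, D ≤ T → E(D).Finite := fun h => hE.subset h.edgeSet_mono
  have i₁₂ : ∀ {D : Graph α β}, D ≤ X → V(Y) ∩ V(D) ⊆ {c} := fun hD x hx =>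
    h.eq₁₂ (hD.vertexSet_mono hx.2) hx.1
  have i₁₃ : ∀ {D : Graph α β}, D ≤ X → V(Z) ∩ V(D) ⊆ {c} := fun hD x hx =>
    h.eq₁₃ (hD.vertexSet_mono hx.2) hx.1
  have eY : ∀ {D : Graph α β}, D ≤ X → Disjoint E(Y) E(D) := fun hD =>
    h.disj₁₂.symm.mono_right hD.edgeSet_mono
  have eZ : ∀ {D : Graph α β}, D ≤ X → Disjoint E(Z) E(D) := fun hD =>
    h.disj₁₃.symm.mono_right hD.edgeSet_mono
  have hYZ : Y ∪ Z ≤ T := union_le h.le₂ h.le₃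
  have hYZc := h.toTripod.rotate.conn_union
  have hX₁₂ : X₁ ∪ X₂ ≤ T := union_le h₁.le h₂.le
  have hX₁₂c := h'.rotate.conn_union
  have lYZ : (Y ∪ Z).length ℓ = Y.length ℓ + Z.length ℓ :=
    length_eq_add (fin h.le₂) (fin h.le₃) h.disj₂₃ rfl
  have lX : (X₁ ∪ X₂).length ℓ = X₁.length ℓ + X₂.length ℓ :=
    length_eq_add (fin h₁.le) (fin h₂.le) h'.disj₂₃ rfl
  have tYZ : T.leaves ∩ V(Y ∪ Z) = T.leaves ∩ V(Y) ∪ T.leaves ∩ V(Z) :=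
    Set.inter_union_distrib_left _ _ _
  have tX : T.leaves ∩ V(X₁ ∪ X₂) = T.leaves ∩ V(X₁) ∪ T.leaves ∩ V(X₂) :=
    Set.inter_union_distrib_left _ _ _
  have eYX : Disjoint E(Y) E(X₁ ∪ X₂) := Set.disjoint_union_right.2 ⟨eY h'.le₂, eY h'.le₃⟩
  have eZX : Disjoint E(Z) E(X₁ ∪ X₂) := Set.disjoint_union_right.2 ⟨eZ h'.le₂, eZ h'.le₃⟩
  have eQX : Disjoint E(Q) E(X₁ ∪ X₂) := Set.disjoint_union_right.2 ⟨h'.disj₁₂, h'.disj₁₃⟩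
  have eXYZ : ∀ {D : Graph α β}, D ≤ X → Disjoint E(D) E(Y ∪ Z) := fun hD =>
    Set.disjoint_union_right.2 ⟨(eY hD).symm, (eZ hD).symm⟩
  have quad : IsQuad (T.length ℓ) T.leaves (Covers ℓ T) (T.leaves ∩ V(Y)) (T.leaves ∩ V(Z))
      (T.leaves ∩ V(X₁)) (T.leaves ∩ V(X₂)) (Y.length ℓ) (Z.length ℓ) (X₁.length ℓ) (X₂.length ℓ)
      (Q.length ℓ) := by
    refine ⟨?_, disjoint_leaves hc h.inter₂₃.le, disjoint_leaves hw h'.inter₂₃.le, ?_,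
      h.branch₂.nonempty_leaves hT.isTree hE, h.branch₃.nonempty_leaves hT.isTree hE,
      h₁.nonempty_leaves hT.isTree hE, h₂.nonempty_leaves hT.isTree hE,
      covers_union hE h.le₂ h.le₃ h.conn₂ h.conn₃ h.mem₂ h.mem₃ h.disj₂₃,
      covers_union hE h₁.le h₂.le h'.conn₂ h'.conn₃ h'.mem₂ h'.mem₃ h'.disj₂₃,
      covers_bridge hE h.le₂ hQT h₁.le h.conn₂ h'.conn₁ h'.conn₂ h.mem₂ hcQ hwQ h'.mem₂
        (eY h'.le₁) (eY h'.le₂) h'.disj₁₂,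
      covers_bridge hE h.le₂ hQT h₂.le h.conn₂ h'.conn₁ h'.conn₃ h.mem₂ hcQ hwQ h'.mem₃
        (eY h'.le₁) (eY h'.le₃) h'.disj₁₃,
      covers_bridge hE h.le₃ hQT h₁.le h.conn₃ h'.conn₁ h'.conn₂ h.mem₃ hcQ hwQ h'.mem₂
        (eZ h'.le₁) (eZ h'.le₂) h'.disj₁₂,
      covers_bridge hE h.le₃ hQT h₂.le h.conn₃ h'.conn₁ h'.conn₃ h.mem₃ hcQ hwQ h'.mem₃
        (eZ h'.le₁) (eZ h'.le₃) h'.disj₁₃,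
      covers_of_le h.le₂ h.conn₂, covers_of_le h.le₃ h.conn₃, covers_of_le h₁.le h'.conn₂,
      covers_of_le h₂.le h'.conn₃, ?_, ?_, ?_, ?_, ?_, ?_⟩
    · rw [Set.union_assoc, ← h'.inter_leaves h.le₁ hQ hc hw, ← Set.inter_union_distrib_left,
        ← Set.inter_union_distrib_left, Set.union_comm V(Z), ← Set.union_assoc,
        Set.union_comm V(Y), ← h.vertexSet_eq]
      exact (Set.inter_eq_left.2 fun x hx => hx.1).symm
    · simp only [Set.disjoint_union_left, Set.disjoint_union_right]
      exact ⟨⟨disjoint_leaves hc (i₁₂ h'.le₂), disjoint_leaves hc (i₁₃ h'.le₂)⟩,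
        disjoint_leaves hc (i₁₂ h'.le₃), disjoint_leaves hc (i₁₃ h'.le₃)⟩
    · rw [← tX, ← lX]
      exact covers_bridge hE h.le₃ hQT hX₁₂ h.conn₃ h'.conn₁ hX₁₂c h.mem₃ hcQ hwQ (Or.inl h'.mem₂)
        (eZ h'.le₁) eZX eQX
    · rw [← tX, ← lX]
      exact covers_bridge hE h.le₂ hQT hX₁₂ h.conn₂ h'.conn₁ hX₁₂c h.mem₂ hcQ hwQ (Or.inl h'.mem₂)
        (eY h'.le₁) eYX eQX
    · rw [← tYZ, ← lYZ]
      exact covers_bridge hE h₂.le hQT hYZ h'.conn₃ h'.conn₁ hYZc h'.mem₃ hwQ hcQ (Or.inl h.mem₂)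
        h'.disj₁₃.symm (eXYZ h'.le₃) (eXYZ h'.le₁)
    · rw [← tYZ, ← lYZ]
      exact covers_bridge hE h₁.le hQT hYZ h'.conn₂ h'.conn₁ hYZc h'.mem₂ hwQ hcQ (Or.inl h.mem₂)
        h'.disj₁₂.symm (eXYZ h'.le₂) (eXYZ h'.le₁)
    · unfold length
      rw [finsum_mem_eq_finite_toFinset_sum _ (fin hQT)]
      exact Finset.sum_nonneg fun e he => (hpos e (hQT.edgeSet_mono (by simpa using he))).le
    · rw [h.toTripod.length_eq hE, h'.length_eq (fin h.le₁)]
      linarith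
  -- Any set of leaves is covered by the whole tree.
  exact quad.ncard_le_two_or hcirc fun B hB =>
    ⟨T, le_rfl, hT.isTree.2.1, fun x hx => (hB.1 hx).1, le_rfl⟩

/-- A branch consisting of a path to the leaf `x`. -/
def IsTwig (T X : Graph α β) (v x : α) : Prop := v ≠ x ∧ X.IsPath v x ∧ x ∈ T.leaves

/-- A branch that splits once, into paths to the leaves `x` and `y`. -/
def IsCherry (T X : Graph α β) (v x y : α) : Prop :=
  ∃ Q w X₁ X₂, v ≠ w ∧ Q.IsPath v w ∧ Tripod X w Q X₁ X₂ ∧ IsTwig T X₁ w x ∧ IsTwig T X₂ w y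

/-- A branch with at most two leaves. -/
def IsSmall (T X : Graph α β) (v : α) : Prop :=
  (∃ x, IsTwig T X v x) ∨ ∃ x y, IsCherry T X v x y

lemma IsCherry.symm (h : IsCherry T X v x y) : IsCherry T X v y x := by
  obtain ⟨Q, w, X₁, X₂, hvw, hQ, ht, h₁, h₂⟩ := h
  exact ⟨Q, w, X₂, X₁, hvw, hQ, ht.swap_right, h₂, h₁⟩

lemma IsTwig.inter_leaves (h : IsTwig T X v x) (hX : X ≤ T) (hv : v ∉ T.leaves) :
    T.leaves ∩ V(X) = {x} := by
  refine Set.Subset.antisymm (fun z hz => ?_) ?_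
  · rcases h.2.1.inter_leaves hX hz with rfl | rfl
    · exact absurd hz.1 hv
    · rfl
  · rintro z rfl
    exact ⟨h.2.2, h.2.1.right_mem⟩

lemma ncard_add (hfin : T.leaves.Finite) (h : Disjoint (T.leaves ∩ V(X)) (T.leaves ∩ V(Y))) :
    (T.leaves ∩ V(X) ∪ T.leaves ∩ V(Y)).ncard =
      (T.leaves ∩ V(X)).ncard + (T.leaves ∩ V(Y)).ncard :=
  Set.ncard_union_eq h (hfin.subset Set.inter_subset_left) (hfin.subset Set.inter_subset_left)

lemma IsBranch.ncard_pos (hT : T.IsTree) (hE : E(T).Finite) (hfin : T.leaves.Finite)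
    (h : IsBranch T X c) :
    0 < (T.leaves ∩ V(X)).ncard :=
  (Set.ncard_pos (hfin.subset Set.inter_subset_left)).2 (h.nonempty_leaves hT hE)

/-- If the branch split, both of its parts would contribute a leaf. -/
lemma Rooted.isTwig (hT : T.IsTree) (hE : E(T).Finite)
    (hcirc : ShortcutCircle θ K (T.length ℓ) T.leaves (Covers ℓ T)) (h : Rooted T R X v)
    (hn : (T.leaves ∩ V(X)).ncard ≤ 1) :
    ∃ x, IsTwig T X v x := by
  have hfin := hcirc.finite
  rcases h.cases hT hE hcirc with h' | ⟨Q, w, X₁, X₂, hvw, hQ, ht, h₁, h₂⟩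
  · exact h'
  exfalso
  have hw := h₁.notMem_leaves h₂ ht.disj₂₃
  have h3 := ncard_add hfin (disjoint_leaves hw ht.inter₂₃.le)
  have h4 := h₁.ncard_pos hT hE hfin
  have h5 := h₂.ncard_pos hT hE hfin
  have h6 : (T.leaves ∩ V(X₁) ∪ T.leaves ∩ V(X₂)).ncard ≤ (T.leaves ∩ V(X)).ncard := by
    refine Set.ncard_le_ncard (Set.union_subset ?_ ?_) (hfin.subset Set.inter_subset_left)
    · exact Set.inter_subset_inter_right _ ht.le₂.vertexSet_mono
    · exact Set.inter_subset_inter_right _ ht.le₃.vertexSet_mono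
  omega

lemma Rooted.isSmall (hT : T.IsTree) (hE : E(T).Finite)
    (hcirc : ShortcutCircle θ K (T.length ℓ) T.leaves (Covers ℓ T)) (h : Rooted T R X v)
    (hn : (T.leaves ∩ V(X)).ncard ≤ 2) : IsSmall T X v := by
  have hfin := hcirc.finite
  rcases h.cases hT hE hcirc with h' | ⟨Q, w, X₁, X₂, hvw, hQ, ht, h₁, h₂⟩
  · exact Or.inl h'
  right
  have hw := h₁.notMem_leaves h₂ ht.disj₂₃
  have h3 := ncard_add hfin (disjoint_leaves hw ht.inter₂₃.le)
  have h4 := h₁.ncard_pos hT hE hfin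
  have h5 := h₂.ncard_pos hT hE hfin
  have h6 : (T.leaves ∩ V(X₁) ∪ T.leaves ∩ V(X₂)).ncard ≤ (T.leaves ∩ V(X)).ncard := by
    refine Set.ncard_le_ncard (Set.union_subset ?_ ?_) (hfin.subset Set.inter_subset_left)
    · exact Set.inter_subset_inter_right _ ht.le₂.vertexSet_mono
    · exact Set.inter_subset_inter_right _ ht.le₃.vertexSet_mono
  obtain ⟨x, hx⟩ := (h.child ht hvw hQ.left_mem h₁).isTwig hT hE hcirc (by omega)
  obtain ⟨y, hy⟩ := (h.child ht.swap_right hvw hQ.left_mem h₂).isTwig hT hE hcirc (by omega)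
  exact ⟨x, y, Q, w, X₁, X₂, hvw, hQ, ht, hx, hy⟩

lemma IsTwig.isBranch (h : IsTwig T X c x) (ht : Tripod T c X Y Z) : IsBranch T X c := by
  refine ⟨⟨ht.le₁, ht.conn₁, ht.mem₁, ?_⟩, h.2.1.existsUnique_inc h.1⟩
  intro y hy hyc e he
  have : e ∈ E(X) ∪ E(Y) ∪ E(Z) := ht.edgeSet_eq ▸ he.edge_mem
  rcases this with (he' | he') | he'
  · exact he'
  · exact absurd (ht.eq₁₂ hy ((ht.le₂.inc_congr he').2 he).vertex_mem) hyc
  · exact absurd (ht.eq₁₃ hy ((ht.le₃.inc_congr he').2 he).vertex_mem) hyc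

/-- The stem together with the other two branches at `c` becomes the third branch at `w`. Its only
edge at `w` is the last edge of `Q`, because `Y` and `Z` meet `X` only in `c`. -/
lemma Centre.move (h : Centre T c X Y Z) (h' : Tripod X w Q X₁ X₂) (hcw : c ≠ w)
    (hQ : Q.IsPath c w) (h₁ : IsBranch T X₁ w) (h₂ : IsBranch T X₂ w) :
    Centre T w X₁ X₂ (Q ∪ Y ∪ Z) ∧ Tripod (Q ∪ Y ∪ Z) c Q Y Z := by
  obtain ⟨ht, ht'⟩ := h.toTripod.move h' hQ.left_mem hcw
  refine ⟨⟨ht, h₁, h₂, ⟨ht.le₃, ht.conn₃, ht.mem₃, ?_⟩, ?_⟩, ht'⟩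
  · intro y hy hyw e he
    have : e ∈ E(X₁) ∪ E(X₂) ∪ E(Q ∪ Y ∪ Z) := ht.edgeSet_eq ▸ he.edge_mem
    rcases this with (he' | he') | he'
    · exact absurd (ht.eq₁₃ ((ht.le₁.inc_congr he').2 he).vertex_mem hy) hyw
    · exact absurd (ht.eq₂₃ ((ht.le₂.inc_congr he').2 he).vertex_mem hy) hyw
    · exact he'
  · obtain ⟨e, he, hu⟩ := hQ.symm.existsUnique_inc hcw.symm
    refine ⟨e, he.mono ht'.le₁, fun f hf => ?_⟩
    have hwX : w ∈ V(X) := h'.le₁.vertexSet_mono hQ.right_mem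
    rcases hf.edge_mem with (hf' | hf') | hf'
    · exact hu f ((ht'.le₁.inc_congr hf').2 hf)
    · exact absurd (h.eq₁₂ hwX ((ht'.le₂.inc_congr hf').2 hf).vertex_mem) hcw.symm
    · exact absurd (h.eq₁₃ hwX ((ht'.le₃.inc_congr hf').2 hf).vertex_mem) hcw.symm

/-- If `X` splits, its stem has more than two leaves on the side of `Y` and `Z`, so at most two on
the side of `X`. -/
lemma Centre.isSmall_of_three_le (hT : IsShortcutTree ℓ T C) (hE : E(T).Finite)
    (hcirc : ShortcutCircle θ K (T.length ℓ) T.leaves (Covers ℓ T)) (h : Centre T c X Y Z)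
    (hn : 2 < (T.leaves ∩ V(Y) ∪ T.leaves ∩ V(Z)).ncard) : IsSmall T X c := by
  have hr := h.rooted hT.isTree hE
  rcases hr.cases hT.isTree hE hcirc with h' | ⟨Q, w, X₁, X₂, hvw, hQ, ht, h₁, h₂⟩
  · exact Or.inl h'
  refine hr.isSmall hT.isTree hE hcirc ?_
  rw [ht.inter_leaves h.le₁ hQ h.notMem_leaves (h₁.notMem_leaves h₂ ht.disj₂₃)]
  have := h.ncard_le_two_or hT hE hcirc ht hQ h₁ h₂
  omega

/-- The stem of `X` has more than two leaves on the far side, so `Y` and `Z` have one leaf each and,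
with the stem, form a branch with two leaves at `w`. Move the centre to `w`. Each of `X₁` and `X₂`
now faces at least three leaves and is therefore small. -/
lemma Centre.exists_small_aux (hT : IsShortcutTree ℓ T C) (hE : E(T).Finite)
    (hcirc : ShortcutCircle θ K (T.length ℓ) T.leaves (Covers ℓ T)) (h : Centre T c X Y Z)
    (hY : IsTwig T Y c y) (hn : 2 < (T.leaves ∩ V(X)).ncard) :
    ∃ c X Y Z, Centre T c X Y Z ∧ IsSmall T X c ∧ IsSmall T Y c ∧ IsSmall T Z c := by
  have hfin := hcirc.finite
  have hc := h.notMem_leaves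
  have hr := h.rooted hT.isTree hE
  rcases hr.cases hT.isTree hE hcirc with ⟨x, hx⟩ | ⟨Q, w, X₁, X₂, hcw, hQ, ht, h₁, h₂⟩
  · rw [IsTwig.inter_leaves hx h.le₁ hc, Set.ncard_singleton] at hn
    omega
  have hn' := hn
  rw [ht.inter_leaves h.le₁ hQ hc (h₁.notMem_leaves h₂ ht.disj₂₃)] at hn'
  have hYZ := (h.ncard_le_two_or hT hE hcirc ht hQ h₁ h₂).resolve_right (by omega)
  rw [ncard_add hfin (disjoint_leaves hc h.inter₂₃.le),
    hY.inter_leaves h.le₂ hc, Set.ncard_singleton] at hYZ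
  obtain ⟨z, hZ⟩ := (h.rotate.rotate.rooted hT.isTree hE).isTwig hT.isTree hE hcirc (by omega)
  obtain ⟨hC, hK⟩ := h.move ht hcw hQ h₁ h₂
  have hw := hC.notMem_leaves
  have hpos₁ := h₁.ncard_pos hT.isTree hE hfin
  have hpos₂ := h₂.ncard_pos hT.isTree hE hfin
  have hKn : 2 ≤ (T.leaves ∩ V(Q ∪ Y ∪ Z)).ncard := by
    have h1 := h.branch₂.ncard_pos hT.isTree hE hfin
    have h2 := h.branch₃.ncard_pos hT.isTree hE hfin
    have h3 := ncard_add hfin (disjoint_leaves hc h.inter₂₃.le)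
    have h4 : (T.leaves ∩ V(Y) ∪ T.leaves ∩ V(Z)).ncard ≤ (T.leaves ∩ V(Q ∪ Y ∪ Z)).ncard :=
      Set.ncard_le_ncard (Set.union_subset
        (Set.inter_subset_inter_right _ hK.le₂.vertexSet_mono)
        (Set.inter_subset_inter_right _ hK.le₃.vertexSet_mono))
        (hfin.subset Set.inter_subset_left)
    omega
  refine ⟨w, X₁, X₂, Q ∪ Y ∪ Z, hC, hC.isSmall_of_three_le hT hE hcirc ?_,
    hC.swap.isSmall_of_three_le hT hE hcirc ?_, Or.inr ⟨y, z, Q, c, Y, Z, hcw.symm, hQ.symm, hK,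
    hY, hZ⟩⟩
  · rw [ncard_add hfin (disjoint_leaves hw hC.inter₂₃.le)]
    omega
  · rw [ncard_add hfin (disjoint_leaves hw hC.inter₁₃.le)]
    omega

/-- A shortcut tree for a cycle is a path, or consists of three small branches. -/
lemma IsShortcutTree.isPath_or_exists_centre (hT : IsShortcutTree ℓ T C) (hE : E(T).Finite)
    (hcirc : ShortcutCircle θ K (T.length ℓ) T.leaves (Covers ℓ T)) (hr : r ∈ T.leaves) :
    (∃ x, r ≠ x ∧ T.IsPath r x ∧ x ∈ T.leaves) ∨
    ∃ c X Y Z, Centre T c X Y Z ∧ IsSmall T X c ∧ IsSmall T Y c ∧ IsSmall T Z c := by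
  -- The tree is rooted at a leaf `r`, so that it is itself a branch and the rest is a single
  -- vertex.
  have hroot : Rooted T (noEdge {r} β) T r := by
    refine ⟨⟨⟨le_rfl, hT.isTree.2.1, hr.1, fun y _ _ e he => he.edge_mem⟩, hr.2⟩,
      ⟨noEdge_le_iff.2 (by simpa using hr.1), le_rfl, ?_, ?_, ?_, ?_⟩, isConnected_noEdge r,
      r, hr, rfl⟩
    · exact (Set.union_eq_right.2 (by simpa using hr.1)).symm
    · simp
    · exact Set.inter_eq_left.2 (by simpa using hr.1)
    · simp
  rcases hroot.cases hT.isTree hE hcirc with h | ⟨Q, c, X, Z, hrc, hQ, ht, hX, hZ⟩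
  · exact Or.inl h
  right
  -- Read from `c`, the stem is the branch that ends in the root.
  have hQt : IsTwig T Q c r := ⟨hrc.symm, hQ.symm, hr⟩
  have hC : Centre T c X Q Z := ⟨ht.swap, hX, hQt.isBranch ht, hZ⟩
  by_cases hXn : (T.leaves ∩ V(X)).ncard ≤ 2
  · by_cases hZn : (T.leaves ∩ V(Z)).ncard ≤ 2
    · exact ⟨c, X, Q, Z, hC, (hC.rooted hT.isTree hE).isSmall hT.isTree hE hcirc hXn,
        Or.inl ⟨r, hQt⟩, (hC.rotate.rotate.rooted hT.isTree hE).isSmall hT.isTree hE hcirc hZn⟩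
    · exact hC.rotate.swap.exists_small_aux hT hE hcirc hQt (by omega)
  · exact hC.exists_small_aux hT hE hcirc hQt (by omega)

end Graph

/-! ### Path systems and subdivisions -/

namespace Graph

variable {α β : Type*} {G H X Y Z S T C : Graph α β} {ℓ : β → ℝ}

/-- The two labels in an entry of an edge list. -/
def endSet (p : ℕ × ℕ) : Set ℕ := {p.1, p.2}

/-- `G` is the union of the paths `P i`, for `i ∈ I`, which meet only in common ends. Their ends
are the vertices that `f` assigns to the pairs of labels `d i`. -/
structure IsPathSystem (d : ℕ → ℕ × ℕ) (f : ℕ → α) (P : ℕ → Graph α β) (I : Set ℕ)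
    (G : Graph α β) : Prop where
  path_le : ∀ i ∈ I, P i ≤ G
  isPath : ∀ i ∈ I, (P i).IsPath (f (d i).1) (f (d i).2)
  inter_subset : ∀ i ∈ I, ∀ j ∈ I, i ≠ j → V(P i) ∩ V(P j) ⊆ f '' (endSet (d i) ∩ endSet (d j))
  disjoint : ∀ i ∈ I, ∀ j ∈ I, i ≠ j → Disjoint E(P i) E(P j)
  vertexSet_eq : V(G) = ⋃ i ∈ I, V(P i)
  edgeSet_eq : E(G) = ⋃ i ∈ I, E(P i)

namespace IsPathSystem

variable {d : ℕ → ℕ × ℕ} {f : ℕ → α} {P : ℕ → Graph α β} {I J K M : Set ℕ}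

lemma mem_of_mem_endSet (h : IsPathSystem d f P I G) {i a : ℕ} (hi : i ∈ I)
    (ha : a ∈ endSet (d i)) : f a ∈ V(P i) := by
  rcases ha with rfl | rfl
  · exact (h.isPath i hi).left_mem
  · exact (h.isPath i hi).right_mem

/-- Distinct paths of the system meet only in common ends, and injectivity of `f` identifies the
label. Thus an end of one path is never an inner vertex of another. -/
lemma mem_endSet (h : IsPathSystem d f P I G) (hf : Set.InjOn f M)
    (hM : ∀ i ∈ I, endSet (d i) ⊆ M) {i j a : ℕ} (hi : i ∈ I) (hj : j ∈ I)
    (ha : a ∈ endSet (d j)) (hai : f a ∈ V(P i)) : a ∈ endSet (d i) := by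
  by_cases hij : i = j
  · exact hij ▸ ha
  obtain ⟨b, ⟨hb, hb'⟩, hab⟩ := h.inter_subset i hi j hj hij ⟨hai, h.mem_of_mem_endSet hj ha⟩
  rwa [← hf (hM i hi hb) (hM j hj ha) hab]

lemma single {i : ℕ} (h : (P i).IsPath (f (d i).1) (f (d i).2)) :
    IsPathSystem d f P {i} (P i) := by
  refine ⟨?_, ?_, ?_, ?_, by simp, by simp⟩
  · rintro _ rfl; exact le_rfl
  · rintro _ rfl; exact h
  · rintro _ rfl _ rfl hij; exact absurd rfl hij
  · rintro _ rfl _ rfl hij; exact absurd rfl hij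

/-- `N` consists of the labels of the common vertices. As each of them is an end of a path on both
sides, paths from different sides also meet only in common ends. -/
lemma union (hX : IsPathSystem d f P I X) (hY : IsPathSystem d f P J Y) (hXG : X ≤ G)
    (hYG : Y ≤ G) (hV : V(G) = V(X) ∪ V(Y)) (hE : E(G) = E(X) ∪ E(Y))
    (hdisj : Disjoint E(X) E(Y)) (hf : Set.InjOn f M) (hI : ∀ i ∈ I, endSet (d i) ⊆ M)
    (hJ : ∀ i ∈ J, endSet (d i) ⊆ M) {N : Set ℕ} (hN : V(X) ∩ V(Y) ⊆ f '' N)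
    (hNI : ∀ a ∈ N, ∃ i ∈ I, a ∈ endSet (d i)) (hNJ : ∀ a ∈ N, ∃ i ∈ J, a ∈ endSet (d i)) :
    IsPathSystem d f P (I ∪ J) G := by
  have cross : ∀ i ∈ I, ∀ j ∈ J, V(P i) ∩ V(P j) ⊆ f '' (endSet (d i) ∩ endSet (d j)) := by
    rintro i hi j hj x ⟨hxi, hxj⟩
    obtain ⟨a, ha, rfl⟩ := hN ⟨(hX.path_le i hi).vertexSet_mono hxi,
      (hY.path_le j hj).vertexSet_mono hxj⟩
    obtain ⟨i', hi', hai'⟩ := hNI a ha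
    obtain ⟨j', hj', haj'⟩ := hNJ a ha
    exact ⟨a, ⟨hX.mem_endSet hf hI hi hi' hai' hxi, hY.mem_endSet hf hJ hj hj' haj' hxj⟩, rfl⟩
  have crossE : ∀ i ∈ I, ∀ j ∈ J, Disjoint E(P i) E(P j) := fun i hi j hj =>
    hdisj.mono (hX.path_le i hi).edgeSet_mono (hY.path_le j hj).edgeSet_mono
  refine ⟨?_, ?_, ?_, ?_, ?_, ?_⟩
  · rintro i (hi | hi)
    · exact (hX.path_le i hi).trans hXG
    · exact (hY.path_le i hi).trans hYG
  · rintro i (hi | hi)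
    · exact hX.isPath i hi
    · exact hY.isPath i hi
  · rintro i (hi | hi) j (hj | hj) hij
    · exact hX.inter_subset i hi j hj hij
    · exact cross i hi j hj
    · rw [Set.inter_comm, Set.inter_comm (endSet (d i))]
      exact cross j hj i hi
    · exact hY.inter_subset i hi j hj hij
  · rintro i (hi | hi) j (hj | hj) hij
    · exact hX.disjoint i hi j hj hij
    · exact crossE i hi j hj
    · exact (crossE j hj i hi).symm
    · exact hY.disjoint i hi j hj hij
  · rw [hV, hX.vertexSet_eq, hY.vertexSet_eq, Set.biUnion_union]
  · rw [hE, hX.edgeSet_eq, hY.edgeSet_eq, Set.biUnion_union]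

lemma tripod {c : ℕ} (ht : Tripod G (f c) X Y Z) (hX : IsPathSystem d f P I X)
    (hY : IsPathSystem d f P J Y) (hZ : IsPathSystem d f P K Z) (hf : Set.InjOn f M)
    (hI : ∀ i ∈ I, endSet (d i) ⊆ M) (hJ : ∀ i ∈ J, endSet (d i) ⊆ M)
    (hK : ∀ i ∈ K, endSet (d i) ⊆ M) (hcI : ∃ i ∈ I, c ∈ endSet (d i))
    (hcJ : ∃ i ∈ J, c ∈ endSet (d i)) (hcK : ∃ i ∈ K, c ∈ endSet (d i)) :
    IsPathSystem d f P (I ∪ J ∪ K) G := by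
  refine (hX.union (G := X ∪ Y) (N := {c}) hY le_union_left ht.compat₁₂.le_union_right rfl rfl
    ht.disj₁₂ hf hI hJ ?_ ?_ ?_).union (N := {c}) hZ (union_le ht.le₁ ht.le₂) ht.le₃ ht.vertexSet_eq
    ht.edgeSet_eq (Set.disjoint_union_left.2 ⟨ht.disj₁₃, ht.disj₂₃⟩) hf ?_ hK ?_ ?_ ?_
  · rw [Set.image_singleton]; exact ht.inter₁₂.le
  · rintro _ rfl; exact hcI
  · rintro _ rfl; exact hcJ
  · rintro i (hi | hi)
    exacts [hI i hi, hJ i hi]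
  · rw [Set.image_singleton]
    rintro x ⟨hx | hx, hxZ⟩
    exacts [ht.eq₁₃ hx hxZ, ht.eq₂₃ hx hxZ]
  · rintro _ rfl
    obtain ⟨i, hi, h⟩ := hcI
    exact ⟨i, Or.inl hi, h⟩
  · rintro _ rfl; exact hcK

lemma exists_subdivision {l : List (ℕ × ℕ)} (h : IsPathSystem (fun i => l.getD i (0, 0)) f P
    {i | i < l.length} G) (hf : Set.InjOn f V(ofEdgeList l)) :
    ∃ φ : Subdivision (ofEdgeList l) G, φ.path = P := by
  have hM : ∀ i ∈ {i | i < l.length}, endSet (l.getD i (0, 0)) ⊆ V(ofEdgeList l) := by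
    intro i hi a ha
    have hi' : i < l.length := hi
    rw [List.getD_eq_getElem l _ hi'] at ha
    exact ⟨l[i], List.getElem_mem hi', ha⟩
  have hlink : ∀ {i x y}, (ofEdgeList l).IsLink i x y →
      i < l.length ∧ (l.getD i (0, 0) = (x, y) ∨ l.getD i (0, 0) = (y, x)) := by
    rintro i x y (h | h)
    · exact ⟨(List.getElem?_eq_some_iff.1 h).1, Or.inl (by rw [List.getD, h]; rfl)⟩
    · exact ⟨(List.getElem?_eq_some_iff.1 h).1, Or.inr (by rw [List.getD, h]; rfl)⟩
  have hlab : ∀ a ∈ V(ofEdgeList l), ∃ i, i < l.length ∧ a ∈ endSet (l.getD i (0, 0)) := by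
    rintro a ⟨p, hp, ha⟩
    obtain ⟨i, hi, rfl⟩ := List.getElem_of_mem hp
    exact ⟨i, hi, by rw [List.getD_eq_getElem l _ hi]; exact ha⟩
  refine ⟨⟨f, P, hf, h.path_le, ?_, ?_, ?_, h.disjoint, ?_, h.edgeSet_eq⟩, rfl⟩
  · intro i x y hxy
    obtain ⟨hi, h' | h'⟩ := hlink hxy
    · have := h.isPath i hi
      simpa only [h'] using this
    · have := (h.isPath i hi).symm
      simpa only [h'] using this
  · intro i hi a ha hai
    obtain ⟨j, hj, haj⟩ := hlab a ha
    have := h.mem_endSet hf hM hi hj haj hai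
    have hi' : i < l.length := hi
    simp only [List.getD_eq_getElem l _ hi'] at this
    have hl : (ofEdgeList l).IsLink i l[i].1 l[i].2 := Or.inl (List.getElem?_eq_getElem hi')
    rcases this with rfl | rfl
    · exact hl.inc_left
    · exact hl.inc_right
  · intro i hi j hj hij x hx
    obtain ⟨a, ha, rfl⟩ := h.inter_subset i hi j hj hij hx
    exact ⟨a, hM i hi ha.1, rfl⟩
  · rw [h.vertexSet_eq]
    refine (Set.union_eq_right.2 ?_).symm
    rintro _ ⟨a, ha, rfl⟩
    obtain ⟨i, hi, hai⟩ := hlab a ha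
    exact Set.mem_biUnion hi (h.mem_of_mem_endSet hi hai)

end IsPathSystem

/-- Locates an index in one of the intervals between successive values of `q`, without assuming `q`
monotone. -/
lemma exists_index {k m : ℕ} {q : ℕ → ℕ} (h₀ : q 0 ≤ m) (hk : m < q k) :
    ∃ i < k, q i ≤ m ∧ m < q (i + 1) := by
  induction k with
  | zero => omega
  | succ k ih =>
    rcases Nat.lt_or_ge m (q k) with h | h
    · obtain ⟨i, hi, h'⟩ := ih h
      exact ⟨i, by omega, h'⟩
    · exact ⟨k, by omega, h, hk⟩

/-- Points in cyclic order cut a cycle into paths between consecutive points. -/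
lemma IsCycleSeq.exists_isPathSystem {n : ℕ} {v : ℕ → α} {e : ℕ → β} (h : C.IsCycleSeq n v e)
    {k : ℕ} (hk : 2 ≤ k) {q : ℕ → ℕ} (hq : ∀ i < k, q i < q (i + 1)) (hqk : q k = q 0 + n)
    {f : ℕ → α} (hf : ∀ i < k, f i = v (q i)) {d : ℕ → ℕ × ℕ}
    (hd : ∀ i < k, d i = (i, (i + 1) % k)) :
    ∃ P : ℕ → Graph α β, IsPathSystem d f P (Set.Iio k) C := by
  have hmono : ∀ i j, i ≤ j → j ≤ k → q i ≤ q j := by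
    intro i j hij hj
    induction j, hij using Nat.le_induction with
    | base => exact le_rfl
    | succ j hij ih =>
      have := hq j (by omega)
      have := ih (by omega)
      omega
  have hstrict : ∀ i j, i < j → j ≤ k → q i < q j := by
    intro i j hij hj
    have := hmono (i + 1) j hij hj
    have := hq i (by omega)
    omega
  -- The condition `i < k` stands inside the existential so that `choose` yields a family on all of
  -- `ℕ`; for other `i` the value `C` is a dummy.
  have harc : ∀ i, ∃ P : Graph α β, i < k → P ≤ C ∧ V(P) = v '' Set.Icc (q i) (q (i + 1)) ∧
      E(P) = e '' Set.Ico (q i) (q (i + 1)) ∧ P.IsPath (v (q i)) (v (q (i + 1))) := by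
    intro i
    by_cases hi : i < k
    · have h1 := hq i hi
      have h2 : q (i + 1) < q i + n := by
        have h3 := hmono (i + 1) k hi le_rfl
        have h4 := hmono 0 i (by omega) (by omega)
        rcases Nat.eq_zero_or_pos i with rfl | hi0
        · have := hstrict 1 k (by omega) le_rfl
          simp only [zero_add] at *
          omega
        · have := hstrict 0 i hi0 (by omega)
          omega
      obtain ⟨P, hP, hV, hE, hp, -⟩ := h.exists_arc (ℓ := fun _ => 0) h1.le h2
      exact ⟨P, fun _ => ⟨hP, hV, hE, hp⟩⟩
    · exact ⟨C, fun hi' => absurd hi' hi⟩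
  choose P hP using harc
  have hend : ∀ i < k, f ((i + 1) % k) = v (q (i + 1)) := by
    intro i hi
    rcases Nat.lt_or_ge (i + 1) k with hlt | hge
    · rw [Nat.mod_eq_of_lt hlt, hf _ hlt]
    · obtain rfl : i + 1 = k := by omega
      rw [Nat.mod_self, hf 0 (by omega), hqk, h.vert_add]
  have hinter : ∀ i j, i < j → j < k →
      V(P i) ∩ V(P j) ⊆ f '' (endSet (d i) ∩ endSet (d j)) := by
    intro i j hij hj
    rw [(hP i (by omega)).2.1, (hP j hj).2.1, hd i (by omega), hd j hj]
    rintro _ ⟨⟨a, ⟨ha, ha'⟩, rfl⟩, b, ⟨hb, hb'⟩, hab⟩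
    have h1 := hmono (i + 1) j hij (by omega)
    have h2 := hmono (j + 1) k hj le_rfl
    have h3 := hmono 0 i (by omega) (by omega)
    -- A common vertex has the same index on both arcs, which are then consecutive, or the indices
    -- differ by a full turn, and the arcs are the first and the last.
    rcases Nat.lt_or_ge b (a + n) with hlt | hge
    · have := h.vert_inj hab.symm (by omega) hlt
      have hji : j = i + 1 := by
        by_contra hne
        have := hstrict (i + 1) j (by omega) (by omega)
        omega
      subst hji
      obtain rfl : a = q (i + 1) := by omega
      refine ⟨i + 1, ⟨Or.inr ?_, Or.inl rfl⟩, hf _ hj⟩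
      exact (Nat.mod_eq_of_lt hj).symm
    · have hi0 : i = 0 := by
        by_contra hne
        have := hstrict 0 i (by omega) (by omega)
        omega
      have hjk : j + 1 = k := by
        by_contra hne
        have := hstrict (j + 1) k (by omega) le_rfl
        omega
      subst hi0
      subst hjk
      obtain rfl : a = q 0 := by omega
      exact ⟨0, ⟨Or.inl rfl, Or.inr (Nat.mod_self _).symm⟩, hf 0 (by omega)⟩
  have hdisj : ∀ i j, i < j → j < k → Disjoint E(P i) E(P j) := by
    intro i j hij hj
    rw [(hP i (by omega)).2.2.1, (hP j hj).2.2.1, Set.disjoint_left]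
    rintro _ ⟨a, ⟨ha, ha'⟩, rfl⟩ ⟨b, ⟨hb, hb'⟩, hab⟩
    have h1 := hmono (i + 1) j hij (by omega)
    have h2 := hmono (j + 1) k hj le_rfl
    have h3 := hmono 0 i (by omega) (by omega)
    have := h.edge_inj hab.symm (by omega) (by omega)
    omega
  -- The arcs cover the indices from `q 0` to `q 0 + n`; a multiple of `n` moves `m` into this
  -- window.
  have hcov : ∀ m < n, ∃ m', m' % n = m ∧ ∃ i < k, q i ≤ m' ∧ m' < q (i + 1) := by
    intro m hm
    have hpos := h.pos
    have hlt := Nat.mod_lt (q 0) hpos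
    have hdm := Nat.mod_add_div (q 0) n
    rcases Nat.lt_or_ge m (q 0 % n) with hlt' | hge
    · refine ⟨m + n * (q 0 / n + 1), ?_, exists_index ?_ ?_⟩
      · rw [Nat.add_mul_mod_self_left, Nat.mod_eq_of_lt hm]
      · rw [Nat.mul_add]; omega
      · rw [hqk, Nat.mul_add]; omega
    · refine ⟨m + n * (q 0 / n), ?_, exists_index ?_ ?_⟩
      · rw [Nat.add_mul_mod_self_left, Nat.mod_eq_of_lt hm]
      · omega
      · rw [hqk]; omega
  refine ⟨P, fun i hi => (hP i hi).1, ?_, ?_, ?_, ?_, ?_⟩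
  · intro i hi
    rw [hd i hi]
    simp only
    rw [hf i hi, hend i hi]
    exact (hP i hi).2.2.2
  · intro i hi j hj hij
    rcases lt_or_gt_of_ne hij with hlt | hlt
    · exact hinter i j hlt hj
    · rw [Set.inter_comm, Set.inter_comm (endSet (d i))]
      exact hinter j i hlt hi
  · intro i hi j hj hij
    rcases lt_or_gt_of_ne hij with hlt | hlt
    · exact hdisj i j hlt hj
    · exact (hdisj j i hlt hi).symm
  · refine Set.Subset.antisymm ?_ (Set.iUnion₂_subset fun i hi => (hP i hi).1.vertexSet_mono)
    rw [h.vertexSet_eq]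
    rintro _ ⟨m, hm, rfl⟩
    obtain ⟨m', hm', i, hi, h1, h2⟩ := hcov m hm
    refine Set.mem_biUnion hi ?_
    rw [(hP i hi).2.1]
    exact ⟨m', ⟨h1, h2.le⟩, by rw [← hm', h.vert_mod]⟩
  · refine Set.Subset.antisymm ?_ (Set.iUnion₂_subset fun i hi => (hP i hi).1.edgeSet_mono)
    rw [h.edgeSet_eq]
    rintro _ ⟨m, hm, rfl⟩
    obtain ⟨m', hm', i, hi, h1, h2⟩ := hcov m hm
    refine Set.mem_biUnion hi ?_
    rw [(hP i hi).2.2.1]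
    exact ⟨m', ⟨h1, h2⟩, by rw [← hm', h.edge_mod]⟩

/-- Leaves in cyclic order on the cycle have increasing indices. -/
lemma IsCycleSeq.exists_indices {n : ℕ} {v : ℕ → α} {e : ℕ → β} (h : C.IsCycleSeq n v e)
    (hpos : ∀ e ∈ E(C), 0 < ℓ e) {k : ℕ} {f : ℕ → α} (hf : ∀ i < k, f i ∈ V(C)) (hk : 0 < k)
    (hlt : ∀ i, i + 1 < k →
      fwd (fun x => seqLength ℓ e (seqPos v n x)) (seqLength ℓ e n) (f 0) (f i) <
      fwd (fun x => seqLength ℓ e (seqPos v n x)) (seqLength ℓ e n) (f 0) (f (i + 1))) :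
    ∃ q : ℕ → ℕ, (∀ i < k, q i < q (i + 1)) ∧ q k = q 0 + n ∧ ∀ i < k, f i = v (q i) := by
  have hmono := h.seqLength_strictMono hpos
  let s : ℕ → ℕ := fun i => seqPos v n (f i)
  have hs : ∀ i < k, s i < n := fun i hi => h.seqPos_lt (hf i hi)
  -- Leaves that lie before the first one in the original numbering are passed after the origin and
  -- so belong to the next period.
  let q : ℕ → ℕ := fun i => if i < k then (if s 0 ≤ s i then s i else s i + n) else s 0 + n
  have hq : ∀ i < k, q i = if s 0 ≤ s i then s i else s i + n := fun i hi => if_pos hi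
  have hq0 : q 0 = s 0 := by rw [hq 0 hk, if_pos le_rfl]
  have hqk : q k = s 0 + n := if_neg (lt_irrefl k)
  have hfwd : ∀ i < k, fwd (fun x => seqLength ℓ e (seqPos v n x)) (seqLength ℓ e n) (f 0) (f i) =
      seqLength ℓ e (q i) - seqLength ℓ e (s 0) := by
    intro i hi
    unfold fwd
    simp only [hmono.le_iff_le]
    rw [hq i hi]
    by_cases hle : s 0 ≤ s i
    · rw [if_pos hle, if_pos hle]
    · rw [if_neg hle, if_neg hle, h.seqLength_add]
      ring
  refine ⟨q, fun i hi => ?_, by rw [hqk, hq0], fun i hi => ?_⟩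
  · rcases Nat.lt_or_ge (i + 1) k with hlt' | hge
    · have := hlt i hlt'
      rw [hfwd i hi, hfwd _ hlt'] at this
      exact hmono.lt_iff_lt.1 (by linarith)
    · obtain rfl : i + 1 = k := by omega
      rw [hqk, hq i hi]
      have := hs i hi
      split_ifs <;> omega
  · rw [hq i hi]
    split_ifs
    · exact (h.vert_seqPos (hf i hi)).symm
    · rw [h.vert_add]
      exact (h.vert_seqPos (hf i hi)).symm

end Graph

/-! ### Realising the graphs `X_k` -/

namespace Graph

variable {α β : Type*} {G H X Y Z S T C : Graph α β} {ℓ : β → ℝ} {c : α}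

/-- The ends of the `i`-th edge of `cycleTree k`. -/
def cycleTreeEnds (k i : ℕ) : ℕ × ℕ := (cycleEdges k ++ innerTreeEdges k).getD i (0, 0)

/-- The number of edges of `cycleTree k`. -/
def cycleTreeSize (k : ℕ) : ℕ := (cycleEdges k ++ innerTreeEdges k).length

lemma length_cycleEdges (k : ℕ) : (cycleEdges k).length = k := by simp [cycleEdges]

lemma cycleTreeEnds_of_lt {k i : ℕ} (hi : i < k) : cycleTreeEnds k i = (i, (i + 1) % k) := by
  have hi' : i < (cycleEdges k).length := by rwa [length_cycleEdges]
  unfold cycleTreeEnds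
  rw [List.getD_append _ _ _ _ hi', List.getD_eq_getElem _ _ hi']
  simp [cycleEdges]

lemma IsPathSystem.congr {d : ℕ → ℕ × ℕ} {f : ℕ → α} {P P' : ℕ → Graph α β} {I : Set ℕ}
    (h : IsPathSystem d f P I G) (hP : ∀ i ∈ I, P' i = P i) : IsPathSystem d f P' I G := by
  refine ⟨fun i hi => ?_, fun i hi => ?_, fun i hi j hj hij => ?_, fun i hi j hj hij => ?_, ?_, ?_⟩
  · rw [hP i hi]; exact h.path_le i hi
  · rw [hP i hi]; exact h.isPath i hi
  · rw [hP i hi, hP j hj]; exact h.inter_subset i hi j hj hij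
  · rw [hP i hi, hP j hj]; exact h.disjoint i hi j hj hij
  · rw [h.vertexSet_eq]; exact Set.iUnion₂_congr fun i hi => by rw [hP i hi]
  · rw [h.edgeSet_eq]; exact Set.iUnion₂_congr fun i hi => by rw [hP i hi]

/-- Labels below `k` are leaves, kept apart by their positions on the cycle; the remaining labels
are vertices that are not leaves. -/
lemma injOn_labels {f : ℕ → α} {g : α → ℝ} {L : Set α} {k m : ℕ}
    (hlt : ∀ i, i + 1 < k → g (f i) < g (f (i + 1))) (hL : ∀ i < k, f i ∈ L)
    (hin : ∀ i, k ≤ i → i < m → f i ∉ L) (hinj : Set.InjOn f (Set.Ico k m)) :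
    Set.InjOn f (Set.Iio m) := by
  have hmono : ∀ i j, i < j → j < k → g (f i) < g (f j) := by
    intro i j hij
    induction j, hij using Nat.le_induction with
    | base => exact hlt i
    | succ j hij ih => exact fun hj => (ih (by omega)).trans (hlt j hj)
  intro i hi j hj hij
  rcases Nat.lt_or_ge i k with hik | hik <;> rcases Nat.lt_or_ge j k with hjk | hjk
  · rcases lt_trichotomy i j with h | h | h
    · have := hmono i j h hjk
      rw [hij] at this
      exact absurd this (lt_irrefl _)
    · exact h
    · have := hmono j i h hik
      rw [hij] at this
      exact absurd this (lt_irrefl _)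
  · exact absurd (hij ▸ hL i hik) (hin j hjk hj)
  · exact absurd (hij.symm ▸ hL j hjk) (hin i hik hi)
  · exact hinj ⟨hik, hi⟩ ⟨hjk, hj⟩ hij

/-- The union of the tree `T` and the cycle `C` is a subdivision of some `cycleTree k`. -/
def HasSubdivision (T C : Graph α β) : Prop :=
  ∃ k : ℕ, 2 ≤ k ∧ k ≤ 6 ∧ T.leaves.ncard = k ∧
    ∃ φ : Subdivision (cycleTree k) (T ∪ C),
      ∀ i ∈ E(cycleTree k), (i < k → φ.path i ≤ C) ∧ (k ≤ i → φ.path i ≤ T)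

/-- The common frame for all `k`: labels below `k` name the leaves in cyclic order, labels from `k`
to `m - 1` the branching vertices. It remains to describe `T` as a path system; `hsys` may use the
injectivity of `f`, which is derived here. -/
lemma IsShortcutTree.hasSubdivision (hT : IsShortcutTree ℓ T C) {n : ℕ} {v : ℕ → α} {e : ℕ → β}
    (hC : C.IsCycleSeq n v e) {k m : ℕ} (hk₂ : 2 ≤ k) (hk₆ : k ≤ 6) {f : ℕ → α}
    {P : ℕ → Graph α β}
    (hsys : Set.InjOn f (Set.Iio m) →
      IsPathSystem (cycleTreeEnds k) f P {i | k ≤ i ∧ i < cycleTreeSize k} T)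
    (hM : ∀ i < cycleTreeSize k, (cycleTreeEnds k i).1 < m ∧ (cycleTreeEnds k i).2 < m)
    (hlab : ∀ a < k, ∃ i < cycleTreeSize k, k ≤ i ∧
      (a = (cycleTreeEnds k i).1 ∨ a = (cycleTreeEnds k i).2))
    (hleaf : T.leaves = f '' Set.Iio k)
    (hlt : ∀ i, i + 1 < k →
      fwd (fun x => seqLength ℓ e (seqPos v n x)) (seqLength ℓ e n) (f 0) (f i) <
      fwd (fun x => seqLength ℓ e (seqPos v n x)) (seqLength ℓ e n) (f 0) (f (i + 1)))
    (hin : ∀ i, k ≤ i → i < m → f i ∉ T.leaves) (hinj : Set.InjOn f (Set.Ico k m)) :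
    HasSubdivision T C := by
  have hfL : ∀ i < k, f i ∈ T.leaves := fun i hi => hleaf ▸ ⟨i, hi, rfl⟩
  have hf := injOn_labels hlt hfL hin hinj
  have hLC : T.leaves ⊆ V(C) := fun x hx => (hT.vert.ge hx).2
  have hE : Disjoint E(T) E(C) := Set.disjoint_iff_inter_eq_empty.2 hT.edge
  have hmk : k ≤ m := by
    by_contra! hlt'
    obtain ⟨i, hi, -, h⟩ := hlab m hlt'
    have := hM i hi
    omega
  obtain ⟨q, hq, hqk, hfq⟩ := hC.exists_indices (fun e he => hT.length_pos e (Or.inr he))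
    (fun i hi => hLC (hfL i hi)) (by omega) hlt
  obtain ⟨A, hA⟩ := hC.exists_isPathSystem hk₂ hq hqk hfq (d := cycleTreeEnds k)
    fun i hi => cycleTreeEnds_of_lt hi
  let Q : ℕ → Graph α β := fun i => if i < k then A i else P i
  have hks : k ≤ cycleTreeSize k := by
    unfold cycleTreeSize
    rw [List.length_append, length_cycleEdges]
    omega
  have hA' := hA.congr (P' := Q) fun i hi => if_pos hi
  have hT' := (hsys hf).congr (P' := Q) fun i hi => if_neg (by have := hi.1; omega)
  have hends : ∀ i < cycleTreeSize k, endSet (cycleTreeEnds k i) ⊆ Set.Iio m := by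
    rintro i hi _ (rfl | rfl)
    exacts [(hM i hi).1, (hM i hi).2]
  have hI : {i | k ≤ i ∧ i < cycleTreeSize k} ∪ Set.Iio k = {i | i < cycleTreeSize k} := by
    ext i
    simp only [Set.mem_union, Set.mem_ofPred_eq, Set.mem_Iio]
    omega
  -- Tree and cycle meet exactly in the leaves, and each label below `k` is an end of some edge of
  -- both `T_k` and `C_k`.
  have hU := hT'.union (G := T ∪ C) (N := Set.Iio k) hA' le_union_left
    (Compatible.of_disjoint_edgeSet hE).le_union_right rfl rfl hE hf
    (fun i hi => hends i hi.2) (fun i hi => hends i (lt_of_lt_of_le hi hks))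
    (by rw [hT.vert, hleaf])
    (fun a ha => by
      obtain ⟨i, hi, hki, h⟩ := hlab a ha
      exact ⟨i, ⟨hki, hi⟩, h⟩)
    (fun a ha => ⟨a, ha, by rw [cycleTreeEnds_of_lt ha]; exact Or.inl rfl⟩)
  rw [hI] at hU
  obtain ⟨φ, hφ⟩ := IsPathSystem.exists_subdivision (l := cycleEdges k ++ innerTreeEdges k) hU
    (hf.mono (by
      rintro a ⟨p, hp, ha⟩
      obtain ⟨i, hi, rfl⟩ := List.getElem_of_mem hp
      have := hM i hi
      unfold cycleTreeEnds at this
      rw [List.getD_eq_getElem _ _ hi] at this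
      simp only [Set.mem_Iio]
      omega))
  refine ⟨k, hk₂, hk₆, ?_, φ, fun i hi => ⟨fun hik => ?_, fun hki => ?_⟩⟩
  · have hIio : (Set.Iio k).ncard = k := by
      rw [← Finset.coe_range, Set.ncard_coe_finset, Finset.card_range]
    have hfk : Set.InjOn f (Set.Iio k) := hf.mono (Set.Iio_subset_Iio hmk)
    rw [hleaf, hfk.ncard_image, hIio]
  · rw [hφ]
    exact hA'.path_le i hik
  · rw [hφ]
    exact hT'.path_le i ⟨hki, hi⟩

lemma IsPathSystem.fork {d : ℕ → ℕ × ℕ} {f : ℕ → α} {P : ℕ → Graph α β} {M : Set ℕ} (w i j k : ℕ)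
    (ht : Tripod X (f w) (P i) (P j) (P k)) (hi : (P i).IsPath (f (d i).1) (f (d i).2))
    (hj : (P j).IsPath (f (d j).1) (f (d j).2)) (hk : (P k).IsPath (f (d k).1) (f (d k).2))
    (hf : Set.InjOn f M) (hMi : endSet (d i) ⊆ M) (hMj : endSet (d j) ⊆ M)
    (hMk : endSet (d k) ⊆ M) (hwi : w ∈ endSet (d i)) (hwj : w ∈ endSet (d j))
    (hwk : w ∈ endSet (d k)) : IsPathSystem d f P ({i} ∪ {j} ∪ {k}) X :=
  IsPathSystem.tripod ht (.single hi) (.single hj) (.single hk) hf (by rintro _ rfl; exact hMi)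
    (by rintro _ rfl; exact hMj) (by rintro _ rfl; exact hMk) ⟨i, rfl, hwi⟩ ⟨j, rfl, hwj⟩
    ⟨k, rfl, hwk⟩

section

variable {n : ℕ} {v : ℕ → α} {e : ℕ → β} {x₀ x₁ x₂ x₃ x₄ x₅ : α}

lemma IsShortcutTree.hasSubdivision_two (hT : IsShortcutTree ℓ T C) (hC : C.IsCycleSeq n v e)
    (hne : x₀ ≠ x₁) (hp : T.IsPath x₀ x₁) (hx₀ : x₀ ∈ T.leaves) (hx₁ : x₁ ∈ T.leaves)
    (h₀₁ : fwd (fun x => seqLength ℓ e (seqPos v n x)) (seqLength ℓ e n) x₀ x₀ <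
      fwd (fun x => seqLength ℓ e (seqPos v n x)) (seqLength ℓ e n) x₀ x₁) :
    HasSubdivision T C := by
  refine hT.hasSubdivision hC (k := 2) (m := 2) (f := fun i => [x₀, x₁].getD i x₀)
    (P := fun _ => T) (by omega) (by omega) (fun _ => ?_) (by decide) (by decide) ?_ ?_ ?_ ?_
  · have hI : {i | 2 ≤ i ∧ i < cycleTreeSize 2} = {2} := by
      ext i
      simp only [Set.mem_ofPred_eq, Set.mem_singleton_iff, show cycleTreeSize 2 = 3 from rfl]
      omega
    rw [hI]
    exact IsPathSystem.single (P := fun _ => T) (i := 2) hp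
  · refine Set.Subset.antisymm (fun x hx => ?_) ?_
    · rcases hp.inter_leaves le_rfl ⟨hx, hx.1⟩ with rfl | rfl
      exacts [⟨0, by simp, rfl⟩, ⟨1, by simp, rfl⟩]
    · rintro _ ⟨i, hi, rfl⟩
      simp only [Set.mem_Iio] at hi
      interval_cases i
      exacts [hx₀, hx₁]
  · intro i hi
    obtain rfl : i = 0 := by omega
    exact h₀₁
  · intro i h1 h2; omega
  · intro i hi; simp at hi

lemma Centre.leaves_eq (h : Centre T c X Y Z) :
    T.leaves = T.leaves ∩ V(X) ∪ T.leaves ∩ V(Y) ∪ T.leaves ∩ V(Z) := by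
  rw [← Set.inter_union_distrib_left, ← Set.inter_union_distrib_left, ← h.vertexSet_eq]
  exact (Set.inter_eq_left.2 fun x hx => hx.1).symm

lemma IsShortcutTree.hasSubdivision_three (hT : IsShortcutTree ℓ T C) (hC : C.IsCycleSeq n v e)
    (h : Centre T c X Y Z) (hX : IsTwig T X c x₀) (hY : IsTwig T Y c x₁) (hZ : IsTwig T Z c x₂)
    {g : α → ℝ}
    (hg : g = fwd (fun x => seqLength ℓ e (seqPos v n x)) (seqLength ℓ e n) x₀)
    (h₀₁ : g x₀ < g x₁) (h₁₂ : g x₁ < g x₂) : HasSubdivision T C := by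
  subst hg
  have hc := h.notMem_leaves
  have hM : ∀ i < cycleTreeSize 3, (cycleTreeEnds 3 i).1 < 4 ∧ (cycleTreeEnds 3 i).2 < 4 := by
    decide
  have hM' : ∀ i < cycleTreeSize 3, endSet (cycleTreeEnds 3 i) ⊆ Set.Iio 4 := by
    rintro i hi _ (rfl | rfl)
    exacts [(hM i hi).1, (hM i hi).2]
  -- Label `3` is the centre. The edges of the tree are numbered from `3` on, hence the shift in the
  -- list of paths.
  refine hT.hasSubdivision hC (k := 3) (m := 4) (f := fun i => [x₀, x₁, x₂, c].getD i c)
    (P := fun i => [X, Y, Z].getD (i - 3) T) (by omega) (by omega) (fun hf => ?_) hM (by decide)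
    ?_ ?_ ?_ ?_
  · have hI : {i | 3 ≤ i ∧ i < cycleTreeSize 3} = {3} ∪ {4} ∪ {5} := by
      ext i
      simp only [Set.mem_ofPred_eq, Set.mem_union, Set.mem_singleton_iff,
        show cycleTreeSize 3 = 6 from rfl]
      omega
    rw [hI]
    exact .fork 3 3 4 5 h.toTripod hX.2.1 hY.2.1 hZ.2.1 hf (hM' 3 (by decide)) (hM' 4 (by decide))
      (hM' 5 (by decide)) (Or.inl rfl) (Or.inl rfl) (Or.inl rfl)
  · rw [h.leaves_eq, hX.inter_leaves h.le₁ hc, hY.inter_leaves h.le₂ hc, hZ.inter_leaves h.le₃ hc]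
    refine Set.Subset.antisymm ?_ ?_
    · rintro _ ((rfl | rfl) | rfl)
      exacts [⟨0, by simp, rfl⟩, ⟨1, by simp, rfl⟩, ⟨2, by simp, rfl⟩]
    · rintro _ ⟨i, hi, rfl⟩
      simp only [Set.mem_Iio] at hi
      interval_cases i <;> simp
  · intro i hi
    have hi' : i < 2 := by omega
    interval_cases i
    exacts [h₀₁, h₁₂]
  · intro i h1 h2
    obtain rfl : i = 3 := by omega
    exact hc
  · intro i hi j hj _
    simp only [Set.mem_Ico] at hi hj
    omega

end

end Graph

namespace Graph

variable {α β : Type*} {G H X Y Z S T C X₁ X₂ : Graph α β} {ℓ : β → ℝ} {c w x y : α}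
  {n : ℕ} {v : ℕ → α} {e : ℕ → β} {x₀ x₁ x₂ x₃ x₄ x₅ : α} {g : α → ℝ}

lemma IsTwig.notMem_leaves (h₁ : IsTwig T X₁ w x) (h₂ : IsTwig T X₂ w y) (hX₁ : X₁ ≤ T)
    (hX₂ : X₂ ≤ T) (h : Disjoint E(X₁) E(X₂)) : w ∉ T.leaves := by
  obtain ⟨e, he⟩ := (h₁.2.1.existsUnique_inc h₁.1).exists
  obtain ⟨f, hf⟩ := (h₂.2.1.existsUnique_inc h₂.1).exists
  exact notMem_leaves_of_disjoint hX₁ hX₂ h he hf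

lemma IsCherry.inter_leaves (h : IsCherry T X c x y) (hX : X ≤ T) (hc : c ∉ T.leaves) :
    T.leaves ∩ V(X) = {x, y} := by
  obtain ⟨Q, w, X₁, X₂, -, hQ, ht, h₁, h₂⟩ := h
  have hw := h₁.notMem_leaves h₂ (ht.le₂.trans hX) (ht.le₃.trans hX) ht.disj₂₃
  rw [ht.inter_leaves hX hQ hc hw, h₁.inter_leaves (ht.le₂.trans hX) hw,
    h₂.inter_leaves (ht.le₃.trans hX) hw]
  rfl

lemma IsShortcutTree.hasSubdivision_four (hT : IsShortcutTree ℓ T C) (hC : C.IsCycleSeq n v e)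
    (h : Centre T c X Y Z) (hX : IsCherry T X c x₀ x₁) (hY : IsTwig T Y c x₂)
    (hZ : IsTwig T Z c x₃)
    (hg : g = fwd (fun x => seqLength ℓ e (seqPos v n x)) (seqLength ℓ e n) x₀)
    (h₀₁ : g x₀ < g x₁) (h₁₂ : g x₁ < g x₂) (h₂₃ : g x₂ < g x₃) : HasSubdivision T C := by
  subst hg
  have hc := h.notMem_leaves
  have hL := h.leaves_eq
  rw [hX.inter_leaves h.le₁ hc, hY.inter_leaves h.le₂ hc, hZ.inter_leaves h.le₃ hc] at hL
  obtain ⟨Q, w, X₁, X₂, hcw, hQ, ht, hX₁, hX₂⟩ := hX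
  have hw := hX₁.notMem_leaves hX₂ (ht.le₂.trans h.le₁) (ht.le₃.trans h.le₁) ht.disj₂₃
  have hM : ∀ i < cycleTreeSize 4, (cycleTreeEnds 4 i).1 < 6 ∧ (cycleTreeEnds 4 i).2 < 6 := by
    decide
  have hM' : ∀ i < cycleTreeSize 4, endSet (cycleTreeEnds 4 i) ⊆ Set.Iio 6 := by
    rintro i hi _ (rfl | rfl)
    exacts [(hM i hi).1, (hM i hi).2]
  -- Label `4` is the vertex where the cherry splits and `5` is the centre; the stem `Q` is the last
  -- edge, numbered `8`.
  refine hT.hasSubdivision hC (k := 4) (m := 6) (f := fun i => [x₀, x₁, x₂, x₃, w, c].getD i c)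
    (P := fun i => [X₁, X₂, Y, Z, Q].getD (i - 4) T) (by omega) (by omega) (fun hf => ?_) hM
    (by decide) ?_ ?_ ?_ ?_
  · have hI : {i | 4 ≤ i ∧ i < cycleTreeSize 4} = ({8} ∪ {4} ∪ {5}) ∪ {6} ∪ {7} := by
      ext i
      simp only [Set.mem_ofPred_eq, Set.mem_union, Set.mem_singleton_iff,
        show cycleTreeSize 4 = 9 from rfl]
      omega
    have sub : ∀ i ∈ ({8} ∪ {4} ∪ {5} ∪ {6} ∪ {7} : Set ℕ),
        endSet (cycleTreeEnds 4 i) ⊆ Set.Iio 6 := fun i hi => hM' i (hI.ge hi).2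
    rw [hI]
    exact .tripod (c := 5) h.toTripod
      (.fork 4 8 4 5 ht hQ hX₁.2.1 hX₂.2.1 hf (hM' 8 (by decide)) (hM' 4 (by decide))
        (hM' 5 (by decide)) (Or.inr rfl) (Or.inl rfl) (Or.inl rfl))
      (.single hY.2.1) (.single hZ.2.1) hf (fun i hi => sub i (Or.inl (Or.inl hi)))
      (fun i hi => sub i (Or.inl (Or.inr hi))) (fun i hi => sub i (Or.inr hi))
      ⟨8, Or.inl (Or.inl rfl), Or.inl rfl⟩ ⟨6, rfl, Or.inl rfl⟩ ⟨7, rfl, Or.inl rfl⟩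
  · rw [hL]
    refine Set.Subset.antisymm ?_ ?_
    · rintro _ (((rfl | rfl) | rfl) | rfl)
      exacts [⟨0, by simp, rfl⟩, ⟨1, by simp, rfl⟩, ⟨2, by simp, rfl⟩, ⟨3, by simp, rfl⟩]
    · rintro _ ⟨i, hi, rfl⟩
      simp only [Set.mem_Iio] at hi
      interval_cases i <;> simp
  · intro i hi
    have hi' : i < 3 := by omega
    interval_cases i
    exacts [h₀₁, h₁₂, h₂₃]
  · intro i h1 h2
    interval_cases i
    exacts [hw, hc]
  · rintro i ⟨hi, hi'⟩ j ⟨hj, hj'⟩ hij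
    interval_cases i <;> interval_cases j <;> first | rfl | skip
    exacts [absurd hij.symm hcw, absurd hij hcw]

lemma IsShortcutTree.hasSubdivision_five (hT : IsShortcutTree ℓ T C) (hC : C.IsCycleSeq n v e)
    (h : Centre T c X Y Z) (hX : IsCherry T X c x₀ x₁) (hY : IsCherry T Y c x₂ x₃)
    (hZ : IsTwig T Z c x₄)
    (hg : g = fwd (fun x => seqLength ℓ e (seqPos v n x)) (seqLength ℓ e n) x₀)
    (h₀₁ : g x₀ < g x₁) (h₁₂ : g x₁ < g x₂) (h₂₃ : g x₂ < g x₃) (h₃₄ : g x₃ < g x₄) :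
    HasSubdivision T C := by
  subst hg
  have hc := h.notMem_leaves
  have hL := h.leaves_eq
  rw [hX.inter_leaves h.le₁ hc, hY.inter_leaves h.le₂ hc, hZ.inter_leaves h.le₃ hc] at hL
  obtain ⟨Q, w, X₁, X₂, hcw, hQ, ht, hX₁, hX₂⟩ := hX
  obtain ⟨Q', w', Y₁, Y₂, hcw', hQ', ht', hY₁, hY₂⟩ := hY
  have hw := hX₁.notMem_leaves hX₂ (ht.le₂.trans h.le₁) (ht.le₃.trans h.le₁) ht.disj₂₃
  have hw' := hY₁.notMem_leaves hY₂ (ht'.le₂.trans h.le₂) (ht'.le₃.trans h.le₂) ht'.disj₂₃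
  have hww' : w ≠ w' := fun hww => hcw
    (h.eq₁₂ (ht.le₁.vertexSet_mono ht.mem₁) (hww ▸ ht'.le₁.vertexSet_mono ht'.mem₁)).symm
  have hM : ∀ i < cycleTreeSize 5, (cycleTreeEnds 5 i).1 < 8 ∧ (cycleTreeEnds 5 i).2 < 8 := by
    decide
  have hM' : ∀ i < cycleTreeSize 5, endSet (cycleTreeEnds 5 i) ⊆ Set.Iio 8 := by
    rintro i hi _ (rfl | rfl)
    exacts [(hM i hi).1, (hM i hi).2]
  refine hT.hasSubdivision hC (k := 5) (m := 8)
    (f := fun i => [x₀, x₁, x₂, x₃, x₄, w, w', c].getD i c)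
    (P := fun i => [X₁, X₂, Y₁, Y₂, Z, Q, Q'].getD (i - 5) T) (by omega) (by omega) (fun hf => ?_)
    hM (by decide) ?_ ?_ ?_ ?_
  · have hI : {i | 5 ≤ i ∧ i < cycleTreeSize 5} =
        ({10} ∪ {5} ∪ {6}) ∪ ({11} ∪ {7} ∪ {8}) ∪ {9} := by
      ext i
      simp only [Set.mem_ofPred_eq, Set.mem_union, Set.mem_singleton_iff,
        show cycleTreeSize 5 = 12 from rfl]
      omega
    have sub : ∀ i ∈ (({10} ∪ {5} ∪ {6}) ∪ ({11} ∪ {7} ∪ {8}) ∪ {9} : Set ℕ),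
        endSet (cycleTreeEnds 5 i) ⊆ Set.Iio 8 := fun i hi => hM' i (hI.ge hi).2
    rw [hI]
    exact .tripod (c := 7) h.toTripod
      (.fork 5 10 5 6 ht hQ hX₁.2.1 hX₂.2.1 hf (hM' 10 (by decide)) (hM' 5 (by decide))
        (hM' 6 (by decide)) (Or.inr rfl) (Or.inl rfl) (Or.inl rfl))
      (.fork 6 11 7 8 ht' hQ' hY₁.2.1 hY₂.2.1 hf (hM' 11 (by decide)) (hM' 7 (by decide))
        (hM' 8 (by decide)) (Or.inr rfl) (Or.inl rfl) (Or.inl rfl))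
      (.single hZ.2.1) hf (fun i hi => sub i (Or.inl (Or.inl hi)))
      (fun i hi => sub i (Or.inl (Or.inr hi))) (fun i hi => sub i (Or.inr hi))
      ⟨10, Or.inl (Or.inl rfl), Or.inl rfl⟩ ⟨11, Or.inl (Or.inl rfl), Or.inl rfl⟩
      ⟨9, rfl, Or.inl rfl⟩
  · rw [hL]
    refine Set.Subset.antisymm ?_ ?_
    · rintro _ (((rfl | rfl) | (rfl | rfl)) | rfl)
      exacts [⟨0, by simp, rfl⟩, ⟨1, by simp, rfl⟩, ⟨2, by simp, rfl⟩, ⟨3, by simp, rfl⟩,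
        ⟨4, by simp, rfl⟩]
    · rintro _ ⟨i, hi, rfl⟩
      simp only [Set.mem_Iio] at hi
      interval_cases i <;> simp
  · intro i hi
    have hi' : i < 4 := by omega
    interval_cases i
    exacts [h₀₁, h₁₂, h₂₃, h₃₄]
  · intro i h1 h2
    interval_cases i
    exacts [hw, hw', hc]
  · rintro i ⟨hi, hi'⟩ j ⟨hj, hj'⟩ hij
    interval_cases i <;> interval_cases j <;>
      first
      | rfl
      | exact absurd hij hww'
      | exact absurd hij.symm hww'
      | exact absurd hij hcw
      | exact absurd hij.symm hcw
      | exact absurd hij hcw'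
      | exact absurd hij.symm hcw'

lemma IsShortcutTree.hasSubdivision_six (hT : IsShortcutTree ℓ T C) (hC : C.IsCycleSeq n v e)
    (h : Centre T c X Y Z) (hX : IsCherry T X c x₀ x₁) (hY : IsCherry T Y c x₂ x₃)
    (hZ : IsCherry T Z c x₄ x₅)
    (hg : g = fwd (fun x => seqLength ℓ e (seqPos v n x)) (seqLength ℓ e n) x₀)
    (h₀₁ : g x₀ < g x₁) (h₁₂ : g x₁ < g x₂) (h₂₃ : g x₂ < g x₃) (h₃₄ : g x₃ < g x₄)
    (h₄₅ : g x₄ < g x₅) : HasSubdivision T C := by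
  subst hg
  have hc := h.notMem_leaves
  have hL := h.leaves_eq
  rw [hX.inter_leaves h.le₁ hc, hY.inter_leaves h.le₂ hc, hZ.inter_leaves h.le₃ hc] at hL
  obtain ⟨Q, w, X₁, X₂, hcw, hQ, ht, hX₁, hX₂⟩ := hX
  obtain ⟨Q', w', Y₁, Y₂, hcw', hQ', ht', hY₁, hY₂⟩ := hY
  obtain ⟨R, u, Z₁, Z₂, hcu, hR, hs, hZ₁, hZ₂⟩ := hZ
  have hw := hX₁.notMem_leaves hX₂ (ht.le₂.trans h.le₁) (ht.le₃.trans h.le₁) ht.disj₂₃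
  have hw' := hY₁.notMem_leaves hY₂ (ht'.le₂.trans h.le₂) (ht'.le₃.trans h.le₂) ht'.disj₂₃
  have hu := hZ₁.notMem_leaves hZ₂ (hs.le₂.trans h.le₃) (hs.le₃.trans h.le₃) hs.disj₂₃
  have hww' : w ≠ w' := fun hww => hcw
    (h.eq₁₂ (ht.le₁.vertexSet_mono ht.mem₁) (hww ▸ ht'.le₁.vertexSet_mono ht'.mem₁)).symm
  have hwu : w ≠ u := fun hww => hcw
    (h.eq₁₃ (ht.le₁.vertexSet_mono ht.mem₁) (hww ▸ hs.le₁.vertexSet_mono hs.mem₁)).symm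
  have hw'u : w' ≠ u := fun hww => hcw'
    (h.eq₂₃ (ht'.le₁.vertexSet_mono ht'.mem₁) (hww ▸ hs.le₁.vertexSet_mono hs.mem₁)).symm
  have hM : ∀ i < cycleTreeSize 6, (cycleTreeEnds 6 i).1 < 10 ∧ (cycleTreeEnds 6 i).2 < 10 := by
    decide
  have hM' : ∀ i < cycleTreeSize 6, endSet (cycleTreeEnds 6 i) ⊆ Set.Iio 10 := by
    rintro i hi _ (rfl | rfl)
    exacts [(hM i hi).1, (hM i hi).2]
  -- Labels `6`, `7`, `8` are the vertices where the cherries split and `9` is the centre; edges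
  -- `12`, `13`, `14` are the stems.
  refine hT.hasSubdivision hC (k := 6) (m := 10)
    (f := fun i => [x₀, x₁, x₂, x₃, x₄, x₅, w, w', u, c].getD i c)
    (P := fun i => [X₁, X₂, Y₁, Y₂, Z₁, Z₂, Q, Q', R].getD (i - 6) T) (by omega) (by omega)
    (fun hf => ?_) hM (by decide) ?_ ?_ ?_ ?_
  · have hI : {i | 6 ≤ i ∧ i < cycleTreeSize 6} =
        ({12} ∪ {6} ∪ {7}) ∪ ({13} ∪ {8} ∪ {9}) ∪ ({14} ∪ {10} ∪ {11}) := by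
      ext i
      simp only [Set.mem_ofPred_eq, Set.mem_union, Set.mem_singleton_iff,
        show cycleTreeSize 6 = 15 from rfl]
      omega
    have sub : ∀ i ∈ (({12} ∪ {6} ∪ {7}) ∪ ({13} ∪ {8} ∪ {9}) ∪ ({14} ∪ {10} ∪ {11}) : Set ℕ),
        endSet (cycleTreeEnds 6 i) ⊆ Set.Iio 10 := fun i hi => hM' i (hI.ge hi).2
    rw [hI]
    exact .tripod (c := 9) h.toTripod
      (.fork 6 12 6 7 ht hQ hX₁.2.1 hX₂.2.1 hf (hM' 12 (by decide)) (hM' 6 (by decide))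
        (hM' 7 (by decide)) (Or.inr rfl) (Or.inl rfl) (Or.inl rfl))
      (.fork 7 13 8 9 ht' hQ' hY₁.2.1 hY₂.2.1 hf (hM' 13 (by decide)) (hM' 8 (by decide))
        (hM' 9 (by decide)) (Or.inr rfl) (Or.inl rfl) (Or.inl rfl))
      (.fork 8 14 10 11 hs hR hZ₁.2.1 hZ₂.2.1 hf (hM' 14 (by decide)) (hM' 10 (by decide))
        (hM' 11 (by decide)) (Or.inr rfl) (Or.inl rfl) (Or.inl rfl))
      hf (fun i hi => sub i (Or.inl (Or.inl hi)))
      (fun i hi => sub i (Or.inl (Or.inr hi))) (fun i hi => sub i (Or.inr hi))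
      ⟨12, Or.inl (Or.inl rfl), Or.inl rfl⟩ ⟨13, Or.inl (Or.inl rfl), Or.inl rfl⟩
      ⟨14, Or.inl (Or.inl rfl), Or.inl rfl⟩
  · rw [hL]
    refine Set.Subset.antisymm ?_ ?_
    · rintro _ (((rfl | rfl) | (rfl | rfl)) | (rfl | rfl))
      exacts [⟨0, by simp, rfl⟩, ⟨1, by simp, rfl⟩, ⟨2, by simp, rfl⟩, ⟨3, by simp, rfl⟩,
        ⟨4, by simp, rfl⟩, ⟨5, by simp, rfl⟩]
    · rintro _ ⟨i, hi, rfl⟩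
      simp only [Set.mem_Iio] at hi
      interval_cases i <;> simp
  · intro i hi
    have hi' : i < 5 := by omega
    interval_cases i
    exacts [h₀₁, h₁₂, h₂₃, h₃₄, h₄₅]
  · intro i h1 h2
    interval_cases i
    exacts [hw, hw', hu, hc]
  · rintro i ⟨hi, hi'⟩ j ⟨hj, hj'⟩ hij
    interval_cases i <;> interval_cases j <;>
      first
      | rfl
      | exact absurd hij hww'
      | exact absurd hij.symm hww'
      | exact absurd hij hwu
      | exact absurd hij.symm hwu
      | exact absurd hij hw'u
      | exact absurd hij.symm hw'u
      | exact absurd hij hcw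
      | exact absurd hij.symm hcw
      | exact absurd hij hcw'
      | exact absurd hij.symm hcw'
      | exact absurd hij hcu
      | exact absurd hij.symm hcu

end Graph

/-! ### The cyclic order of the leaves, and the conclusion -/

namespace Graph

variable {α β : Type*} {G H X Y Z S T C X₁ X₂ : Graph α β} {ℓ : β → ℝ} {c w x y z : α}
  {θ : α → ℝ} {K : ℝ} {n : ℕ} {v : ℕ → α} {e : ℕ → β}

lemma Centre.swap_right (h : Centre T c X Y Z) : Centre T c X Z Y := h.swap.rotate

lemma IsTwig.mem (h : IsTwig T X w x) : x ∈ T.leaves ∩ V(X) := ⟨h.2.2, h.2.1.right_mem⟩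

lemma IsCherry.left_mem (h : IsCherry T X c x y) : x ∈ T.leaves ∩ V(X) := by
  obtain ⟨Q, w, X₁, X₂, -, -, ht, h₁, -⟩ := h
  exact ⟨h₁.mem.1, ht.le₂.vertexSet_mono h₁.mem.2⟩

lemma IsCherry.right_mem (h : IsCherry T X c x y) : y ∈ T.leaves ∩ V(X) := h.symm.left_mem

lemma IsCherry.ne (h : IsCherry T X c x y) : x ≠ y := by
  obtain ⟨Q, w, X₁, X₂, -, -, ht, h₁, h₂⟩ := h
  exact fun hxy => h₁.1 (ht.eq₂₃ h₁.mem.2 (hxy ▸ h₂.mem.2)).symm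

lemma Centre.disjoint_leaves (h : Centre T c X Y Z) :
    Disjoint (T.leaves ∩ V(X)) (T.leaves ∩ V(Y)) :=
  Graph.disjoint_leaves h.notMem_leaves h.inter₁₂.le

lemma Centre.disjoint_leaves_union (h : Centre T c X Y Z) :
    Disjoint (T.leaves ∩ V(X)) (T.leaves ∩ V(Y) ∪ T.leaves ∩ V(Z)) :=
  Set.disjoint_union_right.2 ⟨h.disjoint_leaves, h.swap_right.disjoint_leaves⟩

/-- The leaves of a branch lie on an arc of the cycle that contains no other leaf. -/
lemma Centre.separate (hE : E(T).Finite)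
    (hcirc : ShortcutCircle θ K (T.length ℓ) T.leaves (Covers ℓ T)) (h : Centre T c X Y Z)
    (hx : x ∈ T.leaves ∩ V(X)) (hy : y ∈ T.leaves ∩ V(Y)) :
    ∃ q ∈ T.leaves ∩ V(X), ∀ a ∈ T.leaves ∩ V(X), ∀ b ∈ T.leaves ∩ V(Y) ∪ T.leaves ∩ V(Z),
      fwd θ K q a < fwd θ K q b :=
  hcirc.separate (by rw [← Set.union_assoc]; exact h.leaves_eq) h.disjoint_leaves_union ⟨x, hx⟩
    ⟨y, Or.inl hy⟩ (covers_of_le h.le₁ h.conn₁)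
    (covers_union hE h.le₂ h.le₃ h.conn₂ h.conn₃ h.mem₂ h.mem₃ h.disj₂₃)
    (by rw [h.toTripod.length_eq hE, add_assoc])

/-- `not_cross` for the branch `X` against the other two. It ensures that the second leaf of a
cherry does not come after leaves of a later branch. -/
lemma Centre.lt_of_between (hE : E(T).Finite)
    (hcirc : ShortcutCircle θ K (T.length ℓ) T.leaves (Covers ℓ T)) (h : Centre T c X Y Z)
    {a a' b b' : α} (ha : a ∈ T.leaves ∩ V(Y)) (ha' : a' ∈ T.leaves ∩ V(Z))
    (hb : b ∈ T.leaves ∩ V(X)) (hb' : b' ∈ T.leaves ∩ V(X)) (h₁ : θ a < θ b) (h₂ : θ b < θ a') :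
    θ b' < θ a' :=
  hcirc.not_cross (A := T.leaves ∩ V(Y) ∪ T.leaves ∩ V(Z)) (B := T.leaves ∩ V(X))
    (by rw [Set.union_comm, ← Set.union_assoc]; exact h.leaves_eq) h.disjoint_leaves_union.symm
    (covers_union hE h.le₂ h.le₃ h.conn₂ h.conn₃ h.mem₂ h.mem₃ h.disj₂₃)
    (covers_of_le h.le₁ h.conn₁)
    (by rw [h.toTripod.length_eq hE]; linarith) (Or.inl ha) (Or.inr ha') hb hb' h₁ h₂

/-- The starting point `q` of the separating arc is one of the two leaves of the cherry. Taken as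
origin, it makes this cherry come before all other leaves. -/
lemma Centre.exists_first (hE : E(T).Finite)
    (hcirc : ShortcutCircle θ K (T.length ℓ) T.leaves (Covers ℓ T)) (h : Centre T c X Y Z)
    (hX : IsCherry T X c x y) (hz : z ∈ T.leaves ∩ V(Y)) :
    ∃ a a', IsCherry T X c a a' ∧ fwd θ K a a < fwd θ K a a' ∧
      ∀ b ∈ T.leaves ∩ V(Y) ∪ T.leaves ∩ V(Z), fwd θ K a a' < fwd θ K a b := by
  obtain ⟨q, hq, hsep⟩ := h.separate hE hcirc hX.left_mem hz
  obtain ⟨q', hq'⟩ : ∃ q', IsCherry T X c q q' := by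
    rw [hX.inter_leaves h.le₁ h.notMem_leaves] at hq
    rcases hq with rfl | rfl
    exacts [⟨_, hX⟩, ⟨_, hX.symm⟩]
  have hr := hcirc.rebase hq.1
  refine ⟨q, q', hq', hr.lt_of_ne hq.1 hq'.right_mem.1 hq'.ne ?_,
    fun b hb => hsep q' hq'.right_mem b hb⟩
  rw [ShortcutCircle.fwd_self]
  exact hr.nonneg _ hq'.right_mem.1

lemma IsCherry.exists_lt (hcirc : ShortcutCircle θ K (T.length ℓ) T.leaves (Covers ℓ T))
    (h : IsCherry T X c x y) : ∃ a a', IsCherry T X c a a' ∧ θ a < θ a' := by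
  rcases le_total (θ x) (θ y) with hxy | hxy
  · exact ⟨x, y, h, hcirc.lt_of_ne h.left_mem.1 h.right_mem.1 h.ne hxy⟩
  · exact ⟨y, x, h.symm, hcirc.lt_of_ne h.right_mem.1 h.left_mem.1 h.ne.symm hxy⟩

lemma Centre.lt_or_lt (hcirc : ShortcutCircle θ K (T.length ℓ) T.leaves (Covers ℓ T))
    (h : Centre T c X Y Z) (hy : y ∈ T.leaves ∩ V(Y)) (hz : z ∈ T.leaves ∩ V(Z)) :
    θ y < θ z ∨ θ z < θ y :=
  lt_or_gt_of_ne fun hyz => Set.disjoint_left.1 h.rotate.disjoint_leaves hy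
    (hcirc.injOn hy.1 hz.1 hyz ▸ hz)

section

variable {x₀ x₁ x₂ x₃ x₄ x₅ : α}

/-- The origin is placed at the first leaf of the cherry in `X`. Of the other two cherries, the one
met first is completed before the other begins. -/
lemma Centre.hasSubdivision_six (hT : IsShortcutTree ℓ T C) (hE : E(T).Finite)
    (hC : C.IsCycleSeq n v e)
    (hcirc : ShortcutCircle (fun x => seqLength ℓ e (seqPos v n x)) (seqLength ℓ e n) (T.length ℓ)
      T.leaves (Covers ℓ T)) (h : Centre T c X Y Z) (hX : IsCherry T X c x₀ x₁)
    (hY : IsCherry T Y c x₂ x₃) (hZ : IsCherry T Z c x₄ x₅) : HasSubdivision T C := by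
  obtain ⟨a, a', hX, haa, ha⟩ := h.exists_first hE hcirc hX hY.left_mem
  have hr := hcirc.rebase hX.left_mem.1
  obtain ⟨b, b', hY, hbb⟩ := hY.exists_lt hr
  obtain ⟨z, z', hZ, hzz⟩ := hZ.exists_lt hr
  have hb := ha b (Or.inl hY.left_mem)
  have hz := ha z (Or.inr hZ.left_mem)
  rcases h.lt_or_lt hr hY.left_mem hZ.left_mem with hbz | hbz
  · exact hT.hasSubdivision_six hC h hX hY hZ rfl haa hb hbb
      (h.swap.lt_of_between hE hr hX.left_mem hZ.left_mem hY.left_mem hY.right_mem (haa.trans hb)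
        hbz) hzz
  · exact hT.hasSubdivision_six hC h.swap_right hX hZ hY rfl haa hz hzz
      (h.swap_right.swap.lt_of_between hE hr hX.left_mem hY.left_mem hZ.left_mem hZ.right_mem
        (haa.trans hz) hbz) hbb

lemma Centre.hasSubdivision_five (hT : IsShortcutTree ℓ T C) (hE : E(T).Finite)
    (hC : C.IsCycleSeq n v e)
    (hcirc : ShortcutCircle (fun x => seqLength ℓ e (seqPos v n x)) (seqLength ℓ e n) (T.length ℓ)
      T.leaves (Covers ℓ T)) (h : Centre T c X Y Z) (hX : IsCherry T X c x₀ x₁)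
    (hY : IsCherry T Y c x₂ x₃) (hZ : IsTwig T Z c x₄) : HasSubdivision T C := by
  obtain ⟨a, a', hX, haa, ha⟩ := h.exists_first hE hcirc hX hY.left_mem
  have hr := hcirc.rebase hX.left_mem.1
  obtain ⟨b, b', hY, hbb⟩ := hY.exists_lt hr
  have hb := ha b (Or.inl hY.left_mem)
  have hz := ha _ (Or.inr hZ.mem)
  rcases h.lt_or_lt hr hY.left_mem hZ.mem with hbz | hbz
  · exact hT.hasSubdivision_five hC h hX hY hZ rfl haa hb hbb
      (h.swap.lt_of_between hE hr hX.left_mem hZ.mem hY.left_mem hY.right_mem (haa.trans hb) hbz)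
  -- The twig lies between the cherries, so the order is `a`, `a'`, the leaf of `Z`, `b`, `b'`.
  -- Restarting at `b` brings both cherries to the front and the twig to the end.
  · have key : ∀ x ∈ T.leaves, fwd (fun x => seqLength ℓ e (seqPos v n x)) (seqLength ℓ e n) b x =
        fwd (fwd (fun x => seqLength ℓ e (seqPos v n x)) (seqLength ℓ e n) a)
          (seqLength ℓ e n) b x := fun x hx =>
      (fwd_fwd (hcirc.nonneg b hY.left_mem.1) (hcirc.lt b hY.left_mem.1) (hcirc.nonneg x hx)
        (hcirc.lt x hx)).symm
    have hb' := hr.lt b' hY.right_mem.1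
    have ha0 := hr.nonneg a hX.left_mem.1
    refine hT.hasSubdivision_five hC h.swap hY hX hZ rfl ?_ ?_ ?_ ?_
    · rw [key b hY.left_mem.1, key b' hY.right_mem.1, fwd_of_le le_rfl, fwd_of_le hbb.le]
      linarith
    · rw [key b' hY.right_mem.1, key a hX.left_mem.1, fwd_of_le hbb.le,
        fwd_of_lt (haa.trans hb)]
      linarith
    · rw [key a hX.left_mem.1, key a' hX.right_mem.1, fwd_of_lt (haa.trans hb), fwd_of_lt hb]
      linarith
    · rw [key a' hX.right_mem.1, key _ hZ.mem.1, fwd_of_lt hb, fwd_of_lt hbz]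
      linarith

lemma Centre.hasSubdivision_four (hT : IsShortcutTree ℓ T C) (hE : E(T).Finite)
    (hC : C.IsCycleSeq n v e)
    (hcirc : ShortcutCircle (fun x => seqLength ℓ e (seqPos v n x)) (seqLength ℓ e n) (T.length ℓ)
      T.leaves (Covers ℓ T)) (h : Centre T c X Y Z) (hX : IsCherry T X c x₀ x₁)
    (hY : IsTwig T Y c x₂) (hZ : IsTwig T Z c x₃) : HasSubdivision T C := by
  obtain ⟨a, a', hX, haa, ha⟩ := h.exists_first hE hcirc hX hY.mem
  rcases h.lt_or_lt (hcirc.rebase hX.left_mem.1) hY.mem hZ.mem with hyz | hyz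
  · exact hT.hasSubdivision_four hC h hX hY hZ rfl haa (ha _ (Or.inl hY.mem)) hyz
  · exact hT.hasSubdivision_four hC h.swap_right hX hZ hY rfl haa (ha _ (Or.inr hZ.mem)) hyz

lemma Centre.hasSubdivision_three (hT : IsShortcutTree ℓ T C) (hE : E(T).Finite)
    (hC : C.IsCycleSeq n v e)
    (hcirc : ShortcutCircle (fun x => seqLength ℓ e (seqPos v n x)) (seqLength ℓ e n) (T.length ℓ)
      T.leaves (Covers ℓ T)) (h : Centre T c X Y Z) (hX : IsTwig T X c x₀)
    (hY : IsTwig T Y c x₁) (hZ : IsTwig T Z c x₂) : HasSubdivision T C := by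
  obtain ⟨q, hq, hsep⟩ := h.separate hE hcirc hX.mem hY.mem
  have hqX := hq
  rw [hX.inter_leaves h.le₁ h.notMem_leaves] at hqX
  obtain rfl : q = x₀ := hqX
  rcases h.lt_or_lt (hcirc.rebase hX.mem.1) hY.mem hZ.mem with hyz | hyz
  · exact hT.hasSubdivision_three hC h hX hY hZ rfl (hsep _ hX.mem _ (Or.inl hY.mem)) hyz
  · exact hT.hasSubdivision_three hC h.swap_right hX hZ hY rfl
      (hsep _ hX.mem _ (Or.inr hZ.mem)) hyz

end

/-- A single vertex of `C` shows that the Steiner distance of the empty set is at most `0`, so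
without leaves (3) would give `T` negative length. -/
lemma IsShortcutTree.nonempty_leaves (hT : IsShortcutTree ℓ T C) (hTE : E(T).Finite)
    (hC : V(C).Nonempty) : T.leaves.Nonempty := by
  rw [Set.nonempty_iff_ne_empty]
  intro h0
  obtain ⟨x, hx⟩ := hC
  have h1 := hT.shorter
  rw [h0] at h1
  have h2 : C.steinerDist ℓ ∅ ≤ ((0 : ℝ) : EReal) := by
    have h := steinerDist_le (ℓ := ℓ) (G := C) (S := noEdge {x} β) (A := ∅)
      ⟨by simpa using hx, fun e a b hab => by simp at hab⟩ (isConnected_noEdge x)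
      (Set.empty_subset _)
    rwa [show (noEdge {x} β : Graph α β).length ℓ = 0 by simp [length]] at h
  have h3 : 0 ≤ T.length ℓ := by
    unfold length
    rw [finsum_mem_eq_finite_toFinset_sum _ hTE]
    exact Finset.sum_nonneg fun e he => (hT.length_pos e (Or.inl (by simpa using he))).le
  have h4 := EReal.coe_lt_coe_iff.1 (h1.trans_le h2)
  linarith

lemma IsShortcutTree.hasSubdivision_of_isCycle (hT : IsShortcutTree ℓ T C) (hTV : V(T).Finite)
    (hTE : E(T).Finite) (hC : C.IsCycle) : HasSubdivision T C := by
  obtain ⟨n, v, e, hC⟩ := hC.exists_isCycleSeq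
  have hcirc := hT.shortcutCircle hTV hTE hC
  obtain ⟨r, hr⟩ := hT.nonempty_leaves hTE hC.isConnected.1
  rcases hT.isPath_or_exists_centre hTE hcirc hr with
    ⟨x, hrx, hp, hx⟩ | ⟨c, X, Y, Z, h, hX, hY, hZ⟩
  · refine hT.hasSubdivision_two hC hrx hp hr hx ?_
    have hb := hcirc.rebase hr
    exact hb.lt_of_ne hr hx hrx (by rw [ShortcutCircle.fwd_self]; exact hb.nonneg x hx)
  -- The branches are rotated so that the cherries come before the twigs; `k` is three plus the
  -- number of cherries.
  rcases hX with ⟨x, hX⟩ | ⟨x, x', hX⟩ <;> rcases hY with ⟨y, hY⟩ | ⟨y, y', hY⟩ <;>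
    rcases hZ with ⟨z, hZ⟩ | ⟨z, z', hZ⟩
  · exact h.hasSubdivision_three hT hTE hC hcirc hX hY hZ
  · exact h.rotate.rotate.hasSubdivision_four hT hTE hC hcirc hZ hX hY
  · exact h.rotate.hasSubdivision_four hT hTE hC hcirc hY hZ hX
  · exact h.rotate.hasSubdivision_five hT hTE hC hcirc hY hZ hX
  · exact h.hasSubdivision_four hT hTE hC hcirc hX hY hZ
  · exact h.rotate.rotate.hasSubdivision_five hT hTE hC hcirc hZ hX hY
  · exact h.hasSubdivision_five hT hTE hC hcirc hX hY hZ
  · exact h.hasSubdivision_six hT hTE hC hcirc hX hY hZ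

/-- The set of leaves is the witness: `T` connects it within `T ∪ C` at a length below its Steiner
distance in `C`. -/
lemma IsShortcutTree.not_isGeodesic (hT : IsShortcutTree ℓ T C) (hTV : V(T).Finite) {k : ℕ}
    (hk : T.leaves.ncard ≤ k) : ¬ IsGeodesic ℓ k C (T ∪ C) := by
  intro hg
  have hfin : T.leaves.Finite := hTV.subset fun x hx => hx.1
  have h1 := hg T.leaves (fun x hx => (hT.vert.ge hx).2) (by
    rw [← hfin.cast_ncard_eq]
    exact_mod_cast hk)
  have h2 := hT.shorter
  rw [h1] at h2
  refine h2.not_ge (steinerDist_le ?_ ?_ ?_)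
  · exact le_union_left
  · exact hT.isTree.2.1
  · exact fun x hx => hx.1

end Graph

theorem theorem3 {α β : Type*} (T C : Graph α β) (ℓ : β → ℝ)
    (hTV : V(T).Finite) (hTE : E(T).Finite) (hC : C.IsCycle)
    (hT : Graph.IsShortcutTree ℓ T C) :
    (∃ k : ℕ, 2 ≤ k ∧ k ≤ 6 ∧ T.leaves.ncard = k ∧
      ∃ φ : Graph.Subdivision (Graph.cycleTree k) (T ∪ C),
        ∀ i ∈ E(Graph.cycleTree k), (i < k → φ.path i ≤ C) ∧ (k ≤ i → φ.path i ≤ T)) ∧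
    ¬ Graph.IsGeodesic ℓ 6 C (T ∪ C) := by
  have h := hT.hasSubdivision_of_isCycle hTV hTE hC
  refine ⟨h, ?_⟩
  obtain ⟨k, -, hk, hleaves, -⟩ := h
  exact hT.not_isGeodesic hTV (by omega)
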